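/- Let $\mathfrak g$ be a finite-dimensional simple complex Lie algebra with Killing form $k$, let $\mathfrak h\subset\mathfrak b\subset\mathfrak g$ be a Cartan and a Borel subalgebra, and let $R\supset R^+$ be the corresponding roots and positive roots. Let $\widehat{\mathfrak g}=\mathfrak g\otimes\mathbb C[t,t^{-1}]\oplus\mathbb CK\oplus\mathbb CD$ be the affine Kac–Moody algebra, with $[x\otimes t^n,y\otimes t^m]=[x,y]\otimes t^{n+m}+n\delta_{m,-n}k(x,y)K$, $K$ central and $[D,x\otimes t^n]=nx\otimes t^n$. Put $\widehat{\mathfrak h}=\mathfrak h\oplus\mathbb CK\oplus\mathbb CD$ and $\widehat{\mathfrak b}=\mathfrak g\otimes t\mathbb C[t]\oplus\mathfrak b\oplus\mathbb CK\oplus\mathbb CD$. Let $\delta\in\widehat{\mathfrak h}^\star$ be zero on $\mathfrak h\oplus\mathbb CK$ with $\delta(D)=1$, and let $\widehat R^+=R^+\cup\{\alpha+n\delta\mid\alpha\in R,n>0\}\cup\{n\delta\mid n>0\}$. Write $\mu\le\lambda$ if $\lambda-\mu\in\mathbb Z_{\ge0}\widehat R^+$. A subset $\mathcal J\subset\widehat{\mathfrak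 h}^\star$ is open if $\mu\le\lambda\in\mathcal J$ implies $\mu\in\mathcal J$, and locally bounded if $\{\gamma\in\mathcal J\mid\gamma\ge\mu\}$ is finite for all $\mu\in\widehat{\mathfrak h}^\star$. Let $A$ be a commutative Noetherian local $S(\mathfrak h)$-algebra with residue field $\mathbb K$, and let $\tau\colon\widehat{\mathfrak h}\to A$ be the structure map on $\mathfrak h$, extended by $\tau(K)=\tau(D)=0$. A $\widehat{\mathfrak g}_A$-module is an $A$-module with an $A$-linear action of $\widehat{\mathfrak g}$; its weight spaces are $M_\lambda=\{m\mid Hm=(\lambda(H)+\tau(H))m\ \text{for all}\ H\in\widehat{\mathfrak h}\}$ for $\lambda\in\widehat{\mathfrak h}^\star$. For open, locally bounded $\mathcal J$, let $\widehat{\mathcal O}_A^{\mathcal J}$ be the category of $\widehat{\mathfrak g}_A$-modules $M=\bigoplus_{\lambda}M_\lambda$ such that every element lies in a $\widehat{\mathfrak b}$-stable $A$-submodule that is finitely generated over $A$, and such that $M_\lambda\neq0$ implies $\lambda\in\mathcal J$. For $\lambda\in\widehat{\mathfrak h}^\star$ let $\Delta_{\mathbb K}(\lambda)=U(\widehat{\mathfrak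 g})\otimes_{U(\widehat{\mathfrak b})}\mathbb K_\lambda$ be the Verma module over $\mathbb K$, where $\widehat{\mathfrak h}$ acts on $\mathbb K_\lambda=\mathbb K$ by $\lambda+\tau$ and $[\widehat{\mathfrak b},\widehat{\mathfrak b}]$ acts by zero. Let $L_{\mathbb K}(\lambda)$ be its unique simple quotient, and let $L_A(\lambda)$ be $L_{\mathbb K}(\lambda)$ regarded as a $\widehat{\mathfrak g}_A$-module. For $\lambda\in\mathcal J$ let $P_A^{\mathcal J}(\lambda)\to L_A(\lambda)$ be a projective cover in $\widehat{\mathcal O}_A^{\mathcal J}$, that is, a surjection $c$ from a projective object such that every morphism $g\colon M\to P_A^{\mathcal J}(\lambda)$ in $\widehat{\mathcal O}_A^{\mathcal J}$ with $c\circ g$ surjective is itself surjective. Let $\sim_A$ be the equivalence relation on $\widehat{\mathfrak h}^\star$ generated by $\lambda\sim_A\mu$ whenever there are an open, locally bounded $\mathcal J$ containing $\lambda$ and $\mu$ and a non-zero homomorphism $P_A^{\mathcal J}(\lambda)\to P_A^{\mathcal J}(\mu)$. Let $\sim'_A$ be the equivalence relation on $\widehat{\mathfrak h}^\star$ generated by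 $\lambda\sim'_A\mu$ whenever $L_{\mathbb K}(\mu)$ is isomorphic to a subquotient of $\Delta_{\mathbb K}(\lambda)$. Then $\sim'_A=\sim_A$. -/

import Mathlib

open scoped TensorProduct

universe u v w

noncomputable section

namespace AffineKM

/-! ## The affine Kac-Moody algebra -/

section Algebra

variable (𝔤 : Type u) [LieRing 𝔤] [LieAlgebra ℂ 𝔤]

/-- The loop algebra `𝔤 ⊗ ℂ[t, t⁻¹]`. -/
def Loop : Type u := LieAlgebra.loopAlgebra ℂ ℤ 𝔤

instance : LieRing (Loop 𝔤) := inferInstanceAs (LieRing (LieAlgebra.loopAlgebra ℂ ℤ 𝔤))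

instance : LieAlgebra ℂ (Loop 𝔤) :=
  inferInstanceAs (LieAlgebra ℂ (LieAlgebra.loopAlgebra ℂ ℤ 𝔤))

/-- The finitely supported coefficient function of an element of the loop algebra. -/
def Loop.coeffs : Loop 𝔤 ≃ₗ[ℂ] (ℤ →₀ 𝔤) := LieAlgebra.LoopAlgebra.toFinsupp ℂ ℤ 𝔤

variable {𝔤}

/-- The element `x ⊗ tⁿ` of the loop algebra. -/
def tpow (n : ℤ) (x : 𝔤) : Loop 𝔤 :=
  (AddMonoidAlgebra.single n (1 : ℂ) ⊗ₜ[ℂ] x : LieAlgebra.loopAlgebra ℂ ℤ 𝔤)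

variable (𝔤)

/-- The operator `t d/dt` on the loop algebra: `x ⊗ tⁿ ↦ n x ⊗ tⁿ`. -/
def degOp : Loop 𝔤 →ₗ[ℂ] Loop 𝔤 :=
  (Loop.coeffs 𝔤).symm.toLinearMap ∘ₗ
    (Finsupp.lsum ℂ fun n : ℤ => (n : ℂ) • Finsupp.lsingle n) ∘ₗ (Loop.coeffs 𝔤).toLinearMap

/-- The cocycle `(x ⊗ tⁿ, y ⊗ tᵐ) ↦ n δ_{m,-n} k(x, y)`, with `k` the Killing form. -/
def cocyc : Loop 𝔤 →ₗ[ℂ] Loop 𝔤 →ₗ[ℂ] ℂ :=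
  LinearMap.flip (M := Loop 𝔤) (N := Loop 𝔤)
    (LieAlgebra.LoopAlgebra.residuePairing ℂ ℤ 𝔤 (killingForm ℂ 𝔤))

variable {𝔤}

@[simp] lemma coeffs_tpow (n : ℤ) (x : 𝔤) : Loop.coeffs 𝔤 (tpow n x) = Finsupp.single n x :=
  LieAlgebra.LoopAlgebra.toFinsupp_single_tmul ℂ ℤ 𝔤 n x

@[simp] lemma coeffs_symm_single (n : ℤ) (x : 𝔤) :
    (Loop.coeffs 𝔤).symm (Finsupp.single n x) = tpow n x :=
  LieAlgebra.LoopAlgebra.toFinsupp_symm_single ℂ ℤ 𝔤 n x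

@[simp] lemma degOp_tpow (n : ℤ) (x : 𝔤) : degOp 𝔤 (tpow n x) = (n : ℂ) • tpow n x := by
  simp only [degOp, LinearMap.comp_apply, LinearEquiv.coe_coe, coeffs_tpow]
  rw [Finsupp.lsum_single, LinearMap.smul_apply, Finsupp.lsingle_apply, map_smul,
    coeffs_symm_single]

@[simp] lemma cocyc_tpow (n m : ℤ) (x y : 𝔤) :
    cocyc 𝔤 (tpow n x) (tpow m y) = if m = -n then (n : ℂ) * killingForm ℂ 𝔤 x y else 0 := by
  have h : cocyc 𝔤 (tpow n x) (tpow m y) = (Loop.coeffs 𝔤 (tpow n x)).sum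
      fun a v => a • killingForm ℂ 𝔤 (Loop.coeffs 𝔤 (tpow m y) (-a)) v := rfl
  rw [h, coeffs_tpow, coeffs_tpow, Finsupp.sum_single_index (by simp)]
  split_ifs with h
  · subst h
    rw [Finsupp.single_eq_same, LieModule.traceForm_comm ℂ 𝔤 𝔤 y x, zsmul_eq_mul]
  · rw [Finsupp.single_eq_of_ne (by grind)]
    simp

@[simp] lemma tpow_lie (n m : ℤ) (x y : 𝔤) : ⁅tpow n x, tpow m y⁆ = tpow (n + m) ⁅x, y⁆ := by
  have h : ⁅tpow n x, tpow m y⁆ = ((AddMonoidAlgebra.single n (1 : ℂ) *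
      AddMonoidAlgebra.single m (1 : ℂ)) ⊗ₜ[ℂ] ⁅x, y⁆ : LieAlgebra.loopAlgebra ℂ ℤ 𝔤) := rfl
  rw [h, AddMonoidAlgebra.single_mul_single, one_mul]
  rfl

lemma loop_induction {p : Loop 𝔤 → Prop} (h0 : p 0) (ht : ∀ n x, p (tpow n x))
    (ha : ∀ a b, p a → p b → p (a + b)) (a : Loop 𝔤) : p a := by
  have key : ∀ f : ℤ →₀ 𝔤, p ((Loop.coeffs 𝔤).symm f) := by
    intro f
    induction f using Finsupp.induction_linear with
    | zero => rw [map_zero]; exact h0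
    | add f g hf hg => rw [map_add]; exact ha _ _ hf hg
    | single n x => rw [coeffs_symm_single]; exact ht n x
  rw [← (Loop.coeffs 𝔤).symm_apply_apply a]
  exact key _

lemma cocyc_swap (a b : Loop 𝔤) : cocyc 𝔤 a b = - cocyc 𝔤 b a := by
  induction a using loop_induction with
  | h0 => simp
  | ha a a' h h' =>
    simp only [map_add, LinearMap.add_apply]
    linear_combination h + h'
  | ht n x =>
    induction b using loop_induction with
    | h0 => simp
    | ha b b' h h' =>
      simp only [map_add, LinearMap.add_apply]
      linear_combination h + h'
    | ht m y =>
      simp only [cocyc_tpow]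
      by_cases h : m = -n
      · subst h
        rw [if_pos rfl, if_pos (by simp), LieModule.traceForm_comm ℂ 𝔤 𝔤 y x]
        push_cast
        ring
      · rw [if_neg h, if_neg (by grind), neg_zero]

lemma cocyc_self (a : Loop 𝔤) : cocyc 𝔤 a a = 0 := by
  have h := cocyc_swap a a
  linear_combination h / 2

lemma degOp_lie (a b : Loop 𝔤) : degOp 𝔤 ⁅a, b⁆ = ⁅degOp 𝔤 a, b⁆ + ⁅a, degOp 𝔤 b⁆ := by
  induction a using loop_induction with
  | h0 => simp
  | ha a a' h h' => simp only [add_lie, map_add, h, h']; abel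
  | ht n x =>
    induction b using loop_induction with
    | h0 => simp
    | ha b b' h h' => simp only [lie_add, map_add, h, h']; abel
    | ht m y => simp [add_smul]

lemma cocyc_degOp (a b : Loop 𝔤) : cocyc 𝔤 (degOp 𝔤 a) b + cocyc 𝔤 a (degOp 𝔤 b) = 0 := by
  induction a using loop_induction with
  | h0 => simp
  | ha a a' h h' =>
    simp only [map_add, LinearMap.add_apply]
    linear_combination h + h'
  | ht n x =>
    induction b using loop_induction with
    | h0 => simp
    | ha b b' h h' =>
      simp only [map_add]
      linear_combination h + h'
    | ht m y =>
      simp only [degOp_tpow, map_smul, LinearMap.smul_apply, cocyc_tpow, smul_eq_mul]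
      split_ifs with h
      · subst h; push_cast; ring
      · ring

lemma cocyc_lie (a b c : Loop 𝔤) :
    cocyc 𝔤 a ⁅b, c⁆ = cocyc 𝔤 ⁅a, b⁆ c + cocyc 𝔤 b ⁅a, c⁆ := by
  induction a using loop_induction with
  | h0 => simp
  | ha a a' h h' =>
    simp only [add_lie, map_add, LinearMap.add_apply]
    linear_combination h + h'
  | ht n x =>
    induction b using loop_induction with
    | h0 => simp
    | ha b b' h h' =>
      simp only [add_lie, lie_add, map_add, LinearMap.add_apply]
      linear_combination h + h'
    | ht m y =>
      induction c using loop_induction with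
      | h0 => simp
      | ha c c' h h' =>
        simp only [lie_add, map_add]
        linear_combination h + h'
      | ht l z =>
        simp only [tpow_lie, cocyc_tpow]
        by_cases h : n + m + l = 0
        · rw [if_pos (by grind), if_pos (by grind), if_pos (by grind)]
          have e1 : killingForm ℂ 𝔤 ⁅x, y⁆ z = killingForm ℂ 𝔤 x ⁅y, z⁆ :=
            LieModule.traceForm_apply_lie_apply ℂ 𝔤 𝔤 x y z
          have e2 : killingForm ℂ 𝔤 y ⁅x, z⁆ = - killingForm ℂ 𝔤 x ⁅y, z⁆ := by
            rw [← e1, ← lie_skew x y, map_neg, LinearMap.neg_apply, neg_neg]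
            exact (LieModule.traceForm_apply_lie_apply ℂ 𝔤 𝔤 y x z).symm
          rw [e1, e2]
          push_cast
          ring
        · rw [if_neg (by grind), if_neg (by grind), if_neg (by grind)]
          ring

variable (𝔤)

/-- The affine Kac-Moody algebra `𝔤 ⊗ ℂ[t, t⁻¹] ⊕ ℂ K ⊕ ℂ D`; the element
`a + c K + d D` has the components `a`, `c` and `d`. -/
@[ext] structure Affine where
  /-- The component in the loop algebra. -/
  loop : Loop 𝔤
  /-- The coefficient of the central element `K`. -/
  cen : ℂ
  /-- The coefficient of the derivation `D`. -/
  der : ℂ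

namespace Affine

variable {𝔤}

/-- The underlying vector space is the direct sum of the three components. -/
def toProd : Affine 𝔤 ≃ Loop 𝔤 × ℂ × ℂ where
  toFun x := (x.loop, x.cen, x.der)
  invFun x := ⟨x.1, x.2.1, x.2.2⟩
  left_inv _ := rfl
  right_inv _ := rfl

instance : AddCommGroup (Affine 𝔤) := toProd.addCommGroup

instance : Module ℂ (Affine 𝔤) := toProd.module ℂ

@[simp] lemma add_loop (x y : Affine 𝔤) : (x + y).loop = x.loop + y.loop := rfl
@[simp] lemma add_cen (x y : Affine 𝔤) : (x + y).cen = x.cen + y.cen := rfl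
@[simp] lemma add_der (x y : Affine 𝔤) : (x + y).der = x.der + y.der := rfl
@[simp] lemma zero_loop : (0 : Affine 𝔤).loop = 0 := rfl
@[simp] lemma zero_cen : (0 : Affine 𝔤).cen = 0 := rfl
@[simp] lemma zero_der : (0 : Affine 𝔤).der = 0 := rfl
@[simp] lemma smul_loop (r : ℂ) (x : Affine 𝔤) : (r • x).loop = r • x.loop := rfl
@[simp] lemma smul_cen (r : ℂ) (x : Affine 𝔤) : (r • x).cen = r * x.cen := rfl
@[simp] lemma smul_der (r : ℂ) (x : Affine 𝔤) : (r • x).der = r * x.der := rfl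

/-- `[a + c K + d D, a' + c' K + d' D] = [a, a'] + d D(a') - d' D(a) + ω(a, a') K`,
where `D` acts as `t d/dt` and `ω` is the cocycle. -/
instance : Bracket (Affine 𝔤) (Affine 𝔤) where
  bracket x y :=
    ⟨⁅x.loop, y.loop⁆ + x.der • degOp 𝔤 y.loop - y.der • degOp 𝔤 x.loop,
      cocyc 𝔤 x.loop y.loop, 0⟩

@[simp] lemma lie_loop (x y : Affine 𝔤) : ⁅x, y⁆.loop =
    ⁅x.loop, y.loop⁆ + x.der • degOp 𝔤 y.loop - y.der • degOp 𝔤 x.loop := rfl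
@[simp] lemma lie_cen (x y : Affine 𝔤) : ⁅x, y⁆.cen = cocyc 𝔤 x.loop y.loop := rfl
@[simp] lemma lie_der (x y : Affine 𝔤) : ⁅x, y⁆.der = 0 := rfl

instance : LieRing (Affine 𝔤) where
  add_lie x y z := by
    ext
    · simp only [lie_loop, add_loop, add_der, add_lie, map_add, add_smul, smul_add]; abel
    · simp
    · simp
  lie_add x y z := by
    ext
    · simp only [lie_loop, add_loop, add_der, lie_add, map_add, add_smul, smul_add]; abel
    · simp
    · simp
  lie_self x := by
    ext
    · simp
    · simp [cocyc_self]
    · simp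
  leibniz_lie x y z := by
    ext
    · simp only [lie_loop, lie_der, add_loop, lie_add, add_lie, lie_sub, sub_lie, map_add,
        map_sub, map_smul, degOp_lie, lie_smul, smul_lie, smul_add, smul_sub, zero_smul,
        leibniz_lie x.loop y.loop z.loop]
      rw [smul_comm x.der y.der, smul_comm x.der z.der, smul_comm y.der z.der,
        ← lie_skew (degOp 𝔤 x.loop) y.loop, smul_neg]
      abel
    · simp only [lie_cen, lie_loop, add_cen, map_add, map_sub, map_smul, LinearMap.add_apply,
        LinearMap.sub_apply, LinearMap.smul_apply, smul_eq_mul]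
      rw [cocyc_lie x.loop y.loop z.loop]
      have h1 := cocyc_degOp x.loop z.loop
      have h2 := cocyc_degOp x.loop y.loop
      have h3 := cocyc_degOp y.loop z.loop
      have h4 := cocyc_swap y.loop (degOp 𝔤 x.loop)
      linear_combination y.der * h1 - z.der * h2 - x.der * h3 + z.der * h4
    · simp

instance : LieAlgebra ℂ (Affine 𝔤) where
  lie_smul r x y := by
    ext
    · simp only [lie_loop, smul_loop, smul_der, lie_smul, map_smul, smul_add, smul_sub, mul_smul]
      rw [smul_comm x.der r]
    · simp
    · simp

end Affine

end Algebra

/-! ## Cartan subalgebra, roots, and the order on weights -/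

section Roots

variable {𝔤 : Type u} [LieRing 𝔤] [LieAlgebra ℂ 𝔤]

/-- The Cartan subalgebra `𝔥 ⊕ ℂ K ⊕ ℂ D` of the affine algebra. -/
abbrev CartanHat (H : LieSubalgebra ℂ 𝔤) : Type u := H × ℂ × ℂ

/-- The inclusion of the affine Cartan subalgebra: `(h, c, d) ↦ h ⊗ 1 + c K + d D`. -/
def cartanIncl {H : LieSubalgebra ℂ 𝔤} (h : CartanHat H) : Affine 𝔤 :=
  ⟨tpow 0 (h.1 : 𝔤), h.2.1, h.2.2⟩

/-- The dual of the affine Cartan subalgebra. -/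
abbrev WeightHat (H : LieSubalgebra ℂ 𝔤) : Type u := Module.Dual ℂ (CartanHat H)

/-- The weight `δ`, zero on `𝔥 ⊕ ℂ K` and with value `1` at `D`. -/
def delta (H : LieSubalgebra ℂ 𝔤) : WeightHat H :=
  LinearMap.snd ℂ ℂ ℂ ∘ₗ LinearMap.snd ℂ H (ℂ × ℂ)

/-- A linear form on `𝔥`, extended by zero on `K` and `D`. -/
def extendForm {H : LieSubalgebra ℂ 𝔤} (α : Module.Dual ℂ H) : WeightHat H :=
  α ∘ₗ LinearMap.fst ℂ H (ℂ × ℂ)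

variable [FiniteDimensional ℂ 𝔤] [LieAlgebra.IsKilling ℂ 𝔤]
  {H : LieSubalgebra ℂ 𝔤} [H.IsCartanSubalgebra]

/-- The positive affine roots, for the positive system of `𝔤` given by a base:
`α` with `α` positive, `α + n δ` with `α` any root and `n > 0`, and `n δ` with `n > 0`. -/
def posRoots (b : (LieAlgebra.IsKilling.rootSystem H).Base) : Set (WeightHat H) :=
  {β | (∃ i, b.IsPos i ∧ β = extendForm ((LieAlgebra.IsKilling.rootSystem H).root i)) ∨
    (∃ i, ∃ n : ℕ, 0 < n ∧
      β = extendForm ((LieAlgebra.IsKilling.rootSystem H).root i) + n • delta H) ∨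
    (∃ n : ℕ, 0 < n ∧ β = n • delta H)}

/-- The order on weights: `μ ≤ lam` iff `lam - μ` is a sum of positive affine roots. -/
def wLE (b : (LieAlgebra.IsKilling.rootSystem H).Base) (μ lam : WeightHat H) : Prop :=
  lam - μ ∈ AddSubmonoid.closure (posRoots b)

/-- Open sets of weights: closed under passing to smaller weights. -/
def IsOpenSet (b : (LieAlgebra.IsKilling.rootSystem H).Base) (J : Set (WeightHat H)) : Prop :=
  ∀ lam ∈ J, ∀ μ, wLE b μ lam → μ ∈ J

/-- Locally bounded sets of weights. -/
def IsLocallyBounded (b : (LieAlgebra.IsKilling.rootSystem H).Base) (J : Set (WeightHat H)) :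
    Prop :=
  ∀ μ, {γ ∈ J | wLE b μ γ}.Finite

/-- The sum of the root spaces of all positive affine roots:
`𝔤 ⊗ t ℂ[t]` plus the `𝔤_α ⊗ 1` with `α` a positive root. -/
def nilHat (b : (LieAlgebra.IsKilling.rootSystem H).Base) : Submodule ℂ (Affine 𝔤) :=
  Submodule.span ℂ
    ({z | ∃ n : ℤ, 0 < n ∧ ∃ x : 𝔤, z = ⟨tpow n x, 0, 0⟩} ∪
      {z | ∃ i, b.IsPos i ∧ ∃ x ∈ LieAlgebra.rootSpace H (i.1 : H → ℂ), z = ⟨tpow 0 x, 0, 0⟩})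

/-- The affine Borel subalgebra `𝔤 ⊗ t ℂ[t] ⊕ 𝔟 ⊕ ℂ K ⊕ ℂ D`, with `𝔟 ⊆ 𝔤` the Borel subalgebra
containing `𝔥` that is given by the base. -/
def borelHat (b : (LieAlgebra.IsKilling.rootSystem H).Base) : Submodule ℂ (Affine 𝔤) :=
  Submodule.span ℂ (Set.range (cartanIncl (H := H))) ⊔ nilHat b

end Roots

/-! ## Deformed modules

A deformation algebra is a commutative Noetherian algebra `A` over `S(𝔥)`. An `A`-module with an
`A`-linear action of the affine algebra is the same as a module over `A ⊗ U`, where `U` is the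
universal enveloping algebra. -/

section Modules

variable {𝔤 : Type u} [LieRing 𝔤] [LieAlgebra ℂ 𝔤]

/-- The algebra `A ⊗ U`, `U` the universal enveloping algebra of the affine algebra. -/
abbrev UA (𝔤 : Type u) [LieRing 𝔤] [LieAlgebra ℂ 𝔤] (A : Type v) [CommRing A] [Algebra ℂ A] :
    Type (max u v) :=
  A ⊗[ℂ] UniversalEnvelopingAlgebra ℂ (Affine 𝔤)

/-- The image in `A ⊗ U` of an element of the affine algebra. -/
def inc (A : Type v) [CommRing A] [Algebra ℂ A] (x : Affine 𝔤) : UA 𝔤 A :=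
  1 ⊗ₜ[ℂ] UniversalEnvelopingAlgebra.ι ℂ x

/-- The value `lam(h) + τ(h)` in `A`. Here `τ` is the structure map on `𝔥`, and it is zero on
`K` and `D`. -/
def charVal {H : LieSubalgebra ℂ 𝔤} (A : Type v) [CommRing A] [Algebra ℂ A]
    [Algebra (SymmetricAlgebra ℂ H) A] (lam : WeightHat H) (h : CartanHat H) : A :=
  algebraMap ℂ A (lam h) +
    algebraMap (SymmetricAlgebra ℂ H) A (SymmetricAlgebra.ι ℂ H h.1)

variable (H : LieSubalgebra ℂ 𝔤) (A : Type v) [CommRing A] [Algebra ℂ A]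
  [Algebra (SymmetricAlgebra ℂ H) A]

section Objects

variable (M : Type w) [AddCommGroup M] [Module A M] [Module (UA 𝔤 A) M]
  [IsScalarTower A (UA 𝔤 A) M]

variable {H} in
/-- The (deformed) weight space `{m | h m = (lam(h) + τ(h)) m for all h}`. -/
def weightSpace (lam : WeightHat H) : Submodule A M where
  carrier := {m | ∀ h : CartanHat H, inc A (cartanIncl h) • m = charVal A lam h • m}
  add_mem' := by
    intro m n hm hn h
    rw [smul_add, smul_add, hm h, hn h]
  zero_mem' := by
    intro h
    rw [smul_zero, smul_zero]
  smul_mem' := by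
    intro a m hm h
    have : SMulCommClass A (UA 𝔤 A) M := IsScalarTower.to_smulCommClass
    rw [← smul_comm, hm h, smul_comm]

/-- `M` is the direct sum of its weight spaces. -/
def IsWeightModule : Prop :=
  iSupIndep (fun lam : WeightHat H => weightSpace A M lam) ∧
    ⨆ lam : WeightHat H, weightSpace A M lam = ⊤

end Objects

variable {H} [FiniteDimensional ℂ 𝔤] [LieAlgebra.IsKilling ℂ 𝔤] [H.IsCartanSubalgebra]
  (b : (LieAlgebra.IsKilling.rootSystem H).Base)

/-- Every element lies in a finitely generated `A`-submodule that is stable under the affine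
Borel subalgebra. -/
def IsLocallyBorelFinite (M : Type w) [AddCommGroup M] [Module A M] [Module (UA 𝔤 A) M]
    [IsScalarTower A (UA 𝔤 A) M] : Prop :=
  ∀ m : M, ∃ N : Submodule A M, m ∈ N ∧ N.FG ∧
    ∀ x ∈ borelHat b, ∀ n ∈ N, inc A x • n ∈ N

/-- Membership in the truncated deformed category `𝒪`: locally Borel-finite weight modules all of
whose weights lie in `J`. -/
structure InCatO (J : Set (WeightHat H)) (M : Type w) [AddCommGroup M] [Module A M]
    [Module (UA 𝔤 A) M] [IsScalarTower A (UA 𝔤 A) M] : Prop where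
  isWeight : IsWeightModule H A M
  locallyFinite : IsLocallyBorelFinite A b M
  weights : ∀ lam : WeightHat H, weightSpace A M lam ≠ ⊥ → lam ∈ J

/-- The left ideal of `A ⊗ U` generated by the `x` in `nilHat` and by the
`h - (lam(h) + τ(h))` with `h` in the Cartan subalgebra. -/
def vermaIdeal (lam : WeightHat H) : Submodule (UA 𝔤 A) (UA 𝔤 A) :=
  Submodule.span (UA 𝔤 A)
    ({z | ∃ x ∈ nilHat b, z = inc A x} ∪
      {z | ∃ h : CartanHat H,
        z = inc A (cartanIncl h) - algebraMap A (UA 𝔤 A) (charVal A lam h)})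

/-- The deformed Verma module: the module induced from the rank one module of the Borel subalgebra
on which the Cartan subalgebra acts by `lam + τ` and `nilHat` acts by zero. -/
abbrev Verma (lam : WeightHat H) : Type (max u v) := UA 𝔤 A ⧸ vermaIdeal A b lam

/-- The quotient of the Verma module by the sum of its proper submodules, used over a field. -/
abbrev SimpleQuot (lam : WeightHat H) : Type (max u v) :=
  Verma A b lam ⧸ sSup {N : Submodule (UA 𝔤 A) (Verma A b lam) | N ≠ ⊤}

/-- `L` is isomorphic to a subquotient of `M`. -/
def IsSubquotient (R : Type*) [Ring R] (L M : Type*) [AddCommGroup L] [Module R L]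
    [AddCommGroup M] [Module R M] : Prop :=
  ∃ (X : Submodule R M) (Y : Submodule R X), Nonempty ((X ⧸ Y) ≃ₗ[R] L)

variable [IsLocalRing A]

/-- The map `A ⊗ U → 𝕂 ⊗ U`, with `𝕂` the residue field of the local ring `A`. -/
def residueMap (𝔤 : Type u) [LieRing 𝔤] [LieAlgebra ℂ 𝔤] (A : Type v) [CommRing A] [Algebra ℂ A]
    [IsLocalRing A] : UA 𝔤 A →ₐ[ℂ] UA 𝔤 (IsLocalRing.ResidueField A) :=
  Algebra.TensorProduct.map (IsScalarTower.toAlgHom ℂ A (IsLocalRing.ResidueField A))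
    (AlgHom.id ℂ _)

/-- The simple module `L_A(lam)`: the simple quotient of the Verma module over the residue field,
viewed as a module over `A ⊗ U`. -/
def SimpleMod (lam : WeightHat H) : Type (max u v) :=
  SimpleQuot (IsLocalRing.ResidueField A) b lam

instance (lam : WeightHat H) : AddCommGroup (SimpleMod A b lam) :=
  inferInstanceAs (AddCommGroup (SimpleQuot (IsLocalRing.ResidueField A) b lam))

instance (lam : WeightHat H) : Module (UA 𝔤 A) (SimpleMod A b lam) :=
  Module.compHom (SimpleQuot (IsLocalRing.ResidueField A) b lam) (residueMap 𝔤 A).toRingHom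

/-- `c : P → L_A(μ)` is a projective cover in the truncated category `𝒪`. -/
structure IsProjCover (J : Set (WeightHat H)) (μ : WeightHat H)
    (P : Type (max u v)) [AddCommGroup P] [Module A P] [Module (UA 𝔤 A) P]
    [IsScalarTower A (UA 𝔤 A) P] (c : P →ₗ[UA 𝔤 A] SimpleMod A b μ) : Prop where
  mem : InCatO A b J P
  projective : ∀ (M N : Type (max u v)) [AddCommGroup M] [Module A M] [Module (UA 𝔤 A) M]
    [IsScalarTower A (UA 𝔤 A) M] [AddCommGroup N] [Module A N] [Module (UA 𝔤 A) N]
    [IsScalarTower A (UA 𝔤 A) N], InCatO A b J M → InCatO A b J N →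
    ∀ (p : M →ₗ[UA 𝔤 A] N) (f : P →ₗ[UA 𝔤 A] N), Function.Surjective p →
      ∃ f' : P →ₗ[UA 𝔤 A] M, p ∘ₗ f' = f
  surjective : Function.Surjective c
  essential : ∀ (M : Type (max u v)) [AddCommGroup M] [Module A M] [Module (UA 𝔤 A) M]
    [IsScalarTower A (UA 𝔤 A) M], InCatO A b J M →
    ∀ g : M →ₗ[UA 𝔤 A] P, Function.Surjective (c ∘ₗ g) → Function.Surjective g

/-- For some open, locally bounded `J` there is a nonzero homomorphism from a projective cover
of `L_A(lam)` to a projective cover of `L_A(μ)` in the category truncated at `J`. -/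
def ProjLinked (lam μ : WeightHat H) : Prop :=
  ∃ J : Set (WeightHat H), IsOpenSet b J ∧ IsLocallyBounded b J ∧ lam ∈ J ∧ μ ∈ J ∧
    ∃ (P : Type (max u v)) (_ : AddCommGroup P) (_ : Module A P) (_ : Module (UA 𝔤 A) P)
      (_ : IsScalarTower A (UA 𝔤 A) P) (c : P →ₗ[UA 𝔤 A] SimpleMod A b lam)
      (Q : Type (max u v)) (_ : AddCommGroup Q) (_ : Module A Q) (_ : Module (UA 𝔤 A) Q)
      (_ : IsScalarTower A (UA 𝔤 A) Q) (d : Q →ₗ[UA 𝔤 A] SimpleMod A b μ),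
      IsProjCover A b J lam P c ∧ IsProjCover A b J μ Q d ∧
        ∃ f : P →ₗ[UA 𝔤 A] Q, f ≠ 0

/-- The block relation: the equivalence relation generated by `ProjLinked`. -/
def blockRel : Setoid (WeightHat H) := Relation.EqvGen.setoid (ProjLinked A b)

/-- `L_𝕂(μ)` occurs as a subquotient of the Verma module with highest weight `lam` over the
residue field `𝕂` of `A`. -/
def VermaLinked (lam μ : WeightHat H) : Prop :=
  IsSubquotient (UA 𝔤 (IsLocalRing.ResidueField A))
    (SimpleQuot (IsLocalRing.ResidueField A) b μ) (Verma (IsLocalRing.ResidueField A) b lam)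

/-- The equivalence relation generated by `VermaLinked`. -/
def vermaRel : Setoid (WeightHat H) := Relation.EqvGen.setoid (VermaLinked A b)

end Modules

end AffineKM

end

noncomputable section

namespace AffineKM

/-! ## The Chevalley anti-involution of a simple Lie algebra -/

section Chevalley

open LieAlgebra LieAlgebra.IsKilling LieModule Module

variable {K L : Type*} [Field K] [CharZero K] [LieRing L] [LieAlgebra K L]
  [IsKilling K L] [FiniteDimensional K L]
  {H : LieSubalgebra K L} [H.IsCartanSubalgebra] [IsTriangularizable K H L]

/-! Let 𝔪 be the maximal ideal of `A`, and write Δ, L for Verma and simple modules over the residue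
field and P for projective covers over `A`. Each generating pair of one relation is shown to lie in
the equivalence relation generated by the other. The argument uses neither Verma flags of P nor
reciprocity.

Let L(μ) be a quotient of a submodule X of Δ(λ). Truncate at the weights ≤ λ, an open and locally
bounded set. Then P(λ) → L(λ) lifts to Δ(λ), and the lift is onto because all proper submodules of
Δ(λ) lie in one proper submodule. The cover P(μ) → L(μ) lifts to X, and P(μ) → X ⊆ Δ(λ) lifts along
P(λ) → Δ(λ) to a nonzero map P(μ) → P(λ) (`projLinked_of_vermaLinked`). This needs projective covers
(`hasProjCover`), which are split off from the object representing weight vectors of a given weight.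

Conversely, let f : P(λ) → P(μ) be nonzero, p a generator of P(λ) of weight λ, and Z ⊆ P(μ) maximal
among the submodules avoiding f(p). In M = P(μ)/Z every nonzero submodule contains the image x of
f(p), and every proper submodule lies in the kernel of M → L(μ). Let γ ≥ λ be a maximal weight of M.
Both L(λ) and L(μ) occur in Δ(γ) (`exists_vermaLinked_of_projLinked`): For L(λ), if no 𝔪ⁿM were
zero, x would lie in every 𝔪ⁿM_λ, against Krull's intersection theorem. So M_γ has a nonzero vector
killed by 𝔪, which gives a nonzero map Δ(γ) → M. Its image contains x, hence the image of P(λ),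
which has L(λ) as a quotient. For L(μ), pass to the contragredient dual of M
(`vermaLinked_of_maximal`). A functional supported on M_γ is a highest weight vector there, and the
submodule it generates contains the functionals that factor through M → L(μ), by double annihilation
in the weight space M_μ.

The dual requires an anti-automorphism σ of the affine algebra that fixes the Cartan subalgebra; it
comes from a Chevalley involution of 𝔤. The finiteness statements rest on the triangular
decomposition, graded by an integral height on positive affine roots: cyclic weight modules in the
truncated category have finitely generated weight spaces (`weightSpace_span_fg`). -/

lemma exists_smul_eq_of_mem_rootSpace {α : Weight K H L} (hα : α.IsNonZero) {x y : L}
    (hx : x ∈ rootSpace H α) (hx0 : x ≠ 0) (hy : y ∈ rootSpace H α) : ∃ c : K, c • x = y := by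
  obtain ⟨c, hc⟩ := (finrank_eq_one_iff_of_nonzero' (⟨x, hx⟩ : rootSpace H α)
    (by simpa using hx0)).mp (finrank_rootSpace_eq_one α hα) ⟨y, hy⟩
  exact ⟨c, by simpa using congrArg Subtype.val hc⟩

/-- The bracket of nonzero root vectors is nonzero if the sum of the roots is a root. -/
lemma lie_ne_zero_of_rootSpace_add_ne_bot {α β : Weight K H L} (hα : α.IsNonZero)
    (hβ : β.IsNonZero) {x y : L} (hx : x ∈ rootSpace H α) (hx0 : x ≠ 0)
    (hy : y ∈ rootSpace H β) (hy0 : y ≠ 0)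
    (hαβ : rootSpace H ((α : H → K) + β) ≠ ⊥) : ⁅x, y⁆ ≠ 0 := by
  obtain ⟨h, e, f, isSl2, he, hf⟩ := exists_isSl2Triple_of_weight_isNonZero hα
  -- A vector `t` at the top of the `α`-string through `β` is primitive for the `sl₂` of `α`;
  -- lowering it reaches the root space of `β`.
  obtain ⟨t, ht, t_ne0⟩ := (chainTop α β).exists_ne_zero
  obtain rfl := isSl2.h_eq_coroot hα he hf
  have prim : isSl2.HasPrimitiveVectorWith t (chainLength α β : K) :=
    have := lie_mem_genWeightSpace_of_mem_genWeightSpace he ht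
    ⟨t_ne0, (chainLength_smul _ _ ht).symm, by rwa [genWeightSpace_add_chainTop _ _ hα] at this⟩
  have hk : 1 ≤ chainTopCoeff α β := by
    have := (rootSpace_zsmul_add_ne_bot_iff α β hα 1).mp (by rwa [one_smul])
    exact_mod_cast this.1
  obtain ⟨k, hk⟩ := Nat.exists_eq_add_of_le' hk
  have hle : k + 1 ≤ chainLength α β := hk ▸ chainTopCoeff_le_chainLength α β
  have hmem := toEnd_pow_apply_mem hf ht (k + 1)
  have hwt : ((k + 1) • (-α : H → K) + chainTop α β : H → K) = β := by
    rw [coe_chainTop', hk]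
    simp
  rw [hwt] at hmem
  have hne := prim.pow_toEnd_f_ne_zero_of_eq_nat rfl hle
  obtain ⟨c, rfl⟩ := exists_smul_eq_of_mem_rootSpace hα he isSl2.e_ne_zero hx
  obtain ⟨d, rfl⟩ := exists_smul_eq_of_mem_rootSpace hβ hmem hne hy
  have hc : c ≠ 0 := by rintro rfl; simp at hx0
  have hd : d ≠ 0 := by rintro rfl; simp at hy0
  -- `e f^(k+1) t = (k + 1)(n - k) f^k t` with `n` the length of the string, and `k < n`.
  rw [smul_lie, lie_smul, prim.lie_e_pow_succ_toEnd_f]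
  have h1 : ((k : K) + 1) ≠ 0 := by exact_mod_cast Nat.succ_ne_zero k
  have h2 : ((chainLength α β : K) - k) ≠ 0 := by
    rw [sub_ne_zero]
    exact_mod_cast (show chainLength α β ≠ k by omega)
  exact smul_ne_zero hc (smul_ne_zero hd (smul_ne_zero (mul_ne_zero h1 h2)
    (prim.pow_toEnd_f_ne_zero_of_eq_nat rfl (by omega))))

/-- A subalgebra containing the root spaces of the simple roots contains those of all
positive roots. -/
lemma rootSpace_le_of_simple (b : (rootSystem H).Base) (S : LieSubalgebra K L)
    (hS : ∀ i ∈ b.support, ∀ x ∈ rootSpace H (i.1 : H → K), x ∈ S) {i : H.root} (hi : b.IsPos i) :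
    ∀ x ∈ rootSpace H (i.1 : H → K), x ∈ S := by
  refine hi.induction_on_add hS fun i j k hk ih hj x hx => ?_
  have hkf : (k.1 : H → K) = (j.1 : H → K) + i.1 := by
    ext h
    have := LinearMap.congr_fun hk h
    simp only [rootSystem_root_apply, Weight.toLinear_apply, LinearMap.add_apply] at this
    simpa [add_comm] using this
  obtain ⟨y, hy, hy0⟩ := i.1.exists_ne_zero
  obtain ⟨z, hz, hz0⟩ := j.1.exists_ne_zero
  -- Root spaces are lines, so one nonzero bracket spans the root space of the sum.
  have h0 := lie_ne_zero_of_rootSpace_add_ne_bot (H.isNonZero_coe_root j) (H.isNonZero_coe_root i)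
    hz hz0 hy hy0 (hkf ▸ k.1.genWeightSpace_ne_bot)
  have hmem := lie_mem_genWeightSpace_of_mem_genWeightSpace hz hy
  rw [← hkf] at hmem
  obtain ⟨c, rfl⟩ := exists_smul_eq_of_mem_rootSpace (H.isNonZero_coe_root k) hmem h0 hx
  exact S.smul_mem c (S.lie_mem (hS j hj z hz) (ih y hy))

/-- Mirror image of `rootSpace_le_of_simple`, with all roots negated. -/
lemma rootSpace_neg_le_of_simple (b : (rootSystem H).Base) (S : LieSubalgebra K L)
    (hS : ∀ i ∈ b.support, ∀ x ∈ rootSpace H (-(i.1 : H → K)), x ∈ S) {i : H.root}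
    (hi : b.IsPos i) : ∀ x ∈ rootSpace H (-(i.1 : H → K)), x ∈ S := by
  refine hi.induction_on_add hS fun i j k hk ih hj x hx => ?_
  have hkf : (-k.1 : H → K) = (-j.1 : H → K) + -i.1 := by
    ext h
    have := LinearMap.congr_fun hk h
    simp only [rootSystem_root_apply, Weight.toLinear_apply, LinearMap.add_apply] at this
    simp [this, add_comm]
  obtain ⟨y, hy, hy0⟩ := (-i.1).exists_ne_zero
  obtain ⟨z, hz, hz0⟩ := (-j.1).exists_ne_zero
  have h0 := lie_ne_zero_of_rootSpace_add_ne_bot (H.isNonZero_coe_root j).neg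
    (H.isNonZero_coe_root i).neg hz hz0 hy hy0 (by
      simp only [Weight.coe_neg]
      rw [← hkf]; exact (-k.1).genWeightSpace_ne_bot)
  have hmem := lie_mem_genWeightSpace_of_mem_genWeightSpace hz hy
  simp only [Weight.coe_neg] at hmem
  rw [← hkf] at hmem
  obtain ⟨c, rfl⟩ := exists_smul_eq_of_mem_rootSpace (α := -k.1) (H.isNonZero_coe_root k).neg
    (by simpa using hmem) h0 (by simpa using hx)
  exact S.smul_mem c (S.lie_mem (hS j hj z (by simpa using hz)) (ih y (by simpa using hy)))

variable (H) in
/-- An `sl₂`-triple for each root. -/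
lemma exists_sl2_of_root (i : H.root) : ∃ e f : L,
    IsSl2Triple (coroot i.1 : L) e f ∧ e ∈ rootSpace H i.1 ∧ f ∈ rootSpace H (-(i.1 : H → K)) := by
  obtain ⟨h, e, f, ht, he, hf⟩ :=
    exists_isSl2Triple_of_weight_isNonZero (H.isNonZero_coe_root i)
  obtain rfl := ht.h_eq_coroot (H.isNonZero_coe_root i) he hf
  exact ⟨e, f, ht, he, hf⟩

/-- The Lie algebra is spanned by the Cartan subalgebra and the root spaces of the positive and
the negative roots. -/
lemma cartan_root_induction (b : (rootSystem H).Base) (S : Submodule K L)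
    (h0 : ∀ h : H, (h : L) ∈ S)
    (hpos : ∀ i, b.IsPos i → ∀ x ∈ rootSpace H (i.1 : H → K), x ∈ S)
    (hneg : ∀ i, b.IsPos i → ∀ x ∈ rootSpace H (-(i.1 : H → K)), x ∈ S) (x : L) : x ∈ S := by
  have htop := congrArg LieSubmodule.toSubmodule (cartan_sup_iSup_rootSpace_eq_top H (K := K))
  rw [LieSubmodule.sup_toSubmodule, LieSubmodule.iSup_toSubmodule] at htop
  simp only [LieSubmodule.iSup_toSubmodule, LieSubmodule.top_toSubmodule] at htop
  have hx : x ∈ (⊤ : Submodule K L) := trivial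
  rw [← htop] at hx
  refine (sup_le ?_ (iSup₂_le fun α hα => ?_) : _ ≤ S) hx
  · intro y hy
    exact h0 ⟨y, hy⟩
  · let i : H.root := ⟨α, by simpa using hα⟩
    rcases RootPairing.Base.IsPos.or_neg b i with hi | hi
    · exact hpos i hi
    · let := (rootSystem H).indexNeg
      have hi' : ((-i : H.root).1 : H → K) = -(α : H → K) := by
        ext h
        have := LinearMap.congr_fun (((rootSystem H).root_reflectionPerm i i).trans
          ((rootSystem H).reflection_apply_self i)) h
        exact this
      intro y hy
      refine hneg (-i) hi y ?_
      rw [hi', neg_neg]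
      exact hy

/-- The basis of the Lie algebra, consisting of Chevalley generators, for a base of the roots. -/
lemma exists_lieBasis (b : (rootSystem H).Base) :
    ∃ B : LieAlgebra.Basis b.support H, ∀ i, B.h i = (coroot i.1.1 : L) := by
  choose e f ht he hf using fun i : b.support => exists_sl2_of_root H i.1
  have hspan : LieSubalgebra.lieSpan K L (Set.range e ∪ Set.range f) = ⊤ := by
    set S := LieSubalgebra.lieSpan K L (Set.range e ∪ Set.range f) with hSdef
    have heS : ∀ i, e i ∈ S := fun i => LieSubalgebra.subset_lieSpan (Or.inl ⟨i, rfl⟩)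
    have hfS : ∀ i, f i ∈ S := fun i => LieSubalgebra.subset_lieSpan (Or.inr ⟨i, rfl⟩)
    rw [eq_top_iff]
    intro x _
    refine cartan_root_induction b S.toSubmodule ?_ ?_ ?_ x
    · intro h
      have hh : h ∈ Submodule.span K ((rootSystem H).coroot '' b.support) := by
        rw [b.span_coroot_support]
        have h2 : (rootSystem H).corootSpan K = ⊤ :=
          RootPairing.IsRootSystem.span_coroot_eq_top (P := rootSystem H)
        rw [h2]
        trivial
      -- The simple coroots are the brackets `[e_i, f_i]`, and they span the Cartan subalgebra.
      induction hh using Submodule.span_induction with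
      | mem y hy =>
        obtain ⟨i, hi, rfl⟩ := hy
        have := S.lie_mem (heS ⟨i, hi⟩) (hfS ⟨i, hi⟩)
        rwa [(ht ⟨i, hi⟩).lie_e_f] at this
      | zero => simp
      | add y z _ _ hy hz => exact S.add_mem hy hz
      | smul c y _ hy => exact S.smul_mem c hy
    · intro i hi
      refine rootSpace_le_of_simple b S (fun j hj y hy => ?_) hi
      obtain ⟨c, rfl⟩ := exists_smul_eq_of_mem_rootSpace (H.isNonZero_coe_root j) (he ⟨j, hj⟩)
        (ht ⟨j, hj⟩).e_ne_zero hy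
      exact S.smul_mem c (heS _)
    · intro i hi
      refine rootSpace_neg_le_of_simple b S (fun j hj y hy => ?_) hi
      obtain ⟨c, rfl⟩ := exists_smul_eq_of_mem_rootSpace (α := -j.1)
        (H.isNonZero_coe_root j).neg (by simpa using hf ⟨j, hj⟩)
        (ht ⟨j, hj⟩).f_ne_zero (by simpa using hy)
      exact S.smul_mem c (hfS _)
  have hpair : ∀ i j : b.support, i.1.1 (coroot j.1.1) = ((b.cartanMatrix i j : ℤ) : K) := by
    intro i j
    have := b.algebraMap_cartanMatrixIn_apply ℤ i j
    simp only [rootSystem_pairing_apply] at this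
    rw [← this]
    rfl
  have hlin : LinearIndependent K fun i : b.support => (coroot i.1.1 : L) := by
    have h1 : LinearIndependent K fun i : b.support => (coroot i.1.1 : H) :=
      b.linearIndepOn_coroot
    exact h1.map' H.toSubmodule.subtype (Submodule.ker_subtype _)
  refine ⟨{ A := b.cartanMatrix, h := fun i => (coroot i.1.1 : L), e := e, f := f,
            cartan_eq_lieSpan := ?_, span_ef := hspan, linInd := hlin,
            nondegen := b.cartanMatrix_nondegenerate, sl2 := ht, lie_h_h := ?_, lie_h_e := ?_,
            lie_h_f := ?_, lie_e_f_ne := ?_ }, fun i => rfl⟩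
  · apply le_antisymm
    · intro h hh
      have hh' : (⟨h, hh⟩ : H) ∈ Submodule.span K ((rootSystem H).coroot '' b.support) := by
        rw [b.span_coroot_support]
        have h2 : (rootSystem H).corootSpan K = ⊤ :=
          RootPairing.IsRootSystem.span_coroot_eq_top (P := rootSystem H)
        rw [h2]
        trivial
      have := Submodule.mem_map_of_mem (f := H.toSubmodule.subtype) hh'
      rw [Submodule.map_span] at this
      refine (Submodule.span_le.mpr ?_ : _ ≤ (LieSubalgebra.lieSpan K L
        (Set.range fun i : b.support => (coroot i.1.1 : L))).toSubmodule) this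
      rintro _ ⟨_, ⟨i, hi, rfl⟩, rfl⟩
      exact LieSubalgebra.subset_lieSpan ⟨⟨i, hi⟩, rfl⟩
    · rw [LieSubalgebra.lieSpan_le]
      rintro _ ⟨i, rfl⟩
      exact (coroot i.1.1).2
  · intro i j
    have := trivial_lie_zero H H (coroot i.1.1) (coroot j.1.1)
    simpa using congrArg Subtype.val this
  · intro i j
    have := lie_eq_smul_of_mem_rootSpace (he i) (coroot j.1.1)
    rw [LieSubalgebra.coe_bracket_of_module] at this
    rw [this, hpair, Int.cast_smul_eq_zsmul]
  · intro i j
    have := lie_eq_smul_of_mem_rootSpace (hf i) (coroot j.1.1)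
    rw [LieSubalgebra.coe_bracket_of_module] at this
    rw [this, Pi.neg_apply, hpair, ← Int.cast_neg, Int.cast_smul_eq_zsmul]
  · intro i j hij
    have hmem := lie_mem_genWeightSpace_of_mem_genWeightSpace (he i) (hf j)
    by_contra h0
    have hne : rootSpace H ((i.1.1 : H → K) + -(j.1.1 : H → K)) ≠ ⊥ := by
      intro hbot
      have h1 : ⁅e i, f j⁆ ∈ rootSpace H ((i.1.1 : H → K) + -(j.1.1 : H → K)) := hmem
      rw [hbot] at h1
      exact h0 (by simpa using h1)
    let γ : Weight K H L := ⟨_, hne⟩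
    have hγ : γ.IsNonZero := by
      intro h
      apply hij
      have h1 : (i.1.1 : H → K) = j.1.1 := by
        ext x
        have := congrFun (show (γ : H → K) = 0 from h) x
        simpa [γ, add_neg_eq_zero] using this
      exact Subtype.ext (Subtype.ext (DFunLike.coe_injective h1))
    -- A nonzero `[e_i, f_j]` would make the difference of two simple roots a root.
    apply b.sub_notMem_range_root i.2 j.2
    refine ⟨⟨γ, by simpa using hγ⟩, ?_⟩
    ext x
    simp [γ, sub_eq_add_neg]

/-- A simple Lie algebra has an automorphism that is `-1` on the Cartan subalgebra. -/
lemma exists_lieEquiv_neg_on_cartan [IsSimple K L] (b : (rootSystem H).Base) :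
    ∃ θ : L ≃ₗ⁅K⁆ L, ∀ h : H, θ h = -(h : L) := by
  obtain ⟨B, hB⟩ := exists_lieBasis b
  -- `B.symm` is a Chevalley basis with negated coroots and matching Cartan matrix, so the
  -- isomorphism theorem applies.
  let θ := LieAlgebra.Basis.equivOfReindex (Equiv.refl _) B B.symm (by ext; simp)
  have key : ∀ i, θ (B.h i) = - B.h i := by
    intro i
    -- The isomorphism is the subalgebra of `L × L` generated by pairs of corresponding generators,
    -- read as a graph; `(h_i, -h_i)` is one of these pairs.
    obtain ⟨P, f, g, h1, hf, hg, hh⟩ : ∃ (P : LieSubalgebra K (L × L)) (f : P ≃ₗ⁅K⁆ L)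
        (g : P ≃ₗ⁅K⁆ L), θ = f.symm.trans g ∧ (∀ x, f x = x.1.1) ∧ (∀ x, g x = x.1.2) ∧
          ((B.h i, -B.h i) : L × L) ∈ P :=
      ⟨_, _, _, rfl, fun x => rfl, fun x => rfl,
        LieSubalgebra.subset_lieSpan (Or.inl (Or.inl ⟨i, rfl⟩))⟩
    have : f.symm (B.h i) = ⟨_, hh⟩ := by rw [LieEquiv.symm_apply_eq, hf]
    rw [h1, LieEquiv.trans_apply, this, hg]
  refine ⟨θ, fun h => ?_⟩
  have hmem : (h : L) ∈ Submodule.span K (Set.range B.h) := by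
    have h1 := h.2
    rw [← LieSubalgebra.mem_toSubmodule, B.coe_cartan_eq_span] at h1
    exact h1
  generalize (h : L) = x at hmem
  induction hmem using Submodule.span_induction with
  | mem y hy => obtain ⟨i, rfl⟩ := hy; exact key i
  | zero => simp
  | add y z _ _ hy hz => rw [map_add, hy, hz, neg_add]
  | smul c y _ hy => rw [map_smul, hy, smul_neg]

end Chevalley

/-! ## Structure of the affine algebra -/

section AffineStructure

open LieAlgebra LieAlgebra.IsKilling

variable {𝔤 : Type u} [LieRing 𝔤] [LieAlgebra ℂ 𝔤]

variable (𝔤) in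
/-- The map `x ↦ x ⊗ tⁿ` into the affine algebra. -/
def tAff (n : ℤ) : 𝔤 →ₗ[ℂ] Affine 𝔤 where
  toFun x := ⟨tpow n x, 0, 0⟩
  map_add' x y := by
    ext
    · show tpow n (x + y) = tpow n x + tpow n y
      rw [← coeffs_symm_single, Finsupp.single_add, map_add, coeffs_symm_single, coeffs_symm_single]
    · simp
    · simp
  map_smul' c x := by
    ext
    · show tpow n (c • x) = c • tpow n x
      rw [← coeffs_symm_single, ← Finsupp.smul_single, map_smul, coeffs_symm_single]
    · simp
    · simp

lemma tAff_apply (n : ℤ) (x : 𝔤) : tAff 𝔤 n x = ⟨tpow n x, 0, 0⟩ := rfl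

@[simp] lemma tpow_zero (n : ℤ) : tpow n (0 : 𝔤) = 0 :=
  congrArg Affine.loop (map_zero (tAff 𝔤 n))

lemma tpow_add (n : ℤ) (x y : 𝔤) : tpow n (x + y) = tpow n x + tpow n y :=
  congrArg Affine.loop (map_add (tAff 𝔤 n) x y)

lemma tpow_smul (n : ℤ) (c : ℂ) (x : 𝔤) : tpow n (c • x) = c • tpow n x :=
  congrArg Affine.loop (map_smul (tAff 𝔤 n) c x)

variable (𝔤) in
/-- The inclusion of the loop algebra into the affine algebra. -/
def loopIncl : Loop 𝔤 →ₗ[ℂ] Affine 𝔤 where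
  toFun a := ⟨a, 0, 0⟩
  map_add' x y := by ext <;> simp
  map_smul' c x := by ext <;> simp

/-- The inclusion of the affine Cartan subalgebra, as a linear map. -/
def cartanLin (H : LieSubalgebra ℂ 𝔤) : CartanHat H →ₗ[ℂ] Affine 𝔤 where
  toFun h := cartanIncl h
  map_add' x y := by
    ext
    · simp [cartanIncl, tpow_add]
    · simp [cartanIncl]
    · simp [cartanIncl]
  map_smul' c x := by
    ext
    · simp [cartanIncl, tpow_smul]
    · simp [cartanIncl]
    · simp [cartanIncl]

lemma lie_tAff (n m : ℤ) (x y : 𝔤) :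
    ⁅tAff 𝔤 n x, tAff 𝔤 m y⁆ =
      ⟨tpow (n + m) ⁅x, y⁆, if m = -n then (n : ℂ) * killingForm ℂ 𝔤 x y else 0, 0⟩ := by
  ext <;> simp [tAff_apply]

lemma cartanIncl_lie_tAff {H : LieSubalgebra ℂ 𝔤} (h : CartanHat H) (n : ℤ) (x : 𝔤) :
    ⁅cartanIncl h, tAff 𝔤 n x⁆ = tAff 𝔤 n (⁅(h.1 : 𝔤), x⁆ + ((n : ℂ) * h.2.2) • x) := by
  ext
  · simp [tAff_apply, cartanIncl, tpow_add, tpow_smul, smul_smul, mul_comm]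
  · simp [tAff_apply, cartanIncl]
  · simp [tAff_apply]

/-- The affine algebra is spanned by the `x ⊗ tⁿ` and by the affine Cartan subalgebra. -/
lemma affine_induction (H : LieSubalgebra ℂ 𝔤) (S : Submodule ℂ (Affine 𝔤))
    (h1 : ∀ n x, tAff 𝔤 n x ∈ S) (h2 : ∀ h : CartanHat H, cartanIncl h ∈ S) (x : Affine 𝔤) :
    x ∈ S := by
  have hl : ∀ a : Loop 𝔤, loopIncl 𝔤 a ∈ S := fun a => by
    induction a using loop_induction with
    | h0 => rw [map_zero]; exact S.zero_mem
    | ht n x => exact h1 n x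
    | ha a b ha hb => rw [map_add]; exact S.add_mem ha hb
  have hx : x = loopIncl 𝔤 x.loop + cartanIncl ((0, x.cen, x.der) : CartanHat H) := by
    ext <;> simp [loopIncl, cartanIncl]
  rw [hx]
  exact S.add_mem (hl _) (h2 _)

@[simp] lemma extendForm_apply {H : LieSubalgebra ℂ 𝔤} (α : Module.Dual ℂ H) (h : CartanHat H) :
    extendForm α h = α h.1 := rfl

@[simp] lemma delta_apply {H : LieSubalgebra ℂ 𝔤} (h : CartanHat H) : delta H h = h.2.2 := rfl

/-- `x` is a vector of weight `β` for the adjoint action of the affine Cartan subalgebra. -/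
def HasAdWeight {H : LieSubalgebra ℂ 𝔤} (x : Affine 𝔤) (β : WeightHat H) : Prop :=
  ∀ h : CartanHat H, ⁅cartanIncl h, x⁆ = β h • x

/-! ### The anti-automorphism of the affine algebra -/

section Sigma

variable {H : LieSubalgebra ℂ 𝔤}

/-- The linear map `x ⊗ tⁿ ↦ -θ x ⊗ t⁻ⁿ` on the loop algebra. -/
def loopSigma (θ : 𝔤 ≃ₗ⁅ℂ⁆ 𝔤) : Loop 𝔤 →ₗ[ℂ] Loop 𝔤 :=
  (Loop.coeffs 𝔤).symm.toLinearMap ∘ₗ (Finsupp.lsum ℂ fun n : ℤ =>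
    -((Finsupp.lsingle (-n) : 𝔤 →ₗ[ℂ] ℤ →₀ 𝔤) ∘ₗ (θ : 𝔤 →ₗ[ℂ] 𝔤))) ∘ₗ
      (Loop.coeffs 𝔤).toLinearMap

lemma loopSigma_tpow (θ : 𝔤 ≃ₗ⁅ℂ⁆ 𝔤) (n : ℤ) (x : 𝔤) :
    loopSigma θ (tpow n x) = tpow (-n) (-θ x) := by
  rw [loopSigma, LinearMap.comp_apply, LinearMap.comp_apply, LinearEquiv.coe_coe,
    LinearEquiv.coe_coe, coeffs_tpow, Finsupp.lsum_single, ← coeffs_symm_single]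
  simp

/-- The extension to the affine algebra of the anti-automorphism `-θ`, for an automorphism `θ` of
`𝔤`. -/
def affSigma (θ : 𝔤 ≃ₗ⁅ℂ⁆ 𝔤) : Affine 𝔤 →ₗ[ℂ] Affine 𝔤 where
  toFun x := ⟨loopSigma θ x.loop, x.cen, x.der⟩
  map_add' x y := by ext <;> simp
  map_smul' c x := by ext <;> simp

lemma affSigma_tAff (θ : 𝔤 ≃ₗ⁅ℂ⁆ 𝔤) (n : ℤ) (x : 𝔤) :
    affSigma θ (tAff 𝔤 n x) = tAff 𝔤 (-n) (-θ x) := by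
  ext
  · exact loopSigma_tpow θ n x
  · rfl
  · rfl

lemma affSigma_cartanIncl (θ : 𝔤 ≃ₗ⁅ℂ⁆ 𝔤) (hθ : ∀ h : H, θ h = -(h : 𝔤)) (h : CartanHat H) :
    affSigma θ (cartanIncl h) = cartanIncl h := by
  have h1 := congrArg Affine.loop (affSigma_tAff θ 0 (h.1 : 𝔤))
  ext
  · have h2 : (affSigma θ (cartanIncl h)).loop = (affSigma θ (tAff 𝔤 0 (h.1 : 𝔤))).loop := rfl
    rw [h2, h1, hθ]
    simp [tAff_apply, cartanIncl]
  · rfl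
  · rfl

/-- `-θ` reverses brackets and preserves the Killing form. Inverting `t` changes the sign of the
cocycle and of the action of `D`, and exchanging the two arguments restores it. By bilinearity and
skew symmetry only brackets among loop vectors, `K` and `D` need checking. -/
lemma affSigma_lie [FiniteDimensional ℂ 𝔤] (θ : 𝔤 ≃ₗ⁅ℂ⁆ 𝔤) (x y : Affine 𝔤) :
    affSigma θ ⁅x, y⁆ = ⁅affSigma θ y, affSigma θ x⁆ := by
  have hD : ∀ c d : ℂ, affSigma θ (⟨0, c, d⟩ : Affine 𝔤) = ⟨0, c, d⟩ := fun c d => by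
    ext <;> simp [affSigma]
  have hC : ∀ (c d : ℂ) (n : ℤ) (z : 𝔤), ⁅(⟨0, c, d⟩ : Affine 𝔤), tAff 𝔤 n z⁆ =
      tAff 𝔤 n (((n : ℂ) * d) • z) := fun c d n z => by
    ext <;> simp [tAff_apply, mul_smul, mul_comm]
  let S : Affine 𝔤 → Submodule ℂ (Affine 𝔤) := fun y =>
    { carrier := {x | affSigma θ ⁅y, x⁆ = ⁅affSigma θ x, affSigma θ y⁆}
      add_mem' := fun {u v} (hu : _ = _) (hv : _ = _) => by
        rw [Set.mem_ofPred_eq, lie_add, map_add, hu, hv, map_add, add_lie]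
      zero_mem' := by simp
      smul_mem' := fun c u (hu : _ = _) => by
        rw [Set.mem_ofPred_eq, lie_smul, map_smul, hu, map_smul, smul_lie] }
  have hS : ∀ y x, x ∈ S y ↔ affSigma θ ⁅y, x⁆ = ⁅affSigma θ x, affSigma θ y⁆ :=
    fun y x => Iff.rfl
  have hsymm : ∀ y x, x ∈ S y → y ∈ S x := fun y x h => by
    rw [hS] at h ⊢
    rw [← lie_skew, map_neg, h, lie_skew]
  have h1 : ∀ n m a b, tAff 𝔤 n a ∈ S (tAff 𝔤 m b) := fun n m a b => by
    rw [hS, affSigma_tAff, affSigma_tAff, lie_tAff, lie_tAff]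
    have h2 : (⟨tpow (m + n) ⁅b, a⁆,
        if n = -m then (m : ℂ) * killingForm ℂ 𝔤 b a else 0, 0⟩ : Affine 𝔤) =
        tAff 𝔤 (m + n) ⁅b, a⁆ +
          ⟨0, if n = -m then (m : ℂ) * killingForm ℂ 𝔤 b a else 0, 0⟩ := by
      ext <;> simp [tAff_apply]
    rw [h2, map_add, affSigma_tAff, hD]
    ext
    · simp only [tAff_apply, Affine.add_loop, add_zero, neg_lie, lie_neg, neg_neg]
      rw [← LieEquiv.map_lie, ← map_neg, lie_skew, show -(m + n) = -n + -m by ring]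
    · simp only [tAff_apply, Affine.add_cen, zero_add]
      by_cases h : n = -m
      · subst h
        rw [if_pos rfl, if_pos (by simp)]
        have hk : killingForm ℂ 𝔤 (-θ a) (-θ b) = killingForm ℂ 𝔤 b a := by
          rw [map_neg, map_neg, LinearMap.neg_apply, neg_neg, LieAlgebra.killingForm_of_equiv_apply,
            LieModule.traceForm_comm]
        rw [hk]
        simp
      · rw [if_neg h, if_neg (fun h' => h (by omega))]
    · simp [tAff_apply]
  have h0 : ∀ n a c d, tAff 𝔤 n a ∈ S (⟨0, c, d⟩ : Affine 𝔤) := fun n a c d => by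
    rw [hS, hC, affSigma_tAff, affSigma_tAff, hD, ← lie_skew, hC]
    simp [smul_neg]
  have h00 : ∀ c d c' d', (⟨0, c, d⟩ : Affine 𝔤) ∈ S (⟨0, c', d'⟩ : Affine 𝔤) := fun c d c' d' => by
    rw [hS, hD, hD]
    have : ∀ c d c' d', ⁅(⟨0, c, d⟩ : Affine 𝔤), (⟨0, c', d'⟩ : Affine 𝔤)⁆ = 0 := by
      intro c d c' d'; ext <;> simp
    rw [this, this, map_zero]
  -- With the zero subalgebra in place of `𝔥`, `affine_induction` splits the algebra into loop
  -- vectors and the span of `K` and `D`.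
  have hcart : ∀ h : CartanHat (⊥ : LieSubalgebra ℂ 𝔤), cartanIncl h = ⟨0, h.2.1, h.2.2⟩ := by
    intro h
    have : (h.1 : 𝔤) = 0 := by
      have h2 := h.1.2
      rwa [LieSubalgebra.mem_bot] at h2
    ext <;> simp [cartanIncl, this]
  have key : ∀ y x, x ∈ S y := fun y x => by
    refine affine_induction (⊥ : LieSubalgebra ℂ 𝔤) (S y) (fun n a => ?_) (fun h => ?_) x
    · refine hsymm _ _ (affine_induction (⊥ : LieSubalgebra ℂ 𝔤) (S (tAff 𝔤 n a))
        (fun m b => h1 m n b a) (fun h => hsymm _ _ ?_) y)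
      rw [hcart]
      exact h0 _ _ _ _
    · rw [hcart]
      refine hsymm _ _ (affine_induction (⊥ : LieSubalgebra ℂ 𝔤) _ (fun m b => h0 _ _ _ _)
        (fun h => ?_) y)
      rw [hcart]
      exact h00 _ _ _ _
  exact (hS x y).mp (key x y)

lemma affSigma_surjective (θ : 𝔤 ≃ₗ⁅ℂ⁆ 𝔤) (H : LieSubalgebra ℂ 𝔤) (hθ : ∀ h : H, θ h = -(h : 𝔤)) :
    Function.Surjective (affSigma θ) := by
  intro x
  refine affine_induction H (LinearMap.range (affSigma θ)) (fun n a => ?_) (fun h => ?_) x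
  · refine ⟨tAff 𝔤 (-n) (-θ.symm a), ?_⟩
    rw [affSigma_tAff]
    simp
  · exact ⟨cartanIncl h, affSigma_cartanIncl θ hθ h⟩

end Sigma

/-! ### Heights and finiteness of intervals of weights -/

section Height

variable [FiniteDimensional ℂ 𝔤] [LieAlgebra.IsKilling ℂ 𝔤]
  {H : LieSubalgebra ℂ 𝔤} [H.IsCartanSubalgebra]
  (b : (LieAlgebra.IsKilling.rootSystem H).Base)

/-- The simple roots are a basis of the dual, so some `ρ` takes the value `1` on each of them. -/
lemma exists_rho : ∃ ρ : H, ∀ i, (rootSystem H).root i ρ = (b.height i : ℂ) := by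
  let φ : Module.Dual ℂ (Module.Dual ℂ H) := b.toWeightBasis.constr ℂ fun _ => (1 : ℂ)
  obtain ⟨ρ, hρ⟩ := (Module.evalEquiv ℂ H).surjective φ
  have hφ : ∀ f : Module.Dual ℂ H, f ρ = φ f := fun f => by rw [← hρ]; rfl
  refine ⟨ρ, fun i => ?_⟩
  obtain ⟨f, -, -, hf⟩ := b.exists_root_eq_sum_int i
  rw [RootPairing.Base.height_eq_sum hf, hφ, hf, map_sum, Int.cast_sum]
  refine Finset.sum_congr rfl fun j hj => ?_
  have h1 : φ (b.toWeightBasis ⟨j, hj⟩) = 1 := Module.Basis.constr_basis _ _ _ _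
  rw [b.toWeightBasis_apply] at h1
  rw [map_zsmul, h1]
  simp

/-- A strict upper bound for the heights of the roots. -/
def heightBound : ℕ := 1 + ∑ i, (b.height i).natAbs

lemma natAbs_height_lt (i : H.root) : (b.height i).natAbs < heightBound b := by
  have := Finset.single_le_sum (f := fun i => (b.height i).natAbs) (fun _ _ => Nat.zero_le _)
    (Finset.mem_univ i)
  rw [heightBound]
  omega

/-- An element of the affine Cartan subalgebra on which the positive affine roots take positive
integral values. -/
def heightElt : CartanHat H := ((exists_rho b).choose, 0, (heightBound b : ℂ))

lemma extendForm_heightElt (i : H.root) (n : ℤ) :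
    (extendForm ((rootSystem H).root i) + n • delta H) (heightElt b) =
      ((b.height i + n * heightBound b : ℤ) : ℂ) := by
  have := (exists_rho b).choose_spec i
  rw [LinearMap.add_apply, LinearMap.smul_apply, extendForm_apply, delta_apply]
  simp only [heightElt]
  rw [this]
  simp

lemma delta_heightElt (n : ℤ) :
    (n • delta H) (heightElt b) = ((n * heightBound b : ℤ) : ℂ) := by
  simp [heightElt]

/-- The value of a positive affine root at the derivation `D` is a natural number that is
bounded by its height. -/
lemma posRoots_height {β : WeightHat H} (hβ : β ∈ posRoots b) :
    ∃ k n : ℕ, 0 < k ∧ β (heightElt b) = k ∧ n ≤ k ∧ β (0, 0, 1) = n := by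
  rcases hβ with ⟨i, hi, rfl⟩ | ⟨i, n, hn, rfl⟩ | ⟨n, hn, rfl⟩
  · have h1 := extendForm_heightElt b i 0
    rw [RootPairing.Base.isPos_iff] at hi
    refine ⟨(b.height i).toNat, 0, by omega, ?_, by omega, by simp⟩
    rw [zero_smul, add_zero] at h1
    rw [h1]
    have : ((b.height i).toNat : ℤ) = b.height i := Int.toNat_of_nonneg hi.le
    simp only [zero_mul, add_zero]
    exact (congrArg (Int.cast : ℤ → ℂ) this.symm).trans (Int.cast_natCast _)
  · have h1 := extendForm_heightElt b i n
    have h2 := natAbs_height_lt b i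
    -- With `N` the height bound, the height of `α` is at least `1 - N`, so the total is at least
    -- `(n - 1) N + 1 ≥ n`.
    have h3 : (n : ℤ) ≤ b.height i + n * heightBound b ∧ 0 < b.height i + n * heightBound b := by
      have h4 : -(heightBound b : ℤ) + 1 ≤ b.height i := by omega
      have h5 : (1 : ℤ) ≤ heightBound b := by omega
      have h6 : (1 : ℤ) ≤ n := by omega
      constructor <;> nlinarith
    refine ⟨(b.height i + n * heightBound b).toNat, n, by omega, ?_, by omega, ?_⟩
    · rw [natCast_zsmul] at h1
      rw [h1]
      exact (congrArg (Int.cast : ℤ → ℂ) (Int.toNat_of_nonneg h3.2.le)).symm.trans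
        (Int.cast_natCast _)
    · simp
  · have h1 := delta_heightElt b (H := H) n
    have h5 : 1 ≤ heightBound b := by rw [heightBound]; omega
    refine ⟨n * heightBound b, n, by positivity, ?_, Nat.le_mul_of_pos_right n h5, ?_⟩
    · rw [natCast_zsmul] at h1
      rw [h1]
      simp
    · simp

/-- The height bounds the coefficient of `δ`, and there are finitely many choices for the finite
part. -/
lemma finite_posRoots_height (k : ℕ) : {β ∈ posRoots b | β (heightElt b) = k}.Finite := by
  have : {β ∈ posRoots b | β (heightElt b) = k} ⊆
      (Set.range fun p : H.root × Fin (k + 1) =>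
        extendForm ((rootSystem H).root p.1) + (p.2 : ℕ) • delta H) ∪
      (Set.range fun p : Fin (k + 1) => (p : ℕ) • delta H) := by
    rintro β ⟨hβ, hk⟩
    obtain ⟨k', n, -, h1, h2, h3⟩ := posRoots_height b hβ
    rw [hk] at h1
    obtain rfl : k = k' := by exact_mod_cast h1
    rcases hβ with ⟨i, hi, rfl⟩ | ⟨i, m, hm, rfl⟩ | ⟨m, hm, rfl⟩
    · exact Or.inl ⟨(i, 0), by simp⟩
    · have : m = n := by
        simpa using h3
      exact Or.inl ⟨(i, ⟨m, by omega⟩), rfl⟩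
    · have : m = n := by simpa using h3
      exact Or.inr ⟨⟨m, by omega⟩, rfl⟩
  exact ((Set.finite_range _).union (Set.finite_range _)).subset this

lemma closure_height {β : WeightHat H} (hβ : β ∈ AddSubmonoid.closure (posRoots b)) :
    ∃ k : ℕ, β (heightElt b) = k ∧ (k = 0 → β = 0) := by
  induction hβ using AddSubmonoid.closure_induction with
  | mem x hx =>
    obtain ⟨k, n, hk, h1, -⟩ := posRoots_height b hx
    exact ⟨k, h1, by omega⟩
  | zero => exact ⟨0, by simp, fun _ => rfl⟩
  | add x y _ _ hx hy =>
    obtain ⟨k, h1, h2⟩ := hx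
    obtain ⟨l, h3, h4⟩ := hy
    refine ⟨k + l, by simp [h1, h3], fun h => ?_⟩
    rw [h2 (by omega), h4 (by omega), add_zero]

/-- Splitting off one positive root, which has height at least `1`, leaves a sum of strictly smaller
height; strong induction applies. -/
lemma finite_closure_height (k : ℕ) :
    {β ∈ AddSubmonoid.closure (posRoots b) | β (heightElt b) = k}.Finite := by
  induction k using Nat.strong_induction_on with
  | _ k ih =>
    have hsub : {β ∈ AddSubmonoid.closure (posRoots b) | β (heightElt b) = k} ⊆ {0} ∪
        ⋃ l : Fin k, Set.image2 (· + ·) {β ∈ posRoots b | β (heightElt b) = ((k - l : ℕ) : ℂ)}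
          {β ∈ AddSubmonoid.closure (posRoots b) | β (heightElt b) = ((l : ℕ) : ℂ)} := by
      rintro β ⟨hβ, hk⟩
      obtain rfl | ⟨x, hx, y, hy, rfl⟩ : β = 0 ∨ ∃ x ∈ posRoots b,
          ∃ y ∈ AddSubmonoid.closure (posRoots b), β = x + y := by
        induction hβ using AddSubmonoid.closure_induction_left with
        | zero => exact Or.inl rfl
        | add_left x hx y hy _ => exact Or.inr ⟨x, hx, y, hy, rfl⟩
      · exact Or.inl rfl
      · right
        obtain ⟨m, -, hm, hm', -⟩ := posRoots_height b hx
        obtain ⟨l, hl, -⟩ := closure_height b hy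
        rw [LinearMap.add_apply, hm', hl] at hk
        have hk' : m + l = k := by exact_mod_cast hk
        refine Set.mem_iUnion.mpr ⟨⟨l, by omega⟩, x, ⟨hx, ?_⟩, y, ⟨hy, hl⟩, rfl⟩
        rw [hm']
        congr 1
        simp only
        omega
    refine ((Set.finite_singleton 0).union (Set.finite_iUnion fun l => ?_)).subset hsub
    exact Set.Finite.image2 _ (finite_posRoots_height b _) (ih l l.2)

lemma wLE_refl (μ : WeightHat H) : wLE b μ μ := by
  rw [wLE, sub_self]; exact zero_mem _

lemma wLE_trans {μ ν κ : WeightHat H} (h1 : wLE b μ ν) (h2 : wLE b ν κ) : wLE b μ κ := by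
  have := add_mem h2 h1
  rwa [sub_add_sub_cancel] at this

lemma wLE_antisymm {μ ν : WeightHat H} (h1 : wLE b μ ν) (h2 : wLE b ν μ) : μ = ν := by
  obtain ⟨k, hk, hk0⟩ := closure_height b h1
  obtain ⟨l, hl, -⟩ := closure_height b h2
  have h3 : ((k + l : ℕ) : ℂ) = 0 := by
    push_cast
    rw [← hk, ← hl, LinearMap.sub_apply, LinearMap.sub_apply]
    ring
  have h4 : k + l = 0 := by exact_mod_cast h3
  exact (sub_eq_zero.mp (hk0 (by omega))).symm

lemma isOpenSet_Iic (lam : WeightHat H) : IsOpenSet b {μ | wLE b μ lam} :=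
  fun _ hμ _ hν => wLE_trans b hν hμ

/-- Between `μ` and `lam` the height over `μ` is at most that of `lam - μ`, and each height is
reached finitely often. These are the truncations used to pass from Verma modules to projective
covers. -/
lemma isLocallyBounded_Iic (lam : WeightHat H) : IsLocallyBounded b {μ | wLE b μ lam} := by
  intro μ
  by_cases hμ : wLE b μ lam
  · obtain ⟨k, hk, -⟩ := closure_height b hμ
    have hfin : (⋃ l : Fin (k + 1), {β ∈ AddSubmonoid.closure (posRoots b) |
        β (heightElt b) = ((l : ℕ) : ℂ)}).Finite :=
      Set.finite_iUnion fun l => finite_closure_height b l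
    refine (hfin.image fun β => μ + β).subset ?_
    rintro γ ⟨h1, h2⟩
    refine ⟨γ - μ, ?_, by simp⟩
    obtain ⟨l, hl, -⟩ := closure_height b h2
    obtain ⟨m, hm, -⟩ := closure_height b h1
    have : ((m + l : ℕ) : ℂ) = k := by
      push_cast
      rw [← hm, ← hl, ← hk]
      simp only [LinearMap.sub_apply]
      ring
    have h4 : m + l = k := by exact_mod_cast this
    exact Set.mem_iUnion.mpr ⟨⟨l, by omega⟩, h2, hl⟩
  · refine Set.Finite.subset Set.finite_empty ?_
    rintro γ ⟨h1, h2⟩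
    exact hμ (wLE_trans b h2 h1)

end Height

end AffineStructure

/-! ## The triangular decomposition -/

section Triangular

open LieAlgebra LieAlgebra.IsKilling

variable {𝔤 : Type u} [LieRing 𝔤] [LieAlgebra ℂ 𝔤] [FiniteDimensional ℂ 𝔤] [IsKilling ℂ 𝔤]
  {H : LieSubalgebra ℂ 𝔤} [H.IsCartanSubalgebra]
  (b : (LieAlgebra.IsKilling.rootSystem H).Base)

lemma hasAdWeight_tAff {α : Module.Dual ℂ H} {x : 𝔤} (hx : x ∈ rootSpace H (α : H → ℂ)) (n : ℤ) :
    HasAdWeight (tAff 𝔤 n x) (extendForm α + n • delta H) := by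
  intro h
  have h1 := lie_eq_smul_of_mem_rootSpace hx h.1
  rw [LieSubalgebra.coe_bracket_of_module] at h1
  rw [cartanIncl_lie_tAff, h1, ← add_smul, map_smul]
  simp

/-- The vectors `x ⊗ tⁿ` with `x` in a root space or in the Cartan subalgebra, of the weight a
positive affine root of height `k`. -/
def posVec (k : ℕ) : Set (Affine 𝔤) :=
  {z | ∃ (α : Module.Dual ℂ H) (n : ℕ) (x : 𝔤), x ∈ rootSpace H (α : H → ℂ) ∧
    extendForm α + n • delta H ∈ posRoots b ∧
    (extendForm α + n • delta H) (heightElt b) = k ∧ z = tAff 𝔤 n x}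

/-- The span of the root vectors of height `k`. -/
def posSpan (k : ℕ) : Submodule ℂ (Affine 𝔤) := Submodule.span ℂ (posVec b k)

variable {b}

lemma exists_weight_of_mem_posVec {k : ℕ} {z : Affine 𝔤} (hz : z ∈ posVec b k) :
    ∃ β ∈ posRoots b, β (heightElt b) = k ∧ HasAdWeight z β := by
  obtain ⟨α, n, x, hx, hα, hk, rfl⟩ := hz
  refine ⟨_, hα, hk, ?_⟩
  have := hasAdWeight_tAff hx n
  rwa [natCast_zsmul] at this

lemma posVec_subset_nilHat {k : ℕ} {z : Affine 𝔤} (hz : z ∈ posVec b k) : z ∈ nilHat b := by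
  obtain ⟨α, n, x, hx, hα, -, rfl⟩ := hz
  apply Submodule.subset_span
  rcases Nat.eq_zero_or_pos n with rfl | hn
  · right
    -- Evaluation at `D` excludes the roots with positive `δ`-coefficient.
    rcases hα with ⟨i, hi, h⟩ | ⟨i, m, hm, h⟩ | ⟨m, hm, h⟩
    · have h1 : α = (rootSystem H).root i := by
        ext y
        simpa using LinearMap.congr_fun h (y, 0, 0)
      refine ⟨i, hi, x, ?_, rfl⟩
      rw [h1] at hx
      exact hx
    · have h1 : (0 : ℂ) = m := by simpa using LinearMap.congr_fun h (0, 0, 1)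
      have h2 : m = 0 := by exact_mod_cast h1.symm
      omega
    · have h1 : (0 : ℂ) = m := by simpa using LinearMap.congr_fun h (0, 0, 1)
      have h2 : m = 0 := by exact_mod_cast h1.symm
      omega
  · left
    exact ⟨n, by exact_mod_cast hn, x, rfl⟩

lemma posSpan_le_nilHat (k : ℕ) : posSpan b k ≤ nilHat b :=
  Submodule.span_le.mpr fun _ hz => posVec_subset_nilHat hz

/-- Decompose `𝔤 ⊗ tⁿ` along the Cartan subalgebra and the root spaces; the Cartan part has the
imaginary weight `nδ`, that is `α = 0`. -/
lemma nilHat_le_iSup_posSpan : nilHat b ≤ ⨆ k, posSpan b k := by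
  have hroot : ∀ (i : H.root) (n : ℕ) (x : 𝔤), x ∈ rootSpace H (i.1 : H → ℂ) →
      (0 < n ∨ b.IsPos i) → tAff 𝔤 n x ∈ ⨆ k, posSpan b k := by
    intro i n x hx hn
    have hmem : extendForm ((rootSystem H).root i) + n • delta H ∈ posRoots b := by
      rcases Nat.eq_zero_or_pos n with rfl | hn'
      · exact Or.inl ⟨i, hn.resolve_left (lt_irrefl 0), by simp⟩
      · exact Or.inr (Or.inl ⟨i, n, hn', rfl⟩)
    obtain ⟨k, -, -, hk, -⟩ := posRoots_height b hmem
    exact Submodule.mem_iSup_of_mem k (Submodule.subset_span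
      ⟨(rootSystem H).root i, n, x, hx, hmem, hk, rfl⟩)
  refine Submodule.span_le.mpr ?_
  rintro z (⟨n, hn, x, rfl⟩ | ⟨i, hi, x, hx, rfl⟩)
  · lift n to ℕ using hn.le
    have hn' : 0 < n := by exact_mod_cast hn
    refine cartan_root_induction b ((⨆ k, posSpan b k).comap (tAff 𝔤 n)) (fun h => ?_)
      (fun i hi y hy => hroot i n y hy (Or.inl hn')) (fun i hi y hy => ?_) x
    · have hmem : extendForm (0 : Module.Dual ℂ H) + n • delta H ∈ posRoots b :=
        Or.inr (Or.inr ⟨n, hn', by ext <;> simp⟩)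
      obtain ⟨k, -, -, hk, -⟩ := posRoots_height b hmem
      refine Submodule.mem_iSup_of_mem k (Submodule.subset_span ⟨0, n, h, ?_, hmem, hk, rfl⟩)
      have h2 : (h : 𝔤) ∈ rootSpace H (0 : H → ℂ) := by
        rw [rootSpace_zero_eq]
        exact h.2
      exact h2
    · let j : H.root := ⟨-i.1, by simpa using (H.isNonZero_coe_root i).neg⟩
      exact hroot j n y (by simpa [j] using hy) (Or.inl hn')
  · exact hroot i 0 x hx (Or.inr hi)

/-- A submodule that contains the root vectors contains `nilHat`. -/
lemma nilHat_le_of_posVec {S : Submodule ℂ (Affine 𝔤)} (hS : ∀ k, ∀ z ∈ posVec b k, z ∈ S) :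
    nilHat b ≤ S :=
  nilHat_le_iSup_posSpan.trans (iSup_le fun k => Submodule.span_le.mpr (hS k))

/-- A root vector of height `k` has exponent of `t` at most `k`. -/
instance finiteDimensional_posSpan (k : ℕ) : FiniteDimensional ℂ (posSpan b k) := by
  have hle : posSpan b k ≤ ⨆ n : Fin (k + 1), LinearMap.range (tAff 𝔤 (n : ℕ)) := by
    refine Submodule.span_le.mpr ?_
    rintro z ⟨α, n, x, hx, hα, hk, rfl⟩
    obtain ⟨k', m, -, h1, h2, h3⟩ := posRoots_height b hα
    rw [hk] at h1
    have hk' : k = k' := by exact_mod_cast h1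
    have hm : n = m := by simpa using h3
    exact Submodule.mem_iSup_of_mem (⟨n, by omega⟩ : Fin (k + 1)) ⟨x, rfl⟩
  exact Submodule.finiteDimensional_of_le hle

lemma tAff_mem_nilHat {n : ℤ} (hn : 0 < n) (x : 𝔤) : tAff 𝔤 n x ∈ nilHat b :=
  Submodule.subset_span (Or.inl ⟨n, hn, x, rfl⟩)

lemma tAff_zero_mem_nilHat {i : H.root} (hi : b.IsPos i) {x : 𝔤}
    (hx : x ∈ rootSpace H (i.1 : H → ℂ)) : tAff 𝔤 0 x ∈ nilHat b :=
  Submodule.subset_span (Or.inr ⟨i, hi, x, hx, rfl⟩)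

lemma nilHat_lie_mem {x y : Affine 𝔤} (hx : x ∈ nilHat b) (hy : y ∈ nilHat b) :
    ⁅x, y⁆ ∈ nilHat b := by
  -- For nonnegative exponents the cocycle vanishes: `m = -n` forces `n = 0`, which is its
  -- coefficient.
  have key : ∀ (n m : ℤ) (x y : 𝔤), 0 ≤ n → 0 ≤ m → ⁅tAff 𝔤 n x, tAff 𝔤 m y⁆ =
      tAff 𝔤 (n + m) ⁅x, y⁆ := fun n m x y hn hm => by
    rw [lie_tAff, tAff_apply]
    congr 1
    split_ifs with h
    · have : n = 0 := by omega
      simp [this]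
    · rfl
  induction hx using Submodule.span_induction with
  | zero => rw [zero_lie]; exact zero_mem _
  | add x x' _ _ h h' => rw [add_lie]; exact add_mem h h'
  | smul c x _ h => rw [smul_lie]; exact Submodule.smul_mem _ _ h
  | mem x hx =>
    induction hy using Submodule.span_induction with
    | zero => rw [lie_zero]; exact zero_mem _
    | add x x' _ _ h h' => rw [lie_add]; exact add_mem h h'
    | smul c x _ h => rw [lie_smul]; exact Submodule.smul_mem _ _ h
    | mem y hy =>
      rcases hx with ⟨n, hn, x, rfl⟩ | ⟨i, hi, x, hx, rfl⟩
      · rcases hy with ⟨m, hm, y, rfl⟩ | ⟨j, hj, y, hy, rfl⟩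
        · rw [← tAff_apply, ← tAff_apply, key n m x y hn.le hm.le]
          exact tAff_mem_nilHat (by omega) _
        · rw [← tAff_apply, ← tAff_apply, key n 0 x y hn.le le_rfl]
          exact tAff_mem_nilHat (by omega) _
      · rcases hy with ⟨m, hm, y, rfl⟩ | ⟨j, hj, y, hy, rfl⟩
        · rw [← tAff_apply, ← tAff_apply, key 0 m x y le_rfl hm.le]
          exact tAff_mem_nilHat (by omega) _
        · rw [← tAff_apply, ← tAff_apply, key 0 0 x y le_rfl le_rfl, add_zero]
          have hmem := lie_mem_genWeightSpace_of_mem_genWeightSpace hx hy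
          by_cases h0 : ⁅x, y⁆ = 0
          · rw [h0, map_zero]; exact zero_mem _
          have hne : rootSpace H ((i.1 : H → ℂ) + (j.1 : H → ℂ)) ≠ ⊥ := by
            intro hbot
            have h1 : ⁅x, y⁆ ∈ rootSpace H ((i.1 : H → ℂ) + (j.1 : H → ℂ)) := hmem
            rw [hbot] at h1
            exact h0 (by simpa using h1)
          let γ : LieModule.Weight ℂ H 𝔤 := ⟨_, hne⟩
          have hsum : γ.toLinear = (rootSystem H).root i + (rootSystem H).root j := by
            ext y
            simp [γ]
          -- The heights of two positive roots have a positive sum, so the roots do not cancel.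
          have hγ : γ.IsNonZero := by
            intro h
            have h1 : γ.toLinear = 0 := by ext y; exact congrFun h y
            have hρ := extendForm_heightElt b i 0
            have hρ' := extendForm_heightElt b j 0
            have h2 := LinearMap.congr_fun (hsum.symm.trans h1) (heightElt b).1
            simp only [zero_smul, add_zero, extendForm_apply, zero_mul] at hρ hρ'
            rw [LinearMap.add_apply, hρ, hρ', LinearMap.zero_apply] at h2
            have h3 : b.height i + b.height j = 0 := by exact_mod_cast h2
            rw [RootPairing.Base.isPos_iff] at hi hj
            omega
          let g : H.root := ⟨γ, by simpa using hγ⟩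
          have hg : b.IsPos g := hi.add hj hsum
          exact tAff_zero_mem_nilHat hg hmem

lemma cartan_lie_nilHat (h : CartanHat H) {x : Affine 𝔤} (hx : x ∈ nilHat b) :
    ⁅cartanIncl h, x⁆ ∈ nilHat b := by
  refine nilHat_le_of_posVec (S := (nilHat b).comap
    (LieAlgebra.ad ℂ (Affine 𝔤) (cartanIncl h) : Affine 𝔤 →ₗ[ℂ] Affine 𝔤)) (fun k z hz => ?_) hx
  obtain ⟨β, -, -, hβ⟩ := exists_weight_of_mem_posVec hz
  show ⁅cartanIncl h, z⁆ ∈ nilHat b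
  rw [hβ h]
  exact Submodule.smul_mem _ _ (posVec_subset_nilHat hz)

lemma cartan_lie_cartan (h h' : CartanHat H) : ⁅cartanIncl h, cartanIncl h'⁆ = 0 := by
  have h1 : ⁅(h.1 : 𝔤), (h'.1 : 𝔤)⁆ = 0 := by
    simpa using congrArg Subtype.val (LieModule.IsTrivial.trivial h.1 h'.1)
  ext <;> simp [cartanIncl, h1]

lemma mem_borelHat {x : Affine 𝔤} :
    x ∈ borelHat b ↔ ∃ h : CartanHat H, ∃ y ∈ nilHat b, cartanIncl h + y = x := by
  have : Submodule.span ℂ (Set.range (cartanIncl (H := H))) = LinearMap.range (cartanLin H) :=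
    Submodule.span_eq (LinearMap.range (cartanLin H))
  rw [borelHat, this, Submodule.mem_sup]
  constructor
  · rintro ⟨_, ⟨h, rfl⟩, y, hy, rfl⟩
    exact ⟨h, y, hy, rfl⟩
  · rintro ⟨h, y, hy, rfl⟩
    exact ⟨_, ⟨h, rfl⟩, y, hy, rfl⟩

lemma nilHat_le_borelHat : nilHat b ≤ borelHat b := le_sup_right

lemma cartanIncl_mem_borelHat (h : CartanHat H) : cartanIncl h ∈ borelHat b :=
  mem_borelHat.mpr ⟨h, 0, zero_mem _, add_zero _⟩

/-- The derived algebra of the Borel subalgebra lies in its nilpotent part. -/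
lemma borelHat_lie_mem {x y : Affine 𝔤} (hx : x ∈ borelHat b) (hy : y ∈ borelHat b) :
    ⁅x, y⁆ ∈ nilHat b := by
  obtain ⟨h, x', hx', rfl⟩ := mem_borelHat.mp hx
  obtain ⟨h', y', hy', rfl⟩ := mem_borelHat.mp hy
  rw [add_lie, lie_add, lie_add, cartan_lie_cartan, zero_add, ← lie_skew x']
  exact add_mem (cartan_lie_nilHat h hy')
    (add_mem (neg_mem (cartan_lie_nilHat h' hx')) (nilHat_lie_mem hx' hy'))

/-- The properties of an anti-automorphism of the affine algebra that is the identity on the Cartan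
subalgebra. -/
structure IsChevalley (H : LieSubalgebra ℂ 𝔤) [H.IsCartanSubalgebra] (σ : Affine 𝔤 →ₗ[ℂ] Affine 𝔤) : Prop where
  lie : ∀ x y, σ ⁅x, y⁆ = ⁅σ y, σ x⁆
  cartan : ∀ h : CartanHat H, σ (cartanIncl h) = cartanIncl h
  surjective : Function.Surjective σ
  negative : ∀ (n : ℤ) (x : 𝔤), n < 0 → ∃ y, tAff 𝔤 n x = σ (tAff 𝔤 (-n) y)
  negRoot : ∀ (α : Module.Dual ℂ H) (x : 𝔤), x ∈ rootSpace H (-(α : H → ℂ)) →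
    ∃ y ∈ rootSpace H (α : H → ℂ), tAff 𝔤 0 x = σ (tAff 𝔤 0 y)

/-- The anti-automorphism exists for simple `𝔤`. -/
lemma exists_isChevalley {𝔤 : Type u} [LieRing 𝔤] [LieAlgebra ℂ 𝔤] [FiniteDimensional ℂ 𝔤]
    [IsSimple ℂ 𝔤] {H : LieSubalgebra ℂ 𝔤} [H.IsCartanSubalgebra]
    (b : (LieAlgebra.IsKilling.rootSystem H).Base) :
    ∃ σ : Affine 𝔤 →ₗ[ℂ] Affine 𝔤, IsChevalley H σ := by
  obtain ⟨θ, hθ⟩ := exists_lieEquiv_neg_on_cartan b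
  refine ⟨affSigma θ, affSigma_lie θ, affSigma_cartanIncl θ hθ, affSigma_surjective θ H hθ,
    fun n x _ => ⟨-θ.symm x, ?_⟩, fun α x hx => ⟨-θ.symm x, ?_, ?_⟩⟩
  · rw [affSigma_tAff]; simp
  · refine neg_mem (LieModule.mem_genWeightSpace _ _ _ |>.mpr fun h => ⟨1, ?_⟩)
    have h1 := lie_eq_smul_of_mem_rootSpace (α := -(α : H → ℂ)) hx h
    rw [LieSubalgebra.coe_bracket_of_module] at h1
    -- The inverse of `θ` is also `-1` on the Cartan subalgebra, hence interchanges the root spaces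
    -- of `α` and `-α`.
    have h2 : (h : 𝔤) = θ.symm (-(h : 𝔤)) := by rw [← hθ, LieEquiv.symm_apply_apply]
    have h3 : ⁅(h : 𝔤), θ.symm x⁆ = α h • θ.symm x := by
      rw [h2, ← LieEquiv.map_lie, neg_lie, h1]
      simp
    simp [h3]
  · rw [affSigma_tAff]; simp

variable (b) in
/-- The opposite nilpotent subalgebra. -/
def nilNeg (σ : Affine 𝔤 →ₗ[ℂ] Affine 𝔤) : Submodule ℂ (Affine 𝔤) := (nilHat b).map σ

variable {σ : Affine 𝔤 →ₗ[ℂ] Affine 𝔤}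

lemma IsChevalley.hasAdWeight (hσ : IsChevalley H σ) {x : Affine 𝔤} {β : WeightHat H}
    (hx : HasAdWeight x β) : HasAdWeight (σ x) (-β) := by
  intro h
  rw [← hσ.cartan h, ← lie_skew, ← hσ.lie, hx h, map_smul]
  simp

/-- Negative powers of `t` and negative root vectors in degree zero are images under `σ` of their
positive counterparts; everything else is in the Borel subalgebra. -/
lemma IsChevalley.mem_sup (hσ : IsChevalley H σ) (x : Affine 𝔤) :
    x ∈ nilNeg b σ ⊔ borelHat b := by
  have hneg : nilNeg b σ ≤ nilNeg b σ ⊔ borelHat b := le_sup_left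
  have hbor : borelHat b ≤ nilNeg b σ ⊔ borelHat b := le_sup_right
  refine affine_induction H _ (fun n x => ?_) (fun h => hbor (cartanIncl_mem_borelHat h)) x
  rcases lt_trichotomy n 0 with hn | rfl | hn
  · obtain ⟨y, hy⟩ := hσ.negative n x hn
    rw [hy]
    exact hneg ⟨_, tAff_mem_nilHat (by omega) _, rfl⟩
  · refine cartan_root_induction b ((nilNeg b σ ⊔ borelHat b).comap (tAff 𝔤 0)) (fun h => ?_)
      (fun i hi y hy => ?_) (fun i hi y hy => ?_) x
    · exact hbor (cartanIncl_mem_borelHat (h, 0, 0))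
    · exact hbor (nilHat_le_borelHat (tAff_zero_mem_nilHat hi hy))
    · obtain ⟨z, hz, hzy⟩ := hσ.negRoot ((rootSystem H).root i) y hy
      show tAff 𝔤 0 y ∈ nilNeg b σ ⊔ borelHat b
      rw [hzy]
      exact hneg ⟨_, tAff_zero_mem_nilHat hi hz, rfl⟩
  · exact hbor (nilHat_le_borelHat (tAff_mem_nilHat hn x))

lemma IsChevalley.nilNeg_lie_mem (hσ : IsChevalley H σ) {x y : Affine 𝔤} (hx : x ∈ nilNeg b σ)
    (hy : y ∈ nilNeg b σ) : ⁅x, y⁆ ∈ nilNeg b σ := by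
  obtain ⟨x, hx, rfl⟩ := hx
  obtain ⟨y, hy, rfl⟩ := hy
  exact ⟨⁅y, x⁆, nilHat_lie_mem hy hx, hσ.lie y x⟩

/-- The adjoint action of the element that defines the heights. -/
def adHeight (b : (LieAlgebra.IsKilling.rootSystem H).Base) : Module.End ℂ (Affine 𝔤) :=
  (LieAlgebra.ad ℂ (Affine 𝔤) (cartanIncl (heightElt b)) : Affine 𝔤 →ₗ[ℂ] Affine 𝔤)

lemma mem_eigenspace_adHeight {x : Affine 𝔤} {c : ℂ} :
    x ∈ (adHeight b).eigenspace c ↔ ⁅cartanIncl (heightElt b), x⁆ = c • x :=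
  Module.End.mem_eigenspace_iff

/-- The height element acts with positive eigenvalues here, by zero on the Cartan subalgebra and
with negative eigenvalues on the opposite part; independence of eigenspaces then makes the
triangular decomposition direct. -/
lemma nilHat_le_eigen : nilHat b ≤ ⨆ c ∈ {c : ℂ | 0 < c.re}, (adHeight b).eigenspace c := by
  refine nilHat_le_of_posVec fun k z hz => ?_
  obtain ⟨β, hβ, -, hz⟩ := exists_weight_of_mem_posVec hz
  obtain ⟨k, -, hk, hk', -⟩ := posRoots_height b hβ
  refine Submodule.mem_iSup_of_mem (k : ℂ) (Submodule.mem_iSup_of_mem (by simpa using hk) ?_)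
  rw [mem_eigenspace_adHeight, hz, hk']

lemma IsChevalley.nilNeg_le_eigen (hσ : IsChevalley H σ) :
    nilNeg b σ ≤ ⨆ c ∈ {c : ℂ | c.re < 0}, (adHeight b).eigenspace c := by
  refine Submodule.map_le_iff_le_comap.mpr (nilHat_le_of_posVec fun k z hz => ?_)
  obtain ⟨β, hβ, -, hz⟩ := exists_weight_of_mem_posVec hz
  obtain ⟨k, -, hk, hk', -⟩ := posRoots_height b hβ
  refine Submodule.mem_iSup_of_mem (-(k : ℂ)) (Submodule.mem_iSup_of_mem (by simpa using hk) ?_)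
  rw [mem_eigenspace_adHeight, hσ.hasAdWeight hz, LinearMap.neg_apply, hk']

lemma cartan_mem_eigen (h : CartanHat H) : cartanIncl h ∈ (adHeight b).eigenspace 0 := by
  rw [mem_eigenspace_adHeight, cartan_lie_cartan, zero_smul]

lemma cartanIncl_injective : Function.Injective (cartanIncl (H := H)) := by
  intro h h' hh
  have h1 := congrArg (fun x => Loop.coeffs 𝔤 x.loop 0) hh
  simp only [cartanIncl, coeffs_tpow, Finsupp.single_eq_same] at h1
  exact Prod.ext (Subtype.ext h1) (Prod.ext (congrArg Affine.cen hh) (congrArg Affine.der hh))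

lemma eq_zero_of_cartanIncl_mem_nilHat {h : CartanHat H} (hh : cartanIncl h ∈ nilHat b) :
    h = 0 := by
  have hd := (Module.End.eigenspaces_iSupIndep (adHeight b)).disjoint_biSup
    (x := 0) (y := {c : ℂ | 0 < c.re}) (by simp)
  have h0 : cartanIncl h = 0 := by
    exact Submodule.disjoint_def.mp hd _ (cartan_mem_eigen h) (nilHat_le_eigen hh)
  exact cartanIncl_injective (h0.trans (map_zero (cartanLin H)).symm)

lemma IsChevalley.disjoint (hσ : IsChevalley H σ) : Disjoint (nilNeg b σ) (borelHat b) := by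
  have hd := (Module.End.eigenspaces_iSupIndep (adHeight b)).disjoint_biSup_biSup
    (s := {c : ℂ | c.re < 0}) (t := {c : ℂ | 0 ≤ c.re})
    (by rw [Set.disjoint_left]; intro c (hc : c.re < 0) (hc' : 0 ≤ c.re); linarith)
  refine hd.mono hσ.nilNeg_le_eigen ?_
  intro x hx
  obtain ⟨h, y, hy, rfl⟩ := mem_borelHat.mp hx
  refine add_mem (Submodule.mem_iSup_of_mem 0 (Submodule.mem_iSup_of_mem (by simp)
    (cartan_mem_eigen h))) ?_
  refine (nilHat_le_eigen.trans ?_) hy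
  exact biSup_mono fun c (hc : 0 < c.re) => le_of_lt hc

end Triangular

/-! ## Weight modules -/

section Basics

variable {𝔤 : Type u} [LieRing 𝔤] [LieAlgebra ℂ 𝔤]

/-- By the universal property the Lie algebra map into `S` extends to the enveloping algebra, and
its composite with the inclusion is the identity by uniqueness. -/
lemma mem_of_forall_ι_mem {L : Type*} [LieRing L] [LieAlgebra ℂ L]
    (S : Subalgebra ℂ (UniversalEnvelopingAlgebra ℂ (L)))
    (hS : ∀ x, UniversalEnvelopingAlgebra.ι ℂ x ∈ S)
    (z : UniversalEnvelopingAlgebra ℂ (L)) : z ∈ S := by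
  let _ : LieRing S := LieRing.ofAssociativeRing
  let _ : LieRing (UniversalEnvelopingAlgebra ℂ (L)) := LieRing.ofAssociativeRing
  let f : L →ₗ⁅ℂ⁆ S :=
    { toFun := fun x => ⟨UniversalEnvelopingAlgebra.ι ℂ x, hS x⟩
      map_add' := fun x y => Subtype.ext (map_add _ x y)
      map_smul' := fun c x => Subtype.ext (map_smul _ c x)
      map_lie' := fun {x y} => Subtype.ext (LieHom.map_lie _ x y) }
  have h : S.val.comp (UniversalEnvelopingAlgebra.lift ℂ f) = AlgHom.id ℂ _ := by
    apply UniversalEnvelopingAlgebra.hom_ext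
    ext x
    show (UniversalEnvelopingAlgebra.lift ℂ f (UniversalEnvelopingAlgebra.ι ℂ x) :
      UniversalEnvelopingAlgebra ℂ (L)) = _
    rw [UniversalEnvelopingAlgebra.lift_ι_apply]
    rfl
  have hz := DFunLike.congr_fun h z
  rw [AlgHom.id_apply] at hz
  rw [← hz]
  exact (UniversalEnvelopingAlgebra.lift ℂ f z).2

variable (A : Type v) [CommRing A] [Algebra ℂ A]

lemma inc_add (x y : Affine 𝔤) : inc A (x + y) = inc A x + inc A y := by
  rw [inc, map_add, TensorProduct.tmul_add]; rfl

lemma inc_smul (c : ℂ) (x : Affine 𝔤) : inc A (c • x) = algebraMap ℂ A c • inc A x := by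
  rw [inc, inc, map_smul, TensorProduct.tmul_smul, TensorProduct.smul_tmul',
    TensorProduct.smul_tmul', smul_eq_mul, mul_one, Algebra.smul_def, mul_one]

lemma inc_zero : inc A (0 : Affine 𝔤) = 0 := by
  rw [inc, map_zero, TensorProduct.tmul_zero]

lemma inc_lie (x y : Affine 𝔤) : inc A ⁅x, y⁆ = inc A x * inc A y - inc A y * inc A x := by
  let _ : LieRing (UniversalEnvelopingAlgebra ℂ (Affine 𝔤)) := LieRing.ofAssociativeRing
  simp only [inc, LieHom.map_lie, LieRing.of_associative_ring_bracket, TensorProduct.tmul_sub,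
    Algebra.TensorProduct.tmul_mul_tmul, mul_one]

variable {A} {M : Type w} [AddCommGroup M] [Module A M] [Module (UA 𝔤 A) M]
  [IsScalarTower A (UA 𝔤 A) M]

lemma inc_lie_smul (x y : Affine 𝔤) (m : M) :
    inc A ⁅x, y⁆ • m = inc A x • inc A y • m - inc A y • inc A x • m := by
  rw [inc_lie, sub_smul, mul_smul, mul_smul]

lemma ua_smul_comm (u : UA 𝔤 A) (a : A) (m : M) : u • a • m = a • u • m := by
  have : SMulCommClass A (UA 𝔤 A) M := IsScalarTower.to_smulCommClass
  exact (smul_comm a u m).symm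

lemma inc_smul_smul (c : ℂ) (x : Affine 𝔤) (m : M) :
    inc A (c • x) • m = algebraMap ℂ A c • inc A x • m := by
  rw [inc_smul, smul_assoc]

variable (A M) in
/-- The action of an element of `A ⊗ U` as an `A`-linear map. -/
def act (u : UA 𝔤 A) : M →ₗ[A] M where
  toFun m := u • m
  map_add' := smul_add u
  map_smul' a m := ua_smul_comm u a m

variable (M) in
/-- The elements of the affine algebra that map the submodule `N` to the submodule `N'`. -/
def transporter (N N' : Submodule A M) : Submodule ℂ (Affine 𝔤) where
  carrier := {x | ∀ m ∈ N, inc A x • m ∈ N'}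
  add_mem' := fun {x y} hx hy m hm => by
    rw [inc_add, add_smul]; exact add_mem (hx m hm) (hy m hm)
  zero_mem' := fun m _ => by rw [inc_zero, zero_smul]; exact zero_mem _
  smul_mem' := fun c x hx m hm => by
    rw [inc_smul_smul]; exact N'.smul_mem _ (hx m hm)

/-- An `A`-submodule that is stable under a Lie algebra is stable under its enveloping algebra. -/
lemma env_smul_mem {L : Type*} [LieRing L] [LieAlgebra ℂ L] {E : Type*} [AddCommGroup E] [Module A E]
    [Module (A ⊗[ℂ] UniversalEnvelopingAlgebra ℂ L) E]
    [IsScalarTower A (A ⊗[ℂ] UniversalEnvelopingAlgebra ℂ L) E] {N : Submodule A E}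
    (hN : ∀ x : L, ∀ m ∈ N, ((1 : A) ⊗ₜ[ℂ] UniversalEnvelopingAlgebra.ι ℂ x :
      A ⊗[ℂ] UniversalEnvelopingAlgebra ℂ L) • m ∈ N)
    (u : A ⊗[ℂ] UniversalEnvelopingAlgebra ℂ L) {m : E} (hm : m ∈ N) : u • m ∈ N := by
  let S : Subalgebra ℂ (UniversalEnvelopingAlgebra ℂ (L)) :=
    { carrier := {z | ∀ m ∈ N, ((1 : A) ⊗ₜ[ℂ] z : A ⊗[ℂ] UniversalEnvelopingAlgebra ℂ L) • m ∈ N}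
      mul_mem' := fun {y z} hy hz m hm => by
        have : ((1 : A) ⊗ₜ[ℂ] (y * z) : A ⊗[ℂ] UniversalEnvelopingAlgebra ℂ L) = ((1 : A) ⊗ₜ[ℂ] y) * ((1 : A) ⊗ₜ[ℂ] z) := by
          rw [Algebra.TensorProduct.tmul_mul_tmul, mul_one]
        rw [this, mul_smul]
        exact hy _ (hz m hm)
      add_mem' := fun {y z} hy hz m hm => by
        rw [TensorProduct.tmul_add, add_smul]
        exact add_mem (hy m hm) (hz m hm)
      algebraMap_mem' := fun c m hm => by
        have : ((1 : A) ⊗ₜ[ℂ] (algebraMap ℂ _ c) : A ⊗[ℂ] UniversalEnvelopingAlgebra ℂ L) =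
            algebraMap ℂ A c • (1 : A ⊗[ℂ] UniversalEnvelopingAlgebra ℂ L) := by
          rw [Algebra.algebraMap_eq_smul_one, TensorProduct.tmul_smul, TensorProduct.smul_tmul',
            Algebra.TensorProduct.one_def, TensorProduct.smul_tmul', smul_eq_mul, mul_one,
            Algebra.smul_def, mul_one]
        rw [this, smul_assoc, one_smul]
        exact N.smul_mem _ hm }
  induction u using TensorProduct.induction_on with
  | zero => rw [zero_smul]; exact zero_mem _
  | add y z hy hz => rw [add_smul]; exact add_mem hy hz
  | tmul a z =>
    have : (a ⊗ₜ[ℂ] z : A ⊗[ℂ] UniversalEnvelopingAlgebra ℂ L) = a • ((1 : A) ⊗ₜ[ℂ] z) := by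
      rw [TensorProduct.smul_tmul', smul_eq_mul, mul_one]
    rw [this, smul_assoc]
    exact N.smul_mem _ (mem_of_forall_ι_mem S (fun x => hN x) z m hm)

lemma ua_smul_mem {N : Submodule A M} (hN : ∀ x : Affine 𝔤, ∀ m ∈ N, inc A x • m ∈ N) (u : UA 𝔤 A)
    {m : M} (hm : m ∈ N) : u • m ∈ N := env_smul_mem hN u hm

/-- The `A ⊗ U`-submodule given by a stable `A`-submodule. -/
def stableSub (N : Submodule A M) (hN : ∀ x : Affine 𝔤, ∀ m ∈ N, inc A x • m ∈ N) :
    Submodule (UA 𝔤 A) M where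
  carrier := N
  add_mem' := N.add_mem
  zero_mem' := N.zero_mem
  smul_mem' u _ hm := ua_smul_mem hN u hm

/-- The underlying `A`-submodule of an `A ⊗ U`-submodule. -/
def toA (N : Submodule (UA 𝔤 A) M) : Submodule A M where
  carrier := N
  add_mem' := N.add_mem
  zero_mem' := N.zero_mem
  smul_mem' a m hm := by
    have : a • m = (a • (1 : UA 𝔤 A)) • m := by rw [smul_assoc, one_smul]
    rw [this]
    exact N.smul_mem _ hm

lemma smulA_mem (N : Submodule (UA 𝔤 A) M) (a : A) {m : M} (hm : m ∈ N) : a • m ∈ N :=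
  (toA N).smul_mem a hm

/-- Every `A ⊗ U`-linear map is `A`-linear. -/
def mapA {M' : Type*} [AddCommGroup M'] [Module A M'] [Module (UA 𝔤 A) M']
    [IsScalarTower A (UA 𝔤 A) M'] (f : M →ₗ[UA 𝔤 A] M') : M →ₗ[A] M' where
  toFun := f
  map_add' := map_add f
  map_smul' a m := by
    have h : ∀ m : M, a • m = (a • (1 : UA 𝔤 A)) • m := fun m => by rw [smul_assoc, one_smul]
    have h' : ∀ m : M', a • m = (a • (1 : UA 𝔤 A)) • m := fun m => by rw [smul_assoc, one_smul]
    rw [h, map_smul, ← h']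
    rfl

lemma map_smulA {M' : Type*} [AddCommGroup M'] [Module A M'] [Module (UA 𝔤 A) M']
    [IsScalarTower A (UA 𝔤 A) M'] (f : M →ₗ[UA 𝔤 A] M') (a : A) (m : M) :
    f (a • m) = a • f m := map_smul (mapA f) a m

/-- Multiplication by an element of `A` as an `A ⊗ U`-linear map. -/
def homothety (M : Type w) [AddCommGroup M] [Module A M] [Module (UA 𝔤 A) M]
    [IsScalarTower A (UA 𝔤 A) M] (a : A) : M →ₗ[UA 𝔤 A] M where
  toFun m := a • m
  map_add' := smul_add a
  map_smul' u m := (ua_smul_comm u a m).symm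

@[simp] lemma homothety_apply (a : A) (m : M) :
    (homothety M a : M →ₗ[UA 𝔤 A] M) m = a • m := rfl

end Basics

/-! ### Weight spaces and weight projections -/

section Weights

variable {𝔤 : Type u} [LieRing 𝔤] [LieAlgebra ℂ 𝔤] {H : LieSubalgebra ℂ 𝔤}
  {A : Type v} [CommRing A] [Algebra ℂ A] [Algebra (SymmetricAlgebra ℂ H) A]

lemma charVal_sub (lam μ : WeightHat H) (h : CartanHat H) :
    charVal A lam h - charVal A μ h = algebraMap ℂ A (lam h - μ h) := by
  rw [charVal, charVal, map_sub]; ring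

lemma charVal_add (lam β : WeightHat H) (h : CartanHat H) :
    charVal A (lam + β) h = charVal A lam h + algebraMap ℂ A (β h) := by
  rw [charVal, charVal, LinearMap.add_apply, map_add]; ring

variable {M : Type w} [AddCommGroup M] [Module A M] [Module (UA 𝔤 A) M]
  [IsScalarTower A (UA 𝔤 A) M]
  {N : Type*} [AddCommGroup N] [Module A N] [Module (UA 𝔤 A) N]
  [IsScalarTower A (UA 𝔤 A) N]

lemma mem_weightSpace {lam : WeightHat H} {m : M} : m ∈ weightSpace A M lam ↔
    ∀ h : CartanHat H, inc A (cartanIncl h) • m = charVal A lam h • m := Iff.rfl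

lemma inc_smul_mem_weightSpace {x : Affine 𝔤} {β lam : WeightHat H} (hx : HasAdWeight x β) {m : M}
    (hm : m ∈ weightSpace A M lam) : inc A x • m ∈ weightSpace A M (lam + β) := by
  intro h
  have h1 := inc_lie_smul (A := A) (cartanIncl h) x m
  rw [hx h, inc_smul_smul, hm h, ua_smul_comm, eq_sub_iff_add_eq] at h1
  rw [← h1, charVal_add, add_smul, add_comm]

lemma map_mem_weightSpace (f : M →ₗ[UA 𝔤 A] N) {lam : WeightHat H} {m : M}
    (hm : m ∈ weightSpace A M lam) : f m ∈ weightSpace A N lam := fun h => by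
  rw [← map_smul, hm h, map_smulA]

/-- Vectors of different weights are linearly independent. -/
lemma eq_zero_of_sum_weight_eq_zero (s : Finset (WeightHat H)) (f : WeightHat H → M)
    (hf : ∀ lam ∈ s, f lam ∈ weightSpace A M lam) (h0 : ∑ lam ∈ s, f lam = 0) :
    ∀ lam ∈ s, f lam = 0 := by
  classical
  induction s using Finset.induction_on generalizing f with
  | empty => simp
  | insert κ s hκ ih =>
    have hs : ∀ lam ∈ s, f lam = 0 := by
      intro lam hlam
      have hne : lam ≠ κ := by rintro rfl; exact hκ hlam
      obtain ⟨h, hh⟩ : ∃ h, lam h ≠ κ h := by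
        by_contra hcon
        push Not at hcon
        exact hne (LinearMap.ext hcon)
      -- Subtract the `κ`-eigenvalue of `h` from its action: the term at `κ` disappears. In the
      -- differences `τ` cancels, so they are complex numbers, and the one at `lam` is a unit of
      -- `A`.
      have h1 := ih (fun ν => (charVal A ν h - charVal A κ h) • f ν)
        (fun ν hν => Submodule.smul_mem _ _ (hf ν (Finset.mem_insert_of_mem hν))) ?_ lam hlam
      · simp only [charVal_sub] at h1
        have hu : IsUnit (algebraMap ℂ A (lam h - κ h)) :=
          (isUnit_iff_ne_zero.mpr (sub_ne_zero.mpr hh)).map _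
        exact hu.smul_eq_zero.mp h1
      · have h2 : inc A (cartanIncl h) • (∑ ν ∈ insert κ s, f ν) =
            ∑ ν ∈ insert κ s, charVal A ν h • f ν := by
          rw [Finset.smul_sum]
          exact Finset.sum_congr rfl fun ν hν => hf ν hν h
        have h3 : ∑ ν ∈ insert κ s, (charVal A ν h - charVal A κ h) • f ν = 0 := by
          simp only [sub_smul, Finset.sum_sub_distrib]
          rw [← h2, ← Finset.smul_sum, h0, smul_zero, smul_zero, sub_zero]
        rw [Finset.sum_insert hκ, sub_self, zero_smul, zero_add] at h3
        exact h3
    intro lam hlam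
    rw [Finset.sum_insert hκ, Finset.sum_eq_zero hs, add_zero] at h0
    rcases Finset.mem_insert.mp hlam with rfl | h
    · exact h0
    · exact hs lam h

variable (H A M) in
lemma iSupIndep_weightSpace : iSupIndep (fun lam : WeightHat H => weightSpace A M lam) := by
  classical
  rw [iSupIndep_iff_finsetSum_eq_zero_imp_eq_zero]
  intro s f hf h0 lam hlam
  exact eq_zero_of_sum_weight_eq_zero s f hf h0 lam hlam

/-- Independence of the weight spaces is automatic, even though `A` is not a field. -/
lemma isWeightModule_iff :
    IsWeightModule H A M ↔ ⨆ lam : WeightHat H, weightSpace A M lam = ⊤ :=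
  ⟨fun h => h.2, fun h => ⟨iSupIndep_weightSpace H A M, h⟩⟩

lemma IsWeightModule.isCompl (hM : IsWeightModule H A M) (lam : WeightHat H) :
    IsCompl (weightSpace A M lam) (⨆ κ ≠ lam, weightSpace A M κ) := by
  refine ⟨hM.1 lam, ?_⟩
  rw [codisjoint_iff, eq_top_iff, ← hM.2]
  refine iSup_le fun κ => ?_
  by_cases h : κ = lam
  · subst h; exact le_sup_left
  · exact le_sup_of_le_right (le_iSup₂_of_le κ h le_rfl)

/-- The projection of a weight module to a weight space. -/
def wproj (hM : IsWeightModule H A M) (lam : WeightHat H) : M →ₗ[A] M :=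
  (weightSpace A M lam).subtype ∘ₗ Submodule.projectionOnto _ _ (hM.isCompl lam)

lemma wproj_mem (hM : IsWeightModule H A M) (lam : WeightHat H) (m : M) :
    wproj hM lam m ∈ weightSpace A M lam :=
  (Submodule.projectionOnto _ _ (hM.isCompl lam) m).2

lemma wproj_self (hM : IsWeightModule H A M) {lam : WeightHat H} {m : M}
    (hm : m ∈ weightSpace A M lam) : wproj hM lam m = m := by
  rw [wproj, LinearMap.comp_apply]
  exact congrArg Subtype.val
    (Submodule.projectionOnto_apply_left (hM.isCompl lam) ⟨m, hm⟩)

lemma wproj_of_ne (hM : IsWeightModule H A M) {lam κ : WeightHat H} (h : κ ≠ lam) {m : M}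
    (hm : m ∈ weightSpace A M κ) : wproj hM lam m = 0 := by
  have h1 : m ∈ ⨆ κ ≠ lam, weightSpace A M κ :=
    Submodule.mem_iSup_of_mem κ (Submodule.mem_iSup_of_mem h hm)
  rw [wproj, LinearMap.comp_apply, Submodule.projectionOnto_apply_of_mem_right _ h1, map_zero]

lemma IsWeightModule.induction (hM : IsWeightModule H A M) {p : M → Prop}
    (hw : ∀ lam : WeightHat H, ∀ m ∈ weightSpace A M lam, p m) (h0 : p 0)
    (ha : ∀ m n, p m → p n → p (m + n)) (m : M) : p m := by
  have hm : m ∈ ⨆ lam : WeightHat H, weightSpace A M lam := hM.2 ▸ Submodule.mem_top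
  exact Submodule.iSup_induction (motive := p) _ hm hw h0 ha

/-- Every element is the sum of its weight components. -/
lemma mem_of_wproj_mem (hM : IsWeightModule H A M) {S : Submodule A M} {m : M}
    (h : ∀ lam, wproj hM lam m ∈ S) : m ∈ S := by
  have hsum : ∃ s : Finset (WeightHat H), ∑ lam ∈ s, wproj hM lam m = m := by
    classical
    have hm : m ∈ ⨆ lam : WeightHat H, weightSpace A M lam := hM.2 ▸ Submodule.mem_top
    obtain ⟨f, hf, rfl⟩ := (Submodule.mem_iSup_iff_exists_finsupp _ _).mp hm
    refine ⟨f.support, ?_⟩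
    rw [Finsupp.sum]
    refine Finset.sum_congr rfl fun lam hlam => ?_
    rw [map_sum, Finset.sum_eq_single_of_mem lam hlam]
    · exact wproj_self hM (hf lam)
    · exact fun κ _ hne => wproj_of_ne hM hne (hf κ)
  obtain ⟨s, hs⟩ := hsum
  rw [← hs]
  exact sum_mem fun lam _ => h lam

lemma map_wproj (hM : IsWeightModule H A M) (hN : IsWeightModule H A N) (f : M →ₗ[UA 𝔤 A] N)
    (lam : WeightHat H) (m : M) : f (wproj hM lam m) = wproj hN lam (f m) := by
  refine hM.induction (p := fun m => f (wproj hM lam m) = wproj hN lam (f m)) ?_ ?_ ?_ m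
  · intro κ m hm
    by_cases h : κ = lam
    · subst h
      rw [wproj_self hM hm, wproj_self hN (map_mem_weightSpace f hm)]
    · rw [wproj_of_ne hM h hm, wproj_of_ne hN h (map_mem_weightSpace f hm), map_zero]
  · simp
  · intro m n h h'
    rw [map_add, map_add, map_add, map_add, h, h']

lemma IsWeightModule.of_surjective (hM : IsWeightModule H A M) (f : M →ₗ[UA 𝔤 A] N)
    (hf : Function.Surjective f) : IsWeightModule H A N := by
  rw [isWeightModule_iff, eq_top_iff]
  rintro n -
  obtain ⟨m, rfl⟩ := hf n
  refine hM.induction (p := fun m => f m ∈ ⨆ lam : WeightHat H, weightSpace A N lam) ?_ ?_ ?_ m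
  · exact fun lam m hm => Submodule.mem_iSup_of_mem lam (map_mem_weightSpace f hm)
  · simp
  · intro m n h h'
    rw [map_add]; exact add_mem h h'

/-- Weight vectors can be lifted along surjections of weight modules. -/
lemma exists_weight_lift (hM : IsWeightModule H A M) (f : M →ₗ[UA 𝔤 A] N)
    (hf : Function.Surjective f) {lam : WeightHat H} {n : N} (hn : n ∈ weightSpace A N lam) :
    ∃ m ∈ weightSpace A M lam, f m = n := by
  obtain ⟨m, rfl⟩ := hf n
  have hN := hM.of_surjective f hf
  exact ⟨wproj hM lam m, wproj_mem hM lam m, by rw [map_wproj hM hN, wproj_self hN hn]⟩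

/-- The quotient by `X` is a weight module and the quotient map commutes with the projections. -/
lemma wproj_mem_of_mem (hM : IsWeightModule H A M) (X : Submodule (UA 𝔤 A) M) (lam : WeightHat H)
    {m : M} (hm : m ∈ X) : wproj hM lam m ∈ X := by
  have hQ : IsWeightModule H A (M ⧸ X) := hM.of_surjective X.mkQ X.mkQ_surjective
  have h1 := map_wproj hM hQ X.mkQ lam m
  rw [(Submodule.Quotient.mk_eq_zero X).mpr hm |> (fun h => (h : X.mkQ m = 0)), map_zero] at h1
  exact (Submodule.Quotient.mk_eq_zero X).mp h1

lemma coe_mem_weightSpace {X : Submodule (UA 𝔤 A) M} {lam : WeightHat H} {x : X} :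
    (x : M) ∈ weightSpace A M lam ↔ x ∈ weightSpace A X lam := by
  simp only [mem_weightSpace]
  refine forall_congr' fun h => ?_
  rw [Subtype.ext_iff]
  rfl

lemma IsWeightModule.submodule (hM : IsWeightModule H A M) (X : Submodule (UA 𝔤 A) M) :
    IsWeightModule H A X := by
  rw [isWeightModule_iff, eq_top_iff]
  rintro x -
  let S : Submodule A M := (⨆ lam : WeightHat H, weightSpace A X lam).map (mapA X.subtype)
  have hS : (x : M) ∈ S := mem_of_wproj_mem hM fun lam =>
    ⟨⟨_, wproj_mem_of_mem hM X lam x.2⟩, Submodule.mem_iSup_of_mem lam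
      (coe_mem_weightSpace.mp (wproj_mem hM lam x)), rfl⟩
  obtain ⟨y, hy, hyx⟩ := hS
  rwa [← Subtype.ext hyx]

end Weights

/-! ## Finiteness of weight spaces -/

section Words

variable {𝔤 : Type u} [LieRing 𝔤] [LieAlgebra ℂ 𝔤]
  {A : Type v} [CommRing A] [Algebra ℂ A]
  {M : Type w} [AddCommGroup M] [Module A M] [Module (UA 𝔤 A) M] [IsScalarTower A (UA 𝔤 A) M]

/-- The `A`-submodule spanned by the `x m` with `x ∈ V` and `m ∈ S`. -/
def opSpan (V : Submodule ℂ (Affine 𝔤)) (S : Submodule A M) : Submodule A M :=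
  ⨆ x : V, S.map (act A M (inc A (x : Affine 𝔤)))

lemma inc_smul_mem_opSpan {V : Submodule ℂ (Affine 𝔤)} {S : Submodule A M} {x : Affine 𝔤} {m : M}
    (hx : x ∈ V) (hm : m ∈ S) : inc A x • m ∈ opSpan V S :=
  Submodule.mem_iSup_of_mem (⟨x, hx⟩ : V) ⟨m, hm, rfl⟩

lemma opSpan_le {V : Submodule ℂ (Affine 𝔤)} {S T : Submodule A M} :
    opSpan V S ≤ T ↔ ∀ x ∈ V, ∀ m ∈ S, inc A x • m ∈ T := by
  refine ⟨fun h x hx m hm => h (inc_smul_mem_opSpan hx hm), fun h => iSup_le ?_⟩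
  rintro ⟨x, hx⟩ _ ⟨m, hm, rfl⟩
  exact h x hx m hm

lemma opSpan_fg {V : Submodule ℂ (Affine 𝔤)} (hV : V.FG) {S : Submodule A M} (hS : S.FG) :
    (opSpan V S).FG := by
  obtain ⟨t, rfl⟩ := hV
  have : opSpan (Submodule.span ℂ (t : Set (Affine 𝔤))) S =
      ⨆ x ∈ t, S.map (act A M (inc A x)) := by
    apply le_antisymm
    · rw [opSpan_le]
      intro x hx
      have h : Submodule.span ℂ (t : Set (Affine 𝔤)) ≤
          transporter M S (⨆ x ∈ t, S.map (act A M (inc A x))) :=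
        Submodule.span_le.mpr fun x hx m hm =>
          Submodule.mem_iSup_of_mem x (Submodule.mem_iSup_of_mem hx ⟨m, hm, rfl⟩)
      exact h hx
    · refine iSup₂_le fun x hx => ?_
      rintro _ ⟨m, hm, rfl⟩
      exact inc_smul_mem_opSpan (Submodule.subset_span hx) hm
  rw [this]
  exact Submodule.fg_biSup t _ fun x _ => hS.map _

/-- The span of the `x₁ ⋯ x_r m` with `m ∈ S`, `x_i ∈ V k_i`, `k_i > 0` and `∑ k_i = n`. -/
def words (V : ℕ → Submodule ℂ (Affine 𝔤)) (S : Submodule A M) : ℕ → Submodule A M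
  | 0 => S
  | n + 1 => ⨆ k : Fin (n + 1), opSpan (V (k + 1)) (words V S (n - k))

variable {V : ℕ → Submodule ℂ (Affine 𝔤)} {S : Submodule A M}

lemma words_zero : words V S 0 = S := by rw [words]

lemma inc_smul_mem_words {k n : ℕ} (hk : 0 < k) {x : Affine 𝔤} (hx : x ∈ V k) {m : M}
    (hm : m ∈ words V S n) : inc A x • m ∈ words V S (n + k) := by
  obtain ⟨l, rfl⟩ := Nat.exists_eq_succ_of_ne_zero hk.ne'
  rw [Nat.succ_eq_add_one, ← add_assoc, words]
  refine Submodule.mem_iSup_of_mem (⟨l, by omega⟩ : Fin (n + l + 1)) ?_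
  apply inc_smul_mem_opSpan hx
  rwa [Nat.add_sub_cancel]

/-- To prove that all words lie in a family of submodules one may add one letter at a time. -/
lemma words_le {T : ℕ → Submodule A M} (h0 : S ≤ T 0)
    (hT : ∀ n k, 0 < k → ∀ x ∈ V k, words V S n ≤ T n → ∀ m ∈ words V S n,
      inc A x • m ∈ T (n + k)) (n : ℕ) :
    words V S n ≤ T n := by
  induction n using Nat.strong_induction_on with
  | _ n ih =>
    cases n with
    | zero => rwa [words_zero]
    | succ n =>
      rw [words]
      refine iSup_le fun k => opSpan_le.mpr fun x hx m hm => ?_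
      have h1 := hT (n - k) (k + 1) (Nat.succ_pos _) x hx (ih _ (by omega)) m hm
      rwa [show n - (k : ℕ) + (k + 1) = n + 1 by omega] at h1

/-- All letters have positive height, so only finitely many heights are possible for the first
letter. -/
lemma words_fg (hV : ∀ k, (V k).FG) (hS : S.FG) (n : ℕ) : (words V S n).FG := by
  induction n using Nat.strong_induction_on with
  | _ n ih =>
    cases n with
    | zero => rwa [words_zero]
    | succ n =>
      rw [words]
      exact Submodule.fg_iSup _ fun k => opSpan_fg (hV _) (ih _ (by omega))

end Words

/-! ### Sums of weight spaces over sets of weights -/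

section WeightSpan

variable {𝔤 : Type u} [LieRing 𝔤] [LieAlgebra ℂ 𝔤] {H : LieSubalgebra ℂ 𝔤}
  {A : Type v} [CommRing A] [Algebra ℂ A] [Algebra (SymmetricAlgebra ℂ H) A]
  {M : Type w} [AddCommGroup M] [Module A M] [Module (UA 𝔤 A) M] [IsScalarTower A (UA 𝔤 A) M]

variable (A M) in
/-- The sum of the weight spaces with weight in a given set. -/
def wspan (P : Set (WeightHat H)) : Submodule A M := ⨆ κ ∈ P, weightSpace A M κ

lemma weightSpace_le_wspan {P : Set (WeightHat H)} {κ : WeightHat H} (h : κ ∈ P) :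
    weightSpace A M κ ≤ wspan A M P := le_iSup₂_of_le κ h le_rfl

lemma wspan_le {P : Set (WeightHat H)} {T : Submodule A M} :
    wspan A M P ≤ T ↔ ∀ κ ∈ P, weightSpace A M κ ≤ T := iSup₂_le_iff

lemma inc_smul_mem_wspan {P Q : Set (WeightHat H)} {x : Affine 𝔤} {β : WeightHat H}
    (hx : HasAdWeight x β) (h : ∀ κ ∈ P, κ + β ∈ Q) {m : M} (hm : m ∈ wspan A M P) :
    inc A x • m ∈ wspan A M Q := by
  have : wspan A M P ≤ (wspan A M Q).comap (act A M (inc A x)) :=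
    wspan_le.mpr fun κ hκ n hn =>
      weightSpace_le_wspan (h κ hκ) (inc_smul_mem_weightSpace hx hn)
  exact this hm

lemma wproj_wspan (hM : IsWeightModule H A M) {P : Set (WeightHat H)} {κ : WeightHat H}
    (h : κ ∉ P) {m : M} (hm : m ∈ wspan A M P) : wproj hM κ m = 0 := by
  have : wspan A M P ≤ LinearMap.ker (wproj hM κ) := wspan_le.mpr fun ν hν n hn =>
    wproj_of_ne hM (fun (h' : ν = κ) => h (h' ▸ hν)) hn
  exact this hm

lemma cartan_smul_mem_of_mem {N : Submodule A M} {κ : WeightHat H} {m : M}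
    (hm : m ∈ weightSpace A M κ) (h : m ∈ N) (y : CartanHat H) :
    inc A (cartanIncl y) • m ∈ N := by
  rw [hm y]; exact N.smul_mem _ h

end WeightSpan

/-! ### Local Borel finiteness and finitely generated weight spaces -/

section Finiteness

variable {𝔤 : Type u} [LieRing 𝔤] [LieAlgebra ℂ 𝔤] [FiniteDimensional ℂ 𝔤]
  [LieAlgebra.IsKilling ℂ 𝔤] {H : LieSubalgebra ℂ 𝔤} [H.IsCartanSubalgebra]
  {b : (LieAlgebra.IsKilling.rootSystem H).Base}
  {A : Type v} [CommRing A] [Algebra ℂ A] [Algebra (SymmetricAlgebra ℂ H) A]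
  {M : Type w} [AddCommGroup M] [Module A M] [Module (UA 𝔤 A) M] [IsScalarTower A (UA 𝔤 A) M]
  {J : Set (WeightHat H)} {σ : Affine 𝔤 →ₗ[ℂ] Affine 𝔤}

lemma posSpan_smul_mem_wspan {P Q : Set (WeightHat H)} {k : ℕ}
    (h : ∀ κ ∈ P, ∀ β ∈ posRoots b, β (heightElt b) = k → κ + β ∈ Q) {x : Affine 𝔤}
    (hx : x ∈ posSpan b k) {m : M} (hm : m ∈ wspan A M P) : inc A x • m ∈ wspan A M Q := by
  have : posSpan b k ≤ transporter M (wspan A M P) (wspan A M Q) :=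
    Submodule.span_le.mpr fun z hz m hm => by
      obtain ⟨β, hβ, hk, hz⟩ := exists_weight_of_mem_posVec hz
      exact inc_smul_mem_wspan hz (fun κ hκ => h κ hκ β hβ hk) hm
  exact this hx m hm

lemma negSpan_smul_mem_wspan (hσ : IsChevalley H σ) {P Q : Set (WeightHat H)} {k : ℕ}
    (h : ∀ κ ∈ P, ∀ β ∈ posRoots b, β (heightElt b) = k → κ + -β ∈ Q) {x : Affine 𝔤}
    (hx : x ∈ (posSpan b k).map σ) {m : M} (hm : m ∈ wspan A M P) :
    inc A x • m ∈ wspan A M Q := by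
  have : posSpan b k ≤ (transporter M (wspan A M P) (wspan A M Q)).comap σ :=
    Submodule.span_le.mpr fun z hz m hm => by
      obtain ⟨β, hβ, hk, hz⟩ := exists_weight_of_mem_posVec hz
      exact inc_smul_mem_wspan (hσ.hasAdWeight hz) (fun κ hκ => h κ hκ β hβ hk) hm
  obtain ⟨y, hy, rfl⟩ := hx
  exact this hy m hm

lemma posSpan_fg (k : ℕ) : (posSpan b k).FG := Module.Finite.iff_fg.mp inferInstance

lemma words_posSpan_le {μ : WeightHat H} {S : Submodule A M} (hS : S ≤ weightSpace A M μ) (n : ℕ) :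
    words (posSpan b) S n ≤
      wspan A M {γ | wLE b μ γ ∧ γ (heightElt b) = μ (heightElt b) + n} := by
  refine words_le (T := fun n => wspan A M
    {γ | wLE b μ γ ∧ γ (heightElt b) = μ (heightElt b) + n}) ?_ ?_ n
  · exact hS.trans (weightSpace_le_wspan ⟨wLE_refl b μ, by simp⟩)
  · intro n k _ x hx hle m hm
    refine posSpan_smul_mem_wspan ?_ hx (hle hm)
    rintro κ ⟨h1, h2⟩ β hβ hk
    refine ⟨?_, ?_⟩
    · rw [wLE, add_sub_right_comm]
      exact add_mem h1 (AddSubmonoid.subset_closure hβ)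
    · rw [LinearMap.add_apply, h2, hk]; push_cast; ring

lemma words_negSpan_le (hσ : IsChevalley H σ) {c : ℂ} {S : Submodule A M}
    (hS : S ≤ wspan A M {γ : WeightHat H | γ (heightElt b) = c}) (n : ℕ) :
    words (fun k => (posSpan b k).map σ) S n ≤
      wspan A M {γ : WeightHat H | γ (heightElt b) = c - n} := by
  refine words_le (T := fun n => wspan A M
    {γ : WeightHat H | γ (heightElt b) = c - (n : ℕ)}) ?_ ?_ n
  · simpa using hS
  · intro n k _ x hx hle m hm
    refine negSpan_smul_mem_wspan hσ ?_ hx (hle hm)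
    rintro κ h2 β hβ hk
    rw [Set.mem_ofPred_eq] at h2 ⊢
    rw [LinearMap.add_apply, h2, LinearMap.neg_apply, hk]; push_cast; ring

/-- In a module with locally bounded weights, long words in positive roots act by zero. -/
lemma exists_words_posSpan_eq_bot (hJ : IsLocallyBounded b J)
    (hMJ : ∀ lam : WeightHat H, weightSpace A M lam ≠ ⊥ → lam ∈ J) {μ : WeightHat H}
    {S : Submodule A M} (hS : S ≤ weightSpace A M μ) :
    ∃ n₀ : ℕ, ∀ n, n₀ ≤ n → words (posSpan b) S n = ⊥ := by
  -- Words of height `n` have weights `γ ≥ μ` of height `n` over `μ`; only finitely many such `γ`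
  -- lie in `J`.
  have hfin : {n : ℕ | ∃ γ ∈ J, wLE b μ γ ∧ γ (heightElt b) = μ (heightElt b) + n}.Finite := by
    refine Set.Finite.of_injOn (f := fun n : ℕ => μ (heightElt b) + n)
      (t := (fun γ : WeightHat H => γ (heightElt b)) '' {γ ∈ J | wLE b μ γ}) ?_ ?_
      ((hJ μ).image _)
    · rintro n ⟨γ, hγ, h1, h2⟩
      exact ⟨γ, ⟨hγ, h1⟩, h2⟩
    · intro n _ m _ h
      simpa using h
  obtain ⟨N, hN⟩ := hfin.bddAbove
  refine ⟨N + 1, fun n hn => ?_⟩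
  rw [eq_bot_iff]
  refine (words_posSpan_le hS n).trans (wspan_le.mpr fun γ hγ => ?_)
  by_contra hne
  have hmem : n ∈ {n : ℕ | ∃ γ ∈ J, wLE b μ γ ∧ γ (heightElt b) = μ (heightElt b) + n} :=
    ⟨γ, hMJ γ fun h => hne (h ▸ le_rfl), hγ⟩
  have := hN hmem
  omega

/-- The submodule generated from a module of weight vectors by the positive part is stable under
the Borel subalgebra. -/
lemma borel_smul_mem_iSup_words {μ : WeightHat H} {S : Submodule A M} (hS : S ≤ weightSpace A M μ)
    {x : Affine 𝔤} (hx : x ∈ borelHat b) {m : M} (hm : m ∈ ⨆ n, words (posSpan b) S n) :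
    inc A x • m ∈ ⨆ n, words (posSpan b) S n := by
  set T := ⨆ n, words (posSpan b) S n with hT
  have hnil : nilHat b ≤ transporter M T T := nilHat_le_of_posVec fun k z hz m hm => by
    have hk : 0 < k := by
      rcases Nat.eq_zero_or_pos k with rfl | h
      · obtain ⟨β, hβ, h0, -⟩ := exists_weight_of_mem_posVec hz
        obtain ⟨l, _, hl, h1, -⟩ := posRoots_height b hβ
        rw [h0] at h1
        exact absurd (by exact_mod_cast h1) hl.ne
      · exact h
    have : T ≤ T.comap (act A M (inc A z)) := iSup_le fun n m hm =>
      Submodule.mem_iSup_of_mem (n + k) (inc_smul_mem_words hk (Submodule.subset_span hz) hm)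
    exact this hm
  have hcartan : ∀ h : CartanHat H, T ≤ T.comap (act A M (inc A (cartanIncl h))) := by
    intro h
    refine iSup_le fun n => ?_
    -- Move `h` past the first letter: `h x m = [h, x] m + x h m` with `[h, x]` in the nilpotent
    -- part.
    refine words_le (T := fun _ => T.comap (act A M (inc A (cartanIncl h)))) ?_ ?_ n
    · intro m hm
      exact cartan_smul_mem_of_mem (hS hm)
        (Submodule.mem_iSup_of_mem 0 (by rwa [words_zero])) h
    · intro n k hk x hx hle m hm
      have hxn := posSpan_le_nilHat k hx
      have h1 := inc_lie_smul (A := A) (cartanIncl h) x m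
      rw [eq_sub_iff_add_eq] at h1
      show inc A (cartanIncl h) • inc A x • m ∈ T
      rw [← h1]
      exact add_mem (hnil (cartan_lie_nilHat h hxn) m (Submodule.mem_iSup_of_mem n hm))
        (hnil hxn _ (hle hm))
  obtain ⟨h, y, hy, rfl⟩ := mem_borelHat.mp hx
  rw [inc_add, add_smul]
  exact add_mem (hcartan h hm) (hnil hy m hm)

/-- Weight modules with weights in a locally bounded set are locally finite over the Borel
subalgebra. -/
lemma isLocallyBorelFinite (hJ : IsLocallyBounded b J) (hM : IsWeightModule H A M)
    (hMJ : ∀ lam : WeightHat H, weightSpace A M lam ≠ ⊥ → lam ∈ J) :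
    IsLocallyBorelFinite A b M := by
  intro m
  refine hM.induction (p := fun m => ∃ N : Submodule A M, m ∈ N ∧ N.FG ∧
    ∀ x ∈ borelHat b, ∀ n ∈ N, inc A x • n ∈ N) ?_ ?_ ?_ m
  · intro lam m hm
    have hS : Submodule.span A {m} ≤ weightSpace A M lam := by
      rwa [Submodule.span_singleton_le_iff_mem]
    obtain ⟨n₀, hn₀⟩ := exists_words_posSpan_eq_bot hJ hMJ hS
    refine ⟨⨆ n, words (posSpan b) (Submodule.span A {m}) n,
      Submodule.mem_iSup_of_mem 0 ?_, ?_, fun x hx n hn => borel_smul_mem_iSup_words hS hx hn⟩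
    · rw [words_zero]; exact Submodule.mem_span_singleton_self m
    · have : ⨆ n, words (posSpan b) (Submodule.span A {m}) n =
          ⨆ n ∈ Finset.range n₀, words (posSpan b) (Submodule.span A {m}) n := by
        refine le_antisymm (iSup_le fun n => ?_) (iSup₂_le fun n _ => le_iSup _ n)
        by_cases h : n < n₀
        · exact le_iSup₂_of_le n (Finset.mem_range.mpr h) le_rfl
        · rw [hn₀ n (by omega)]; exact bot_le
      rw [this]
      exact Submodule.fg_biSup _ _ fun n _ =>
        words_fg posSpan_fg (Submodule.fg_span_singleton m) n
  · exact ⟨⊥, zero_mem _, Submodule.fg_bot, fun x _ n hn => by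
      rw [(Submodule.mem_bot A).mp hn, smul_zero]; exact zero_mem _⟩
  · rintro m n ⟨N, hN, h1, h2⟩ ⟨N', hN', h1', h2'⟩
    refine ⟨N ⊔ N', Submodule.add_mem_sup hN hN', h1.sup h1', fun x hx n hn => ?_⟩
    obtain ⟨y, hy, z, hz, rfl⟩ := Submodule.mem_sup.mp hn
    rw [smul_add]
    exact Submodule.add_mem_sup (h2 x hx y hy) (h2' x hx z hz)

/-- Local finiteness follows from the bound on weights, so membership only has to be tested on
weights. This makes submodules and quotients easy. -/
lemma inCatO_iff (hJ : IsLocallyBounded b J) : InCatO A b J M ↔ IsWeightModule H A M ∧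
    ∀ lam : WeightHat H, weightSpace A M lam ≠ ⊥ → lam ∈ J :=
  ⟨fun h => ⟨h.isWeight, h.weights⟩, fun h => ⟨h.1, isLocallyBorelFinite hJ h.1 h.2, h.2⟩⟩

/-- The submodule generated by a module `S` stable under the Borel subalgebra is generated from `S`
by the negative part. -/
lemma inc_smul_mem_iSup_words_negSpan (hσ : IsChevalley H σ) {ι : Type*} {S : ι → Submodule A M}
    (hS : ∀ x ∈ borelHat b, ∀ i, ∀ m ∈ S i, inc A x • m ∈ ⨆ j, S j) (x : Affine 𝔤) {m : M}
    (hm : m ∈ ⨆ i, ⨆ n, words (fun k => (posSpan b k).map σ) (S i) n) :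
    inc A x • m ∈ ⨆ i, ⨆ n, words (fun k => (posSpan b k).map σ) (S i) n := by
  set T := ⨆ i, ⨆ n, words (fun k => (posSpan b k).map σ) (S i) n with hT
  have hST : ⨆ j, S j ≤ T := iSup_mono fun i => le_iSup_of_le 0 (by rw [words_zero])
  have hw : ∀ i n, words (fun k => (posSpan b k).map σ) (S i) n ≤ T := fun i n =>
    le_iSup_of_le i (le_iSup_of_le n le_rfl)
  have hpos : ∀ k, ∀ z ∈ posVec b k, 0 < k := by
    intro k z hz
    rcases Nat.eq_zero_or_pos k with rfl | h
    · obtain ⟨β, hβ, h0, -⟩ := exists_weight_of_mem_posVec hz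
      obtain ⟨l, _, hl, h1, -⟩ := posRoots_height b hβ
      rw [h0] at h1
      exact absurd (by exact_mod_cast h1) hl.ne
    · exact h
  have hneg : ∀ x ∈ nilNeg b σ, ∀ m ∈ T, inc A x • m ∈ T := by
    have h1 : nilHat b ≤ (transporter M T T).comap σ := nilHat_le_of_posVec fun k z hz m hm => by
      have : T ≤ T.comap (act A M (inc A (σ z))) := iSup_le fun i => iSup_le fun n m hm =>
        hw i (n + k) (inc_smul_mem_words (V := fun k => (posSpan b k).map σ) (hpos k z hz)
          ⟨z, Submodule.subset_span hz, rfl⟩ hm)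
      exact this hm
    rintro _ ⟨z, hz, rfl⟩
    exact h1 hz
  have hbor : ∀ i n, words (fun k => (posSpan b k).map σ) (S i) n ≤
      ⨅ x : borelHat b, T.comap (act A M (inc A (x : Affine 𝔤))) := by
    intro i n
    refine words_le (T := fun _ => ⨅ x : borelHat b, T.comap (act A M (inc A (x : Affine 𝔤))))
      ?_ ?_ n
    · intro m hm
      rw [Submodule.mem_iInf]
      exact fun x => hST (hS x x.2 i m hm)
    · intro n k hk x hx hle m hm
      rw [Submodule.mem_iInf]
      rintro ⟨y, hy⟩
      have hxn : x ∈ nilNeg b σ := by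
        obtain ⟨z, hz, rfl⟩ := hx
        exact ⟨z, posSpan_le_nilHat k hz, rfl⟩
      have hm' := (Submodule.mem_iInf _).mp (hle hm)
      have h1 := inc_lie_smul (A := A) y x m
      rw [eq_sub_iff_add_eq] at h1
      show inc A y • inc A x • m ∈ T
      rw [← h1]
      -- In `y x m = [y, x] m + x y m` the bracket splits into a negative part and a Borel part, and
      -- both send the shorter word `m` into `T`.
      obtain ⟨f, hf, c, hc, hfc⟩ := Submodule.mem_sup.mp (hσ.mem_sup (b := b) ⁅y, x⁆)
      rw [← hfc, inc_add, add_smul]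
      exact add_mem (add_mem (hneg f hf m (hw i n hm)) (hm' ⟨c, hc⟩))
        (hneg x hxn _ (hm' ⟨y, hy⟩))
  obtain ⟨f, hf, c, hc, rfl⟩ := Submodule.mem_sup.mp (hσ.mem_sup (b := b) x)
  rw [inc_add, add_smul]
  refine add_mem (hneg f hf m hm) ?_
  have : T ≤ ⨅ x : borelHat b, T.comap (act A M (inc A (x : Affine 𝔤))) :=
    iSup_le fun i => iSup_le fun n => hbor i n
  exact (Submodule.mem_iInf _).mp (this hm) ⟨c, hc⟩

/-- Cyclic weight modules with locally bounded weights have finitely generated weight spaces. -/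
lemma weightSpace_span_fg [IsNoetherianRing A] (hσ : IsChevalley H σ) (hJ : IsLocallyBounded b J)
    (hM : IsWeightModule H A M)
    (hMJ : ∀ lam : WeightHat H, weightSpace A M lam ≠ ⊥ → lam ∈ J) {μ : WeightHat H} {v : M}
    (hv : v ∈ weightSpace A M μ) (κ : WeightHat H) :
    (toA (Submodule.span (UA 𝔤 A) {v}) ⊓ weightSpace A M κ).FG := by
  have hS : Submodule.span A {v} ≤ weightSpace A M μ := by
    rwa [Submodule.span_singleton_le_iff_mem]
  obtain ⟨n₀, hn₀⟩ := exists_words_posSpan_eq_bot hJ hMJ hS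
  -- Only the sum of the `Sp j` is Borel stable, but the pieces are kept apart because each has a
  -- single height, needed for the count below.
  set Sp := fun j => words (posSpan b) (Submodule.span A {v}) j with hSp
  set F : ℕ → ℕ → Submodule A M := fun j n => words (fun k => (posSpan b k).map σ) (Sp j) n with hF
  set T := ⨆ j, ⨆ n, F j n with hT
  have hTst : ∀ x : Affine 𝔤, ∀ m ∈ T, inc A x • m ∈ T := fun x m hm =>
    inc_smul_mem_iSup_words_negSpan (b := b) hσ (fun x hx i m hm =>
      borel_smul_mem_iSup_words hS hx (Submodule.mem_iSup_of_mem i hm)) x hm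
  have hvT : v ∈ T := by
    refine Submodule.mem_iSup_of_mem 0 (Submodule.mem_iSup_of_mem 0 ?_)
    rw [hF]
    simp only [words_zero, hSp]
    exact Submodule.mem_span_singleton_self v
  have hle : toA (Submodule.span (UA 𝔤 A) {v}) ≤ T := by
    have : Submodule.span (UA 𝔤 A) {v} ≤ stableSub T hTst :=
      (Submodule.span_singleton_le_iff_mem _ _).mpr hvT
    exact this
  have hFG : ∀ j n, (F j n).FG := fun j n =>
    words_fg (fun k => (posSpan_fg k).map σ)
      (words_fg posSpan_fg (Submodule.fg_span_singleton v) j) n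
  have hFw : ∀ j n, F j n ≤
      wspan A M {γ : WeightHat H | γ (heightElt b) = μ (heightElt b) + j - n} := by
    intro j n
    refine words_negSpan_le hσ ?_ n
    refine (words_posSpan_le hS j).trans (wspan_le.mpr fun γ hγ => weightSpace_le_wspan hγ.2)
  have hbot : ∀ n, words (fun k => (posSpan b k).map σ) (⊥ : Submodule A M) n = ⊥ := by
    intro n
    rw [eq_bot_iff]
    refine words_le (T := fun _ => (⊥ : Submodule A M)) le_rfl ?_ n
    intro n k _ x _ hle m hm
    rw [(Submodule.mem_bot A).mp (hle hm), smul_zero]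
    exact zero_mem _
  set c : ℂ := μ (heightElt b) - κ (heightElt b) with hc
  -- A negative word of height `n` on `Sp j` contributes to the weight `κ` only if `n = j + c`, and
  -- then `n ≤ j + ‖c‖ < n₁` because `j < n₀`.
  set n₁ : ℕ := n₀ + ⌊‖c‖⌋₊ + 1 with hn₁
  have hsub : T.map (wproj hM κ) ≤
      ⨆ j ∈ Finset.range n₀, ⨆ n ∈ Finset.range n₁, (F j n).map (wproj hM κ) := by
    rw [hT, Submodule.map_iSup]
    refine iSup_le fun j => ?_
    rw [Submodule.map_iSup]
    refine iSup_le fun n => ?_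
    by_cases hj : j < n₀
    · by_cases hn : n < n₁
      · exact le_iSup₂_of_le j (Finset.mem_range.mpr hj)
          (le_iSup₂_of_le n (Finset.mem_range.mpr hn) le_rfl)
      · rintro _ ⟨m, hm, rfl⟩
        rw [wproj_wspan hM _ (hFw j n hm)]
        · exact zero_mem _
        · intro h
          rw [Set.mem_ofPred_eq] at h
          have h1 : (n : ℂ) = j + c := by rw [hc, h]; ring
          have h2 : (n : ℝ) ≤ j + ‖c‖ := by
            have := norm_add_le (j : ℂ) c
            rw [← h1] at this
            simpa using this
          have h3 := Nat.lt_floor_add_one ‖c‖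
          have h4 : (n : ℝ) < n₁ := by
            rw [hn₁]; push_cast
            have : (j : ℝ) < n₀ := by exact_mod_cast hj
            linarith
          exact hn (by exact_mod_cast h4)
    · have : F j n = ⊥ := by
        rw [hF]
        simp only [hSp]
        rw [hn₀ j (by omega), hbot]
      rw [this, Submodule.map_bot]
      exact bot_le
  refine Submodule.FG.of_le (T := ⨆ j ∈ Finset.range n₀, ⨆ n ∈ Finset.range n₁,
    (F j n).map (wproj hM κ)) ?_ ?_
  · exact Submodule.fg_biSup _ _ fun j _ => Submodule.fg_biSup _ _ fun n _ => (hFG j n).map _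
  · rintro m ⟨hm, hmκ⟩
    exact hsub ⟨m, hle hm, wproj_self hM hmκ⟩

end Finiteness

/-! ## Modules over `A ⊗ U` from representations, and nonvanishing of Verma modules -/

section Enveloping

variable {L : Type*} [LieRing L] [LieAlgebra ℂ L] {A : Type*} [CommRing A] [Algebra ℂ A]

/-- The algebra map on `A ⊗ U(L)` given by a representation of `L` on an `A`-module. -/
def envLift {E : Type*} [AddCommGroup E] [Module A E] [Module ℂ E]
    [IsScalarTower ℂ A E] (ρ : L →ₗ[ℂ] Module.End A E)
    (hρ : ∀ x y, ρ ⁅x, y⁆ = ρ x * ρ y - ρ y * ρ x) :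
    A ⊗[ℂ] UniversalEnvelopingAlgebra ℂ L →ₐ[A] Module.End A E :=
  letI : LieRing (Module.End A E) := LieRing.ofAssociativeRing
  letI : LieAlgebra ℂ (Module.End A E) := LieAlgebra.ofAssociativeAlgebra
  Algebra.TensorProduct.lift (Algebra.ofId A (Module.End A E))
    (UniversalEnvelopingAlgebra.lift ℂ ({ ρ with map_lie' := fun {x y} => hρ x y } :
      L →ₗ⁅ℂ⁆ Module.End A E)) fun a u => (Algebra.commutes a _ : Commute _ _)

lemma envLift_ι {E : Type*} [AddCommGroup E] [Module A E] [Module ℂ E]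
    [IsScalarTower ℂ A E] (ρ : L →ₗ[ℂ] Module.End A E)
    (hρ : ∀ x y, ρ ⁅x, y⁆ = ρ x * ρ y - ρ y * ρ x) (x : L) :
    envLift ρ hρ (1 ⊗ₜ UniversalEnvelopingAlgebra.ι ℂ x) = ρ x := by
  let _ : LieRing (Module.End A E) := LieRing.ofAssociativeRing
  let _ : LieAlgebra ℂ (Module.End A E) := LieAlgebra.ofAssociativeAlgebra
  refine (Algebra.TensorProduct.lift_tmul _ _ _ _ _).trans ?_
  rw [map_one, one_mul, UniversalEnvelopingAlgebra.lift_ι_apply]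
  rfl

lemma one_tmul_ι_lie (x y : L) :
    ((1 : A) ⊗ₜ[ℂ] UniversalEnvelopingAlgebra.ι ℂ ⁅x, y⁆ : A ⊗[ℂ] UniversalEnvelopingAlgebra ℂ L) =
      (1 ⊗ₜ UniversalEnvelopingAlgebra.ι ℂ x) * (1 ⊗ₜ UniversalEnvelopingAlgebra.ι ℂ y) -
      (1 ⊗ₜ UniversalEnvelopingAlgebra.ι ℂ y) * (1 ⊗ₜ UniversalEnvelopingAlgebra.ι ℂ x) := by
  let _ : LieRing (UniversalEnvelopingAlgebra ℂ L) := LieRing.ofAssociativeRing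
  simp only [LieHom.map_lie, LieRing.of_associative_ring_bracket, TensorProduct.tmul_sub,
    Algebra.TensorProduct.tmul_mul_tmul, mul_one]

/-- Such an `S` is a left ideal containing `1`. -/
lemma env_induction {S : Submodule A (A ⊗[ℂ] UniversalEnvelopingAlgebra ℂ L)} (h1 : 1 ∈ S)
    (hS : ∀ (x : L), ∀ w ∈ S, (1 ⊗ₜ UniversalEnvelopingAlgebra.ι ℂ x) * w ∈ S)
    (w : A ⊗[ℂ] UniversalEnvelopingAlgebra ℂ L) : w ∈ S := by
  have := env_smul_mem (N := S) hS w h1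
  rwa [smul_eq_mul, mul_one] at this

end Enveloping

/-! ### The module induced from a character of `B`, realised on `A ⊗ U(N)` -/

section Induced

variable {G : Type*} [LieRing G] [LieAlgebra ℂ G] {A : Type*} [CommRing A] [Algebra ℂ A]
  {N : LieSubalgebra ℂ G} {B : Submodule ℂ G} (hNB : IsCompl N.toSubmodule B) (χ : B →ₗ[ℂ] A)

/-- The projection to the subalgebra `N`. -/
def projN : G →ₗ[ℂ] N := Submodule.projectionOnto N.toSubmodule B hNB

/-- The projection to the complement `B` of `N`. -/
def projB : G →ₗ[ℂ] B := Submodule.projectionOnto B N.toSubmodule hNB.symm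

lemma projN_add_projB (x : G) : (projN hNB x : G) + projB hNB x = x :=
  Submodule.projection_add_projection_eq_self hNB x

lemma projN_coe (x : N) : projN hNB x = x := Submodule.projectionOnto_apply_left hNB x

lemma projB_coe (x : B) : projB hNB x = x := Submodule.projectionOnto_apply_left hNB.symm x

lemma projN_coe_right (x : B) : projN hNB x = 0 := Submodule.projectionOnto_apply_right hNB x

lemma projB_coe_right (x : N) : projB hNB x = 0 := Submodule.projectionOnto_apply_right hNB.symm x

variable (A N) in
/-- The algebra `A ⊗ U(N)`. -/
abbrev EnvN : Type _ := A ⊗[ℂ] UniversalEnvelopingAlgebra ℂ N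

variable (A N) in
/-- The inclusion of `N` in `A ⊗ U(N)`. -/
def incN : N →ₗ[ℂ] EnvN A N where
  toFun x := 1 ⊗ₜ UniversalEnvelopingAlgebra.ι ℂ x
  map_add' x y := by rw [map_add, TensorProduct.tmul_add]
  map_smul' c x := by rw [map_smul, TensorProduct.tmul_smul]; rfl

lemma incN_lie (x y : N) : incN A N ⁅x, y⁆ = incN A N x * incN A N y - incN A N y * incN A N x :=
  one_tmul_ι_lie x y

/-- The bracket with `x` on the right. -/
def brk (B : Submodule ℂ G) (x : G) : B →ₗ[ℂ] G where
  toFun c := ⁅(c : G), x⁆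
  map_add' c d := by rw [Submodule.coe_add, add_lie]
  map_smul' c d := by rw [Submodule.coe_smul, smul_lie]; rfl

/-- The action of `x ∈ N` on pairs of an element `u` of the induced module and a map `F` that
gives the action of `B` on `u`. -/
def indAct (x : N) : Module.End A (EnvN A N × (B →ₗ[ℂ] EnvN A N)) where
  toFun p := (incN A N x * p.1, LinearMap.mulLeft ℂ (incN A N x) ∘ₗ p.2 +
    LinearMap.mulRight ℂ p.1 ∘ₗ incN A N ∘ₗ projN hNB ∘ₗ brk B (x : G) +
    p.2 ∘ₗ projB hNB ∘ₗ brk B (x : G))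
  map_add' p q := by
    ext c
    · simp [mul_add]
    · simp [mul_add]; abel
  map_smul' a p := by
    ext c
    · simp
    · simp [smul_add]

lemma indAct_fst (x : N) (p : EnvN A N × (B →ₗ[ℂ] EnvN A N)) :
    (indAct hNB x p).1 = incN A N x * p.1 := rfl

/-- This is the rule `c x u = x c u + [c, x] u`, with the bracket split along `N ⊕ B` and `F(c)`
standing for `c u`. -/
lemma indAct_snd (x : N) (p : EnvN A N × (B →ₗ[ℂ] EnvN A N)) (c : B) :
    (indAct hNB x p).2 c = incN A N x * p.2 c + incN A N (projN hNB ⁅(c : G), (x : G)⁆) * p.1 +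
      p.2 (projB hNB ⁅(c : G), (x : G)⁆) := rfl

variable (A) in
/-- The representation of `N` on pairs. -/
def indRep : N →ₗ[ℂ] Module.End A (EnvN A N × (B →ₗ[ℂ] EnvN A N)) where
  toFun := indAct hNB
  map_add' x y := by
    refine LinearMap.ext fun p => Prod.ext ?_ (LinearMap.ext fun c => ?_)
    · simp only [LinearMap.add_apply, Prod.fst_add, indAct_fst, map_add, add_mul]
    · have hxy : ((x + y : N) : G) = x + y := rfl
      simp only [LinearMap.add_apply, Prod.snd_add, indAct_snd, map_add, add_mul, hxy, lie_add]
      abel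
  map_smul' r x := by
    refine LinearMap.ext fun p => Prod.ext ?_ (LinearMap.ext fun c => ?_)
    · simp only [RingHom.id_apply, LinearMap.smul_apply, Prod.smul_fst, indAct_fst, map_smul,
        smul_mul_assoc]
    · have hrx : ((r • x : N) : G) = r • (x : G) := rfl
      simp only [RingHom.id_apply, LinearMap.smul_apply, Prod.smul_snd, indAct_snd, map_smul,
        smul_mul_assoc, hrx, lie_smul, smul_add]

/-- Project the Jacobi identity for `c`, `x`, `y` to `N` and to `B`; this yields `e1` and `e2`, and
the rest is ring algebra. -/
lemma indRep_lie (x y : N) : indRep A hNB ⁅x, y⁆ =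
    indRep A hNB x * indRep A hNB y - indRep A hNB y * indRep A hNB x := by
  refine LinearMap.ext fun p => Prod.ext ?_ (LinearMap.ext fun c => ?_)
  · show incN A N ⁅x, y⁆ * p.1 = incN A N x * (incN A N y * p.1) - incN A N y * (incN A N x * p.1)
    rw [incN_lie, sub_mul, mul_assoc, mul_assoc]
  · have key : ∀ (x y : N) (c : B), ⁅⁅(c : G), (x : G)⁆, (y : G)⁆ =
        ((⁅projN hNB ⁅(c : G), (x : G)⁆, y⁆ : N) : G) +
          ⁅((projB hNB ⁅(c : G), (x : G)⁆ : B) : G), (y : G)⁆ := by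
      intro x y c
      conv_lhs => rw [← projN_add_projB hNB ⁅(c : G), (x : G)⁆]
      rw [add_lie, LieSubalgebra.coe_bracket]
    have jac : ⁅(c : G), ((⁅x, y⁆ : N) : G)⁆ =
        ⁅⁅(c : G), (x : G)⁆, (y : G)⁆ - ⁅⁅(c : G), (y : G)⁆, (x : G)⁆ := by
      rw [LieSubalgebra.coe_bracket, leibniz_lie, ← lie_skew (x : G)]; abel
    have e1 : projN hNB ⁅(c : G), ((⁅x, y⁆ : N) : G)⁆ =
        (⁅projN hNB ⁅(c : G), (x : G)⁆, y⁆ +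
          projN hNB ⁅((projB hNB ⁅(c : G), (x : G)⁆ : B) : G), (y : G)⁆) -
        (⁅projN hNB ⁅(c : G), (y : G)⁆, x⁆ +
          projN hNB ⁅((projB hNB ⁅(c : G), (y : G)⁆ : B) : G), (x : G)⁆) := by
      rw [jac, key, key, map_sub, map_add, map_add, projN_coe, projN_coe]
    have e2 : projB hNB ⁅(c : G), ((⁅x, y⁆ : N) : G)⁆ =
        projB hNB ⁅((projB hNB ⁅(c : G), (x : G)⁆ : B) : G), (y : G)⁆ -
        projB hNB ⁅((projB hNB ⁅(c : G), (y : G)⁆ : B) : G), (x : G)⁆ := by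
      rw [jac, key, key, map_sub, map_add, map_add, projB_coe_right, projB_coe_right, zero_add,
        zero_add]
    show (indAct hNB ⁅x, y⁆ p).2 c =
      (indAct hNB x (indAct hNB y p)).2 c - (indAct hNB y (indAct hNB x p)).2 c
    simp only [indAct_snd, indAct_fst, e1, e2, map_sub, map_add, incN_lie]
    noncomm_ring

/-- The start vector: `1` with the character `χ`. -/
def indVec : EnvN A N × (B →ₗ[ℂ] EnvN A N) :=
  (1, (Algebra.linearMap A (EnvN A N)).restrictScalars ℂ ∘ₗ χ)

/-- The action of `B` on the induced module. -/
def indB : EnvN A N →ₗ[A] B →ₗ[ℂ] EnvN A N :=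
  LinearMap.snd A _ _ ∘ₗ
    (LinearMap.applyₗ (indVec χ)) ∘ₗ (envLift (indRep A hNB) (indRep_lie hNB)).toLinearMap

lemma envLift_incN_mul (x : N) (w : EnvN A N) (p : EnvN A N × (B →ₗ[ℂ] EnvN A N)) :
    envLift (indRep A hNB) (indRep_lie hNB) (incN A N x * w) p =
      indAct hNB x (envLift (indRep A hNB) (indRep_lie hNB) w p) := by
  rw [map_mul]
  exact congrArg (fun f : Module.End A _ => f _) (envLift_ι (indRep A hNB) (indRep_lie hNB) x)

/-- Acting by `w` on the start vector returns `w` in the first component, so the second component is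
a well-defined action of `B` on `w`. -/
lemma envLift_indVec_fst (w : EnvN A N) :
    (envLift (indRep A hNB) (indRep_lie hNB) w (indVec χ)).1 = w := by
  let f : EnvN A N →ₗ[A] EnvN A N := LinearMap.fst A _ _ ∘ₗ
    (LinearMap.applyₗ (indVec χ)) ∘ₗ (envLift (indRep A hNB) (indRep_lie hNB)).toLinearMap
  have : w ∈ LinearMap.eqLocus f LinearMap.id := by
    refine env_induction ?_ (fun x w hw => ?_) w
    · show (envLift (indRep A hNB) (indRep_lie hNB) 1 (indVec χ)).1 = 1
      rw [map_one]; rfl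
    · show (envLift (indRep A hNB) (indRep_lie hNB) (incN A N x * w) (indVec χ)).1 = incN A N x * w
      rw [envLift_incN_mul, indAct_fst]
      exact congrArg _ hw
  exact this

lemma indB_one (c : B) : indB hNB χ 1 c = algebraMap A (EnvN A N) (χ c) := by
  show (envLift (indRep A hNB) (indRep_lie hNB) 1 (indVec χ)).2 c = _
  rw [map_one]; rfl

lemma indB_mul (x : N) (w : EnvN A N) (c : B) : indB hNB χ (incN A N x * w) c =
    incN A N x * indB hNB χ w c + incN A N (projN hNB ⁅(c : G), (x : G)⁆) * w +
      indB hNB χ w (projB hNB ⁅(c : G), (x : G)⁆) := by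
  show (envLift (indRep A hNB) (indRep_lie hNB) (incN A N x * w) (indVec χ)).2 c = _
  rw [envLift_incN_mul, indAct_snd, envLift_indVec_fst]
  rfl

/-- The action of an element on the induced module. -/
def indEnd (g : G) : Module.End A (EnvN A N) where
  toFun w := incN A N (projN hNB g) * w + indB hNB χ w (projB hNB g)
  map_add' u v := by rw [map_add, LinearMap.add_apply, mul_add]; abel
  map_smul' a u := by
    rw [map_smul, LinearMap.smul_apply, mul_smul_comm, RingHom.id_apply, smul_add]

lemma indEnd_apply (g : G) (w : EnvN A N) : indEnd hNB χ g w =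
    incN A N (projN hNB g) * w + indB hNB χ w (projB hNB g) := rfl

/-- The induced representation on `A ⊗ U(N)`. -/
def ind : G →ₗ[ℂ] Module.End A (EnvN A N) where
  toFun := indEnd hNB χ
  map_add' g h := LinearMap.ext fun w => by
    rw [LinearMap.add_apply, indEnd_apply, indEnd_apply, indEnd_apply, map_add, map_add, map_add,
      map_add, add_mul]
    abel
  map_smul' r g := LinearMap.ext fun w => by
    rw [RingHom.id_apply, LinearMap.smul_apply, indEnd_apply, indEnd_apply, map_smul, map_smul,
      map_smul, map_smul, smul_add, smul_mul_assoc]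

lemma ind_apply (g : G) (w : EnvN A N) : ind hNB χ g w =
    incN A N (projN hNB g) * w + indB hNB χ w (projB hNB g) := rfl

lemma ind_coe_N (x : N) (w : EnvN A N) : ind hNB χ (x : G) w = incN A N x * w := by
  rw [ind_apply, projN_coe, projB_coe_right, map_zero, add_zero]

lemma ind_coe_B (c : B) (w : EnvN A N) : ind hNB χ (c : G) w = indB hNB χ w c := by
  rw [ind_apply, projN_coe_right, projB_coe, map_zero, zero_mul, zero_add]

lemma ind_lie_coe_N (g : G) (x : N) (w : EnvN A N) : ind hNB χ ⁅g, (x : G)⁆ w =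
    ind hNB χ g (ind hNB χ (x : G) w) - ind hNB χ (x : G) (ind hNB χ g w) := by
  have h1 : ⁅g, (x : G)⁆ = ((⁅projN hNB g, x⁆ : N) : G) + ⁅((projB hNB g : B) : G), (x : G)⁆ := by
    conv_lhs => rw [← projN_add_projB hNB g]
    rw [add_lie, LieSubalgebra.coe_bracket]
  have h2 : ∀ w, ind hNB χ g w = incN A N (projN hNB g) * w + indB hNB χ w (projB hNB g) :=
    ind_apply hNB χ g
  rw [h1, map_add, LinearMap.add_apply, ind_coe_N, ind_coe_N, ind_coe_N, h2, h2, ind_apply,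
    indB_mul, incN_lie]
  noncomm_ring

/-- Against an element of `N` the identity holds on every vector by the recursion `indB_mul`. The
general case is by induction on the vector: on `1` two elements of `B` act by commuting scalars
while `χ` kills brackets, and the passage from `w` to `x w` is the Jacobi identity. -/
lemma ind_lie (hB : ∀ x ∈ B, ∀ y ∈ B, ⁅x, y⁆ ∈ B)
    (hχ : ∀ x y : B, χ ⟨⁅(x : G), (y : G)⁆, hB x x.2 y y.2⟩ = 0) (g h : G) :
    ind hNB χ ⁅g, h⁆ = ind hNB χ g * ind hNB χ h - ind hNB χ h * ind hNB χ g := by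
  let S : Submodule A (EnvN A N) :=
    { carrier := {w | ∀ g h : G, ind hNB χ ⁅g, h⁆ w =
        ind hNB χ g (ind hNB χ h w) - ind hNB χ h (ind hNB χ g w)}
      add_mem' := fun {u v} hu hv g h => by
        simp only [map_add, hu g h, hv g h]; abel
      zero_mem' := fun g h => by simp
      smul_mem' := fun a u hu g h => by
        simp only [map_smul, hu g h, smul_sub] }
  have skew : ∀ (g h : G) (w : EnvN A N), ind hNB χ ⁅g, h⁆ w =
      ind hNB χ g (ind hNB χ h w) - ind hNB χ h (ind hNB χ g w) →
      ind hNB χ ⁅h, g⁆ w = ind hNB χ h (ind hNB χ g w) - ind hNB χ g (ind hNB χ h w) := by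
    intro g h w hw
    rw [← lie_skew, map_neg, LinearMap.neg_apply, hw, neg_sub]
  have key : ∀ w, w ∈ S := by
    refine env_induction ?_ fun x w hw => ?_
    · have hBB : ∀ c d : B, ind hNB χ ⁅(c : G), (d : G)⁆ (1 : EnvN A N) =
          ind hNB χ c (ind hNB χ d 1) - ind hNB χ d (ind hNB χ c 1) := by
        intro c d
        have h1 : ∀ c d : B, ind hNB χ (c : G) (ind hNB χ (d : G) (1 : EnvN A N)) =
            algebraMap A _ (χ d * χ c) := by
          intro c d
          rw [ind_coe_B (w := 1), indB_one, Algebra.algebraMap_eq_smul_one, map_smul, ind_coe_B,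
            indB_one, map_mul, Algebra.smul_def]
        rw [h1, h1, mul_comm, sub_self]
        have h2 := ind_coe_B hNB χ ⟨⁅(c : G), (d : G)⁆, hB c c.2 d d.2⟩ (1 : EnvN A N)
        rw [indB_one, hχ, map_zero] at h2
        exact h2
      intro g h
      have hN : ∀ (g : G) (x : N), ind hNB χ ⁅g, (x : G)⁆ (1 : EnvN A N) =
          ind hNB χ g (ind hNB χ (x : G) 1) - ind hNB χ (x : G) (ind hNB χ g 1) :=
        fun g x => ind_lie_coe_N hNB χ g x 1
      obtain ⟨n, c, hg⟩ : ∃ (n : N) (c : B), g = n + c := ⟨_, _, (projN_add_projB hNB g).symm⟩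
      obtain ⟨n', c', hh⟩ : ∃ (n : N) (c : B), h = n + c := ⟨_, _, (projN_add_projB hNB h).symm⟩
      rw [hg, hh]
      simp only [add_lie, lie_add, map_add, LinearMap.add_apply, hN, hBB,
        skew _ _ _ (hN (c' : G) n)]
      abel
    · intro g h
      have hx : (1 ⊗ₜ UniversalEnvelopingAlgebra.ι ℂ x) * w = ind hNB χ (x : G) w :=
        (ind_coe_N hNB χ x w).symm
      have hN : ∀ (g : G) (w : EnvN A N), ind hNB χ g (ind hNB χ (x : G) w) =
          ind hNB χ (x : G) (ind hNB χ g w) + ind hNB χ ⁅g, (x : G)⁆ w := fun g w => by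
        rw [ind_lie_coe_N hNB χ g x w]; abel
      have jac : ⁅⁅g, h⁆, (x : G)⁆ = ⁅g, ⁅h, (x : G)⁆⁆ - ⁅h, ⁅g, (x : G)⁆⁆ := by
        rw [lie_lie]
      rw [hx]
      simp only [hN, map_add, jac, map_sub, LinearMap.sub_apply, hw g h, hw g ⁅h, (x : G)⁆,
        hw h ⁅g, (x : G)⁆]
      abel
  exact LinearMap.ext fun w => key w g h

/-- The augmentation of the enveloping algebra gives a ring map to `A`. -/
lemma one_ne_zero_envN [Nontrivial A] : (1 : EnvN A N) ≠ 0 := by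
  let _ : LieRing ℂ := LieRing.ofAssociativeRing
  let _ : LieAlgebra ℂ ℂ := LieAlgebra.ofAssociativeAlgebra
  let ε : UniversalEnvelopingAlgebra ℂ N →ₐ[ℂ] ℂ := UniversalEnvelopingAlgebra.lift ℂ (0 : N →ₗ⁅ℂ⁆ ℂ)
  intro h
  have h1 := congrArg (Algebra.TensorProduct.map (AlgHom.id ℂ A) ε) h
  rw [map_one, map_zero] at h1
  have h2 := congrArg (Algebra.TensorProduct.rid ℂ ℂ A) h1
  rw [map_one, map_zero] at h2
  exact one_ne_zero h2

end Induced

/-! ### Characters of the Borel subalgebra and nonvanishing of Verma modules -/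

section VermaNonzero

variable {𝔤 : Type u} [LieRing 𝔤] [LieAlgebra ℂ 𝔤] [FiniteDimensional ℂ 𝔤]
  [LieAlgebra.IsKilling ℂ 𝔤] {H : LieSubalgebra ℂ 𝔤} [H.IsCartanSubalgebra]
  {b : (LieAlgebra.IsKilling.rootSystem H).Base}
  {A : Type v} [CommRing A] [Algebra ℂ A] [Algebra (SymmetricAlgebra ℂ H) A]
  [IsScalarTower ℂ (SymmetricAlgebra ℂ H) A] {σ : Affine 𝔤 →ₗ[ℂ] Affine 𝔤}

variable (A) in
/-- The value `lam(h) + τ(h)` as a linear map. -/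
def charLin (lam : WeightHat H) : CartanHat H →ₗ[ℂ] A :=
  Algebra.linearMap ℂ A ∘ₗ lam + (Algebra.ofId (SymmetricAlgebra ℂ H) A).toLinearMap.restrictScalars ℂ
    ∘ₗ SymmetricAlgebra.ι ℂ H ∘ₗ LinearMap.fst ℂ H (ℂ × ℂ)

lemma charLin_apply (lam : WeightHat H) (h : CartanHat H) : charLin A lam h = charVal A lam h := rfl

/-- A linear form on the Cartan subalgebra extends to the Borel subalgebra. -/
lemma exists_borel_char (f : CartanHat H →ₗ[ℂ] A) : ∃ χ : borelHat b →ₗ[ℂ] A,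
    (∀ h, χ ⟨cartanIncl h, cartanIncl_mem_borelHat h⟩ = f h) ∧
    ∀ x, (hx : x ∈ nilHat b) → χ ⟨x, nilHat_le_borelHat hx⟩ = 0 := by
  let g : CartanHat H × nilHat b →ₗ[ℂ] borelHat b :=
    ((cartanLin H ∘ₗ LinearMap.fst ℂ _ _) + ((nilHat b).subtype ∘ₗ LinearMap.snd ℂ _ _)).codRestrict
      (borelHat b) fun p => add_mem (cartanIncl_mem_borelHat p.1) (nilHat_le_borelHat p.2.2)
  have hg : Function.Bijective g := by
    constructor
    · rw [injective_iff_map_eq_zero]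
      rintro ⟨h, y, hy⟩ h0
      have h1 : cartanIncl h + y = 0 := congrArg Subtype.val h0
      have h2 : cartanIncl h ∈ nilHat b := by
        rw [eq_neg_of_add_eq_zero_left h1]; exact neg_mem hy
      have h3 := eq_zero_of_cartanIncl_mem_nilHat h2
      subst h3
      have h4 : cartanIncl (0 : CartanHat H) = 0 := map_zero (cartanLin H)
      rw [h4, zero_add] at h1
      subst h1
      rfl
    · rintro ⟨x, hx⟩
      obtain ⟨h, y, hy, rfl⟩ := mem_borelHat.mp hx
      exact ⟨(h, ⟨y, hy⟩), rfl⟩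
  let e := LinearEquiv.ofBijective g hg
  refine ⟨f ∘ₗ LinearMap.fst ℂ _ _ ∘ₗ e.symm.toLinearMap, fun h => ?_, fun x hx => ?_⟩
  · have : e (h, 0) = ⟨cartanIncl h, cartanIncl_mem_borelHat h⟩ := Subtype.ext (add_zero _)
    rw [← this]
    simp
  · have : e (0, ⟨x, hx⟩) = ⟨x, nilHat_le_borelHat hx⟩ :=
      Subtype.ext ((congrArg (· + x) (map_zero (cartanLin H))).trans (zero_add x))
    rw [← this]
    simp

/-- Verma modules are nonzero. -/
lemma vermaIdeal_ne_top [Nontrivial A] (hσ : IsChevalley H σ) (lam : WeightHat H) :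
    vermaIdeal A b lam ≠ ⊤ := by
  obtain ⟨χ, hχ, hχ0⟩ := exists_borel_char (b := b) (charLin A lam)
  let N : LieSubalgebra ℂ (Affine 𝔤) :=
    { nilNeg b σ with lie_mem' := fun hx hy => hσ.nilNeg_lie_mem hx hy }
  have hNB : IsCompl N.toSubmodule (borelHat b) :=
    ⟨hσ.disjoint, codisjoint_iff.mpr (eq_top_iff.mpr fun x _ => hσ.mem_sup x)⟩
  let ρ := ind hNB χ
  have hρ := ind_lie hNB χ (fun x hx y hy => nilHat_le_borelHat (borelHat_lie_mem hx hy))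
    fun x y => hχ0 _ (borelHat_lie_mem x.2 y.2)
  have hx1 : ∀ x (hx : x ∈ borelHat b), ρ x 1 = algebraMap A _ (χ ⟨x, hx⟩) := fun x hx => by
    rw [← indB_one hNB χ, ← ind_coe_B hNB χ]
  have hinc : ∀ x, envLift ρ hρ (inc A x) = ρ x := fun x => envLift_ι ρ hρ x
  -- The induced module contains the vector `1`, killed by the Verma ideal; if the ideal were
  -- everything, `1` would vanish.
  have key : ∀ u ∈ vermaIdeal A b lam, envLift ρ hρ u 1 = 0 := by
    intro u hu
    induction hu using Submodule.span_induction with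
    | zero => simp
    | add x y _ _ hx hy => rw [map_add, LinearMap.add_apply, hx, hy, add_zero]
    | smul a x _ hx => rw [smul_eq_mul, map_mul, Module.End.mul_apply, hx, map_zero]
    | mem x hx =>
      rcases hx with ⟨y, hy, rfl⟩ | ⟨h, rfl⟩
      · rw [hinc, hx1 y (nilHat_le_borelHat hy), hχ0 y hy, map_zero]
      · rw [map_sub, LinearMap.sub_apply, hinc, hx1 _ (cartanIncl_mem_borelHat h), hχ,
          AlgHom.commutes, Module.algebraMap_end_apply, Algebra.algebraMap_eq_smul_one,
          charLin_apply, sub_self]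
  intro htop
  have h1 := key 1 (htop ▸ Submodule.mem_top)
  have h2 : envLift ρ hρ 1 = 1 := map_one _
  rw [h2] at h1
  exact one_ne_zero_envN h1

end VermaNonzero

/-! ## Highest weight modules -/

section HighestWeight

variable {𝔤 : Type u} [LieRing 𝔤] [LieAlgebra ℂ 𝔤] [FiniteDimensional ℂ 𝔤]
  [LieAlgebra.IsKilling ℂ 𝔤] {H : LieSubalgebra ℂ 𝔤} [H.IsCartanSubalgebra]
  {b : (LieAlgebra.IsKilling.rootSystem H).Base}
  {A : Type v} [CommRing A] [Algebra ℂ A] [Algebra (SymmetricAlgebra ℂ H) A]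
  {M : Type w} [AddCommGroup M] [Module A M] [Module (UA 𝔤 A) M] [IsScalarTower A (UA 𝔤 A) M]
  {N : Type*} [AddCommGroup N] [Module A N] [Module (UA 𝔤 A) N] [IsScalarTower A (UA 𝔤 A) N]
  {σ : Affine 𝔤 →ₗ[ℂ] Affine 𝔤} {lam : WeightHat H}

variable (A b) in
/-- Highest weight vectors: weight vectors killed by the positive part. -/
structure IsHW (lam : WeightHat H) (w : M) : Prop where
  weight : w ∈ weightSpace A M lam
  nil : ∀ x ∈ nilHat b, inc A x • w = 0

lemma IsHW.map {w : M} (hw : IsHW b A lam w) (f : M →ₗ[UA 𝔤 A] N) : IsHW b A lam (f w) :=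
  ⟨map_mem_weightSpace f hw.weight, fun x hx => by rw [← map_smul, hw.nil x hx, map_zero]⟩

lemma IsHW.smul {w : M} (hw : IsHW b A lam w) (a : A) : IsHW b A lam (a • w) :=
  ⟨Submodule.smul_mem _ a hw.weight, fun x hx => by rw [ua_smul_comm, hw.nil x hx, smul_zero]⟩

lemma IsHW.borel_smul_mem {w : M} (hw : IsHW b A lam w) {x : Affine 𝔤} (hx : x ∈ borelHat b) {m : M}
    (hm : m ∈ Submodule.span A {w}) : inc A x • m ∈ Submodule.span A {w} := by
  obtain ⟨a, rfl⟩ := Submodule.mem_span_singleton.mp hm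
  obtain ⟨h, y, hy, rfl⟩ := mem_borelHat.mp hx
  rw [inc_add, add_smul, ua_smul_comm, ua_smul_comm, hw.nil y hy, smul_zero, add_zero, hw.weight h]
  exact Submodule.smul_mem _ _ (Submodule.smul_mem _ _ (Submodule.mem_span_singleton_self w))

lemma words_negSpan_le_of_weight (hσ : IsChevalley H σ) {S : Submodule A M}
    (hS : S ≤ weightSpace A M lam) (n : ℕ) :
    words (fun k => (posSpan b k).map σ) S n ≤
      wspan A M {γ : WeightHat H | wLE b γ lam ∧ γ (heightElt b) = lam (heightElt b) - n} := by
  refine words_le (T := fun n => wspan A M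
    {γ : WeightHat H | wLE b γ lam ∧ γ (heightElt b) = lam (heightElt b) - (n : ℕ)}) ?_ ?_ n
  · exact hS.trans (weightSpace_le_wspan ⟨wLE_refl b lam, by simp⟩)
  · intro n k _ x hx hle m hm
    refine negSpan_smul_mem_wspan hσ ?_ hx (hle hm)
    rintro κ ⟨h1, h2⟩ β hβ hk
    refine ⟨?_, ?_⟩
    · rw [wLE, ← sub_sub, sub_neg_eq_add]
      exact add_mem h1 (AddSubmonoid.subset_closure hβ)
    · rw [LinearMap.add_apply, h2, LinearMap.neg_apply, hk]; push_cast; ring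

/-- The line `A w` is stable under the Borel subalgebra, so the negative part alone generates from
it. -/
lemma IsHW.exists_mem_words (hσ : IsChevalley H σ) {w : M} (hw : IsHW b A lam w)
    (htop : Submodule.span (UA 𝔤 A) {w} = ⊤) (m : M) :
    m ∈ ⨆ n, words (fun k => (posSpan b k).map σ) (Submodule.span A {w}) n := by
  have h1 := fun x m => inc_smul_mem_iSup_words_negSpan (b := b) hσ
    (S := fun _ : Unit => Submodule.span A {w}) (fun x hx i m hm =>
      Submodule.mem_iSup_of_mem i (hw.borel_smul_mem hx hm)) x (m := m)
  rw [iSup_const] at h1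
  have h2 : Submodule.span (UA 𝔤 A) {w} ≤ stableSub _ h1 := by
    rw [Submodule.span_singleton_le_iff_mem]
    refine Submodule.mem_iSup_of_mem 0 ?_
    rw [words_zero]
    exact Submodule.mem_span_singleton_self w
  exact h2 (htop ▸ Submodule.mem_top)

lemma IsHW.mem_wspan (hσ : IsChevalley H σ) {w : M} (hw : IsHW b A lam w)
    (htop : Submodule.span (UA 𝔤 A) {w} = ⊤) (m : M) :
    m ∈ wspan A M {γ : WeightHat H | wLE b γ lam} := by
  have hS : Submodule.span A {w} ≤ weightSpace A M lam := by
    rw [Submodule.span_singleton_le_iff_mem]; exact hw.weight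
  have h1 : ⨆ n, words (fun k => (posSpan b k).map σ) (Submodule.span A {w}) n ≤
      wspan A M {γ : WeightHat H | wLE b γ lam} := iSup_le fun n =>
    (words_negSpan_le_of_weight (b := b) hσ hS n).trans
      (wspan_le.mpr fun γ hγ => weightSpace_le_wspan hγ.1)
  exact h1 (hw.exists_mem_words hσ htop m)

lemma IsHW.isWeightModule (hσ : IsChevalley H σ) {w : M} (hw : IsHW b A lam w)
    (htop : Submodule.span (UA 𝔤 A) {w} = ⊤) : IsWeightModule H A M :=
  isWeightModule_iff.mpr (eq_top_iff.mpr fun m _ =>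
    (wspan_le.mpr fun γ _ => le_iSup (fun lam => weightSpace A M lam) γ) (hw.mem_wspan hσ htop m))

lemma IsHW.wLE_of_ne_bot (hσ : IsChevalley H σ) {w : M} (hw : IsHW b A lam w)
    (htop : Submodule.span (UA 𝔤 A) {w} = ⊤) {κ : WeightHat H} (hκ : weightSpace A M κ ≠ ⊥) :
    wLE b κ lam := by
  by_contra h
  refine hκ (eq_bot_iff.mpr fun m hm => ?_)
  have hM := hw.isWeightModule hσ htop
  rw [Submodule.mem_bot, ← wproj_self hM hm]
  exact wproj_wspan hM (P := {γ | wLE b γ lam}) h (hw.mem_wspan hσ htop m)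

/-- Nonempty words strictly lower the height, so only the empty word contributes to the top weight.
-/
lemma IsHW.weightSpace_eq (hσ : IsChevalley H σ) {w : M} (hw : IsHW b A lam w)
    (htop : Submodule.span (UA 𝔤 A) {w} = ⊤) : weightSpace A M lam = Submodule.span A {w} := by
  have hS : Submodule.span A {w} ≤ weightSpace A M lam := by
    rw [Submodule.span_singleton_le_iff_mem]; exact hw.weight
  have hM := hw.isWeightModule hσ htop
  refine le_antisymm (fun m hm => ?_) hS
  have h1 : ⨆ n, words (fun k => (posSpan b k).map σ) (Submodule.span A {w}) n ≤
      (Submodule.span A {w}).comap (wproj hM lam) := by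
    refine iSup_le fun n m hm => ?_
    rcases Nat.eq_zero_or_pos n with rfl | hn
    · rw [words_zero] at hm
      rwa [Submodule.mem_comap, wproj_self hM (hS hm)]
    · rw [Submodule.mem_comap, wproj_wspan hM _ (words_negSpan_le_of_weight (b := b) hσ hS n hm)]
      · exact zero_mem _
      · rintro ⟨-, h⟩
        have h2 : (n : ℂ) = 0 := by linear_combination h
        exact hn.ne' (by exact_mod_cast h2)
  have h2 := h1 (hw.exists_mem_words hσ htop m)
  rwa [Submodule.mem_comap, wproj_self hM hm] at h2

lemma IsHW.inCatO (hσ : IsChevalley H σ) {w : M} (hw : IsHW b A lam w)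
    (htop : Submodule.span (UA 𝔤 A) {w} = ⊤) {J : Set (WeightHat H)} (hJ : IsOpenSet b J)
    (hJ' : IsLocallyBounded b J) (hlam : lam ∈ J) : InCatO A b J M :=
  (inCatO_iff hJ').mpr ⟨hw.isWeightModule hσ htop, fun κ hκ =>
    hJ lam hlam κ (hw.wLE_of_ne_bot hσ htop hκ)⟩

/-- A highest weight vector in the submodule that it generates. -/
lemma IsHW.restrict {w : M} (hw : IsHW b A lam w) (X : Submodule (UA 𝔤 A) M) (h : w ∈ X) :
    IsHW b A lam (⟨w, h⟩ : X) :=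
  ⟨coe_mem_weightSpace.mp hw.weight, fun x hx => Subtype.ext (hw.nil x hx)⟩

lemma span_mk_eq_top {R V : Type*} [Ring R] [AddCommGroup V] [Module R V] (v : V) :
    Submodule.span R {(⟨v, Submodule.mem_span_singleton_self v⟩ : Submodule.span R {v})} = ⊤ := by
  rw [eq_top_iff]
  rintro ⟨x, hx⟩ -
  obtain ⟨r, rfl⟩ := Submodule.mem_span_singleton.mp hx
  exact Submodule.mem_span_singleton.mpr ⟨r, rfl⟩

end HighestWeight

/-! ### Subquotients and reduction to the residue field -/

section Residue

variable {R : Type*} [Ring R] {L M : Type*} [AddCommGroup L] [Module R L] [AddCommGroup M] [Module R M]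

lemma isSubquotient_iff : IsSubquotient R L M ↔
    ∃ (X : Submodule R M) (f : X →ₗ[R] L), Function.Surjective f := by
  constructor
  · rintro ⟨X, Y, ⟨e⟩⟩
    exact ⟨X, e.toLinearMap ∘ₗ Y.mkQ, e.surjective.comp Y.mkQ_surjective⟩
  · rintro ⟨X, f, hf⟩
    exact ⟨X, LinearMap.ker f, ⟨f.quotKerEquivOfSurjective hf⟩⟩

variable {𝔤 : Type u} [LieRing 𝔤] [LieAlgebra ℂ 𝔤]
  {H : LieSubalgebra ℂ 𝔤}
  {A : Type v} [CommRing A] [Algebra ℂ A] [Algebra (SymmetricAlgebra ℂ H) A] [IsLocalRing A]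

lemma residueMap_smul (a : A) (z : UA 𝔤 A) :
    residueMap 𝔤 A (a • z) = IsLocalRing.residue A a • residueMap 𝔤 A z := by
  induction z using TensorProduct.induction_on with
  | zero => simp
  | add x y hx hy => rw [smul_add, map_add, hx, hy, map_add, smul_add]
  | tmul c z =>
    rw [TensorProduct.smul_tmul']
    simp only [residueMap, Algebra.TensorProduct.map_tmul, TensorProduct.smul_tmul', smul_eq_mul,
      map_mul]
    rfl

lemma residueMap_inc (x : Affine 𝔤) :
    residueMap 𝔤 A (inc A x) = inc (IsLocalRing.ResidueField A) x := by
  rw [inc, residueMap, Algebra.TensorProduct.map_tmul, map_one]; rfl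

lemma residueMap_surjective : Function.Surjective (residueMap 𝔤 A) :=
  Algebra.TensorProduct.map_surjective _ _ IsLocalRing.residue_surjective
    Function.surjective_id

lemma residue_charVal (lam : WeightHat H) (h : CartanHat H) :
    IsLocalRing.residue A (charVal A lam h) = charVal (IsLocalRing.ResidueField A) lam h := by
  rw [charVal, charVal, map_add]; rfl

/-- By right exactness of the tensor product the kernel is generated by the elements `a ⊗ 1` with
`a` in the maximal ideal. -/
lemma ker_residueMap_smul {M : Type*} [AddCommGroup M] [Module A M] [Module (UA 𝔤 A) M]
    [IsScalarTower A (UA 𝔤 A) M] {m : M} (hm : ∀ a ∈ IsLocalRing.maximalIdeal A, a • m = 0)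
    {z : UA 𝔤 A} (hz : residueMap 𝔤 A z = 0) : z • m = 0 := by
  have hk : z ∈ RingHom.ker (Algebra.TensorProduct.map
      (IsScalarTower.toAlgHom ℂ A (IsLocalRing.ResidueField A))
      (AlgHom.id ℂ (UniversalEnvelopingAlgebra ℂ (Affine 𝔤)))) := hz
  rw [Algebra.TensorProduct.rTensor_ker _ IsLocalRing.residue_surjective] at hk
  clear hz
  refine Submodule.span_induction (p := fun z _ => z • m = 0) ?_ (zero_smul _ m) ?_ ?_ hk
  · rintro _ ⟨a, ha, rfl⟩
    have h1 : (a ⊗ₜ[ℂ] 1 : UA 𝔤 A) = a • 1 := by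
      rw [Algebra.TensorProduct.one_def, TensorProduct.smul_tmul', smul_eq_mul, mul_one]
    have h2 : a ∈ IsLocalRing.maximalIdeal A := (IsLocalRing.residue_eq_zero_iff a).mp ha
    show (a ⊗ₜ[ℂ] 1 : UA 𝔤 A) • m = 0
    rw [h1, smul_assoc, one_smul, hm a h2]
  · intro x y _ _ hx hy
    rw [add_smul, hx, hy, add_zero]
  · intro a x _ hx
    rw [smul_eq_mul, mul_smul, hx, smul_zero]

end Residue

/-! ### Verma and simple modules as modules over `A ⊗ U` -/

section VermaSimple

variable {𝔤 : Type u} [LieRing 𝔤] [LieAlgebra ℂ 𝔤] [FiniteDimensional ℂ 𝔤]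
  [LieAlgebra.IsKilling ℂ 𝔤] {H : LieSubalgebra ℂ 𝔤} [H.IsCartanSubalgebra]
  (A : Type v) [CommRing A] [Algebra ℂ A] [Algebra (SymmetricAlgebra ℂ H) A] [IsLocalRing A]
  (b : (LieAlgebra.IsKilling.rootSystem H).Base)

/-- The Verma module over the residue field as a module over `A ⊗ U`. -/
def VermaRes (lam : WeightHat H) : Type (max u v) := Verma (IsLocalRing.ResidueField A) b lam

instance (lam : WeightHat H) : AddCommGroup (VermaRes A b lam) :=
  inferInstanceAs (AddCommGroup (Verma (IsLocalRing.ResidueField A) b lam))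

instance (lam : WeightHat H) : Module (UA 𝔤 A) (VermaRes A b lam) :=
  Module.compHom (Verma (IsLocalRing.ResidueField A) b lam) (residueMap 𝔤 A).toRingHom

instance (lam : WeightHat H) : Module A (VermaRes A b lam) :=
  Module.compHom (Verma (IsLocalRing.ResidueField A) b lam) (IsLocalRing.residue A)

instance (lam : WeightHat H) : Module A (SimpleMod A b lam) :=
  Module.compHom (SimpleQuot (IsLocalRing.ResidueField A) b lam) (IsLocalRing.residue A)

variable {A b} {lam : WeightHat H}

/-- The canonical bijection from a Verma module over the residue field. -/
def toVermaRes (x : Verma (IsLocalRing.ResidueField A) b lam) : VermaRes A b lam := x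

/-- The canonical bijection from a simple module over the residue field. -/
def toSimpleMod (x : SimpleQuot (IsLocalRing.ResidueField A) b lam) : SimpleMod A b lam := x

lemma smul_toVermaRes (u : UA 𝔤 A) (x : Verma (IsLocalRing.ResidueField A) b lam) :
    u • (toVermaRes x : VermaRes A b lam) = toVermaRes (residueMap 𝔤 A u • x) := rfl

lemma smulA_toVermaRes (a : A) (x : Verma (IsLocalRing.ResidueField A) b lam) :
    a • (toVermaRes x : VermaRes A b lam) = toVermaRes (IsLocalRing.residue A a • x) := rfl

lemma smulA_toSimpleMod (a : A) (x : SimpleQuot (IsLocalRing.ResidueField A) b lam) :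
    a • (toSimpleMod x : SimpleMod A b lam) = toSimpleMod (IsLocalRing.residue A a • x) := rfl

instance (lam : WeightHat H) : IsScalarTower A (UA 𝔤 A) (VermaRes A b lam) :=
  ⟨fun a u x => by
    obtain ⟨x, rfl⟩ : ∃ y, toVermaRes y = x := ⟨x, rfl⟩
    show toVermaRes (residueMap 𝔤 A (a • u) • x) =
      toVermaRes (IsLocalRing.residue A a • residueMap 𝔤 A u •
        x)
    rw [residueMap_smul, smul_assoc]⟩

instance (lam : WeightHat H) : IsScalarTower A (UA 𝔤 A) (SimpleMod A b lam) :=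
  ⟨fun a u x => by
    obtain ⟨x, rfl⟩ : ∃ y, toSimpleMod y = x := ⟨x, rfl⟩
    show toSimpleMod (residueMap 𝔤 A (a • u) •
        x) =
      toSimpleMod (IsLocalRing.residue A a • residueMap 𝔤 A u •
        x)
    rw [residueMap_smul, smul_assoc]⟩

lemma maximalIdeal_smul_simpleMod {a : A} (ha : a ∈ IsLocalRing.maximalIdeal A)
    (x : SimpleMod A b lam) : a • x = 0 := by
  obtain ⟨x, rfl⟩ : ∃ y, toSimpleMod y = x := ⟨x, rfl⟩
  rw [smulA_toSimpleMod, (IsLocalRing.residue_eq_zero_iff a).mpr ha, zero_smul]; rfl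

section Ring

variable {A : Type v} [CommRing A] [Algebra ℂ A] [Algebra (SymmetricAlgebra ℂ H) A]

lemma isHW_mk_one (lam : WeightHat H) :
    IsHW b A lam (Submodule.Quotient.mk (p := vermaIdeal A b lam) 1) := by
  constructor
  · intro h
    rw [← Submodule.Quotient.mk_smul, ← Submodule.Quotient.mk_smul, Submodule.Quotient.eq]
    refine Submodule.subset_span (Or.inr ⟨h, ?_⟩)
    rw [smul_eq_mul, mul_one, Algebra.algebraMap_eq_smul_one]
  · intro x hx
    rw [← Submodule.Quotient.mk_smul, Submodule.Quotient.mk_eq_zero, smul_eq_mul, mul_one]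
    exact Submodule.subset_span (Or.inl ⟨x, hx, rfl⟩)

lemma span_mk_one (I : Submodule (UA 𝔤 A) (UA 𝔤 A)) :
    Submodule.span (UA 𝔤 A) {(Submodule.Quotient.mk 1 : UA 𝔤 A ⧸ I)} = ⊤ := by
  rw [eq_top_iff]
  rintro x -
  obtain ⟨u, rfl⟩ := Submodule.Quotient.mk_surjective I x
  refine Submodule.mem_span_singleton.mpr ⟨u, ?_⟩
  rw [← Submodule.Quotient.mk_smul, smul_eq_mul, mul_one]

end Ring

variable (A b lam) in
/-- The highest weight vector of the Verma module. -/
def vermaVec : VermaRes A b lam := toVermaRes (Submodule.Quotient.mk 1)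

variable (A b lam) in
/-- The highest weight vector of the simple module. -/
def simpleVec : SimpleMod A b lam := toSimpleMod (Submodule.Quotient.mk (Submodule.Quotient.mk 1))

variable (A b lam) in
/-- The projection from the Verma module to its simple quotient. -/
def vermaToSimple : VermaRes A b lam →ₗ[UA 𝔤 A] SimpleMod A b lam where
  toFun x := toSimpleMod (Submodule.Quotient.mk (x : Verma (IsLocalRing.ResidueField A) b lam))
  map_add' _ _ := rfl
  map_smul' _ _ := rfl

lemma vermaToSimple_vec : vermaToSimple A b lam (vermaVec A b lam) = simpleVec A b lam := rfl

lemma vermaToSimple_surjective : Function.Surjective (vermaToSimple A b lam) :=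
  Submodule.Quotient.mk_surjective
    (sSup {N : Submodule (UA 𝔤 (IsLocalRing.ResidueField A))
      (Verma (IsLocalRing.ResidueField A) b lam) | N ≠ ⊤})

lemma isHW_vermaVec : IsHW b A lam (vermaVec A b lam) := by
  have h := isHW_mk_one (b := b) (A := IsLocalRing.ResidueField A) lam
  constructor
  · intro k
    rw [vermaVec, smul_toVermaRes, residueMap_inc, h.weight k, smulA_toVermaRes, residue_charVal]
  · intro x hx
    rw [vermaVec, smul_toVermaRes, residueMap_inc, h.nil x hx]
    rfl

lemma isHW_simpleVec : IsHW b A lam (simpleVec A b lam) := by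
  rw [← vermaToSimple_vec]; exact isHW_vermaVec.map _

lemma span_vermaVec : Submodule.span (UA 𝔤 A) {vermaVec A b lam} = ⊤ := by
  rw [eq_top_iff]
  rintro x -
  obtain ⟨u, rfl⟩ := Submodule.Quotient.mk_surjective (vermaIdeal (IsLocalRing.ResidueField A) b lam) x
  obtain ⟨u, rfl⟩ := residueMap_surjective u
  refine Submodule.mem_span_singleton.mpr ⟨u, ?_⟩
  rw [vermaVec, smul_toVermaRes, ← Submodule.Quotient.mk_smul, smul_eq_mul, mul_one]
  rfl

lemma span_simpleVec : Submodule.span (UA 𝔤 A) {simpleVec A b lam} = ⊤ := by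
  rw [← vermaToSimple_vec, ← Set.image_singleton, Submodule.span_image, span_vermaVec,
    Submodule.map_top, LinearMap.range_eq_top]
  exact vermaToSimple_surjective

/-- The universal property of the Verma module. -/
lemma exists_hom_vermaRes {M : Type*} [AddCommGroup M] [Module A M] [Module (UA 𝔤 A) M]
    [IsScalarTower A (UA 𝔤 A) M] {w : M} (hw : IsHW b A lam w)
    (hm : ∀ a ∈ IsLocalRing.maximalIdeal A, a • w = 0) :
    ∃ f : VermaRes A b lam →ₗ[UA 𝔤 A] M, f (vermaVec A b lam) = w := by
  let g := LinearMap.toSpanSingleton (UA 𝔤 A) _ (vermaVec A b lam)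
  let h := LinearMap.toSpanSingleton (UA 𝔤 A) _ w
  have hg : Function.Surjective g := by
    rw [← LinearMap.range_eq_top, LinearMap.range_toSpanSingleton]
    exact span_vermaVec
  -- Each element of the ideal over the residue field has a lift killing `w`. Two lifts differ by an
  -- element of the kernel, which kills `w` by `hm`, so every lift does.
  have key : ∀ z ∈ vermaIdeal (IsLocalRing.ResidueField A) b lam,
      ∃ u, residueMap 𝔤 A u = z ∧ u • w = 0 := by
    intro z hz
    induction hz using Submodule.span_induction with
    | zero => exact ⟨0, map_zero _, zero_smul _ _⟩
    | add x y _ _ hx hy =>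
      obtain ⟨u, rfl, hu⟩ := hx
      obtain ⟨v, rfl, hv⟩ := hy
      exact ⟨u + v, map_add _ _ _, by rw [add_smul, hu, hv, add_zero]⟩
    | smul a x _ hx =>
      obtain ⟨u, rfl, hu⟩ := hx
      obtain ⟨a, rfl⟩ := residueMap_surjective a
      exact ⟨a * u, map_mul _ _ _, by rw [mul_smul, hu, smul_zero]⟩
    | mem x hx =>
      rcases hx with ⟨y, hy, rfl⟩ | ⟨k, rfl⟩
      · exact ⟨inc A y, residueMap_inc y, hw.nil y hy⟩
      · refine ⟨inc A (cartanIncl k) - charVal A lam k • 1, ?_, ?_⟩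
        · rw [map_sub, residueMap_inc, residueMap_smul, residue_charVal, map_one,
            Algebra.algebraMap_eq_smul_one]
        · rw [sub_smul, smul_assoc, one_smul, hw.weight k, sub_self]
  have hle : LinearMap.ker g ≤ LinearMap.ker h := by
    intro u hu
    have h1 : toVermaRes (A := A) (residueMap 𝔤 A u • (Submodule.Quotient.mk 1 :
        Verma (IsLocalRing.ResidueField A) b lam)) = 0 := hu
    rw [← Submodule.Quotient.mk_smul, smul_eq_mul, mul_one] at h1
    obtain ⟨u', hu', h2⟩ := key _ ((Submodule.Quotient.mk_eq_zero _).mp h1)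
    have h3 : (u - u') • w = 0 := ker_residueMap_smul hm (by rw [map_sub, hu', sub_self])
    rw [sub_smul, h2, sub_zero] at h3
    exact h3
  refine ⟨(Submodule.liftQ _ h hle) ∘ₗ (g.quotKerEquivOfSurjective hg).symm.toLinearMap, ?_⟩
  have h1 : (g.quotKerEquivOfSurjective hg).symm (vermaVec A b lam) = Submodule.Quotient.mk 1 := by
    rw [LinearEquiv.symm_apply_eq, LinearMap.quotKerEquivOfSurjective_apply_mk]
    exact (one_smul _ _).symm
  rw [LinearMap.comp_apply, LinearEquiv.coe_coe, h1, Submodule.liftQ_apply]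
  exact one_smul _ _

/-- `A ⊗ U` maps onto its reduction, so submodules and linear maps are the same over both rings. -/
lemma vermaLinked_iff {μ : WeightHat H} : VermaLinked A b lam μ ↔
    IsSubquotient (UA 𝔤 A) (SimpleMod A b μ) (VermaRes A b lam) := by
  rw [VermaLinked, isSubquotient_iff, isSubquotient_iff]
  constructor
  · rintro ⟨X, f, hf⟩
    let X' : Submodule (UA 𝔤 A) (VermaRes A b lam) :=
      { carrier := {x | (x : Verma (IsLocalRing.ResidueField A) b lam) ∈ X}
        add_mem' := X.add_mem
        zero_mem' := X.zero_mem
        smul_mem' := fun u x hx => X.smul_mem (residueMap 𝔤 A u) hx }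
    exact ⟨X', { toFun := fun x => toSimpleMod (f ⟨x.1, x.2⟩)
                 map_add' := fun x y => map_add f ⟨x.1, x.2⟩ ⟨y.1, y.2⟩
                 map_smul' := fun u x => map_smul f (residueMap 𝔤 A u) ⟨x.1, x.2⟩ },
      fun y => by obtain ⟨x, hx⟩ := hf y; exact ⟨⟨x.1, x.2⟩, hx⟩⟩
  · rintro ⟨X, f, hf⟩
    let X' : Submodule (UA 𝔤 (IsLocalRing.ResidueField A)) (Verma (IsLocalRing.ResidueField A) b lam) :=
      { carrier := {x | toVermaRes x ∈ X}
        add_mem' := X.add_mem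
        zero_mem' := X.zero_mem
        smul_mem' := fun u x hx => by
          obtain ⟨u, rfl⟩ := residueMap_surjective u
          exact X.smul_mem u hx }
    exact ⟨X', { toFun := fun x => f ⟨x.1, x.2⟩
                 map_add' := fun x y => map_add f ⟨x.1, x.2⟩ ⟨y.1, y.2⟩
                 map_smul' := fun u x => by
                  obtain ⟨u, rfl⟩ := residueMap_surjective u
                  exact map_smul f u ⟨x.1, x.2⟩ },
      fun y => by obtain ⟨x, hx⟩ := hf y; exact ⟨⟨x.1, x.2⟩, hx⟩⟩

end VermaSimple

/-! ## Simple modules -/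

section Maximal

variable {𝔤 : Type u} [LieRing 𝔤] [LieAlgebra ℂ 𝔤] [FiniteDimensional ℂ 𝔤]
  [LieAlgebra.IsKilling ℂ 𝔤] {H : LieSubalgebra ℂ 𝔤} [H.IsCartanSubalgebra]
  {b : (LieAlgebra.IsKilling.rootSystem H).Base}
  {A : Type v} [CommRing A] [Algebra ℂ A] [Algebra (SymmetricAlgebra ℂ H) A]
  {M : Type w} [AddCommGroup M] [Module A M] [Module (UA 𝔤 A) M] [IsScalarTower A (UA 𝔤 A) M]
  {J : Set (WeightHat H)}

/-- A positive root vector sends `y` into a strictly larger weight, where the module vanishes. -/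
lemma isHW_of_maximal {γ : WeightHat H} {y : M} (hy : y ∈ weightSpace A M γ)
    (hmax : ∀ κ, wLE b γ κ → κ ≠ γ → weightSpace A M κ = ⊥) : IsHW b A γ y := by
  refine ⟨hy, ?_⟩
  have h : nilHat b ≤ transporter M (Submodule.span A {y}) ⊥ := by
    refine nilHat_le_of_posVec fun k z hz m hm => ?_
    obtain ⟨a, rfl⟩ := Submodule.mem_span_singleton.mp hm
    obtain ⟨β, hβ, -, hzβ⟩ := exists_weight_of_mem_posVec hz
    have h1 := inc_smul_mem_weightSpace hzβ (Submodule.smul_mem _ a hy)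
    rwa [hmax (γ + β) ?_ ?_] at h1
    · rw [wLE, add_sub_cancel_left]
      exact AddSubmonoid.subset_closure hβ
    · intro h
      obtain ⟨k, -, hk, hk', -⟩ := posRoots_height b hβ
      rw [left_eq_add.mp h.symm, LinearMap.zero_apply] at hk'
      exact hk.ne (by exact_mod_cast hk')
  exact fun x hx => (Submodule.mem_bot A).mp (h hx y (Submodule.mem_span_singleton_self y))

/-- Only finitely many weights lie above `μ`; one of greatest height is maximal. Heights are
complex, but comparable weights differ by a natural number, so real parts suffice. -/
lemma exists_maximal_weight (hJ : IsLocallyBounded b J)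
    (hMJ : ∀ lam : WeightHat H, weightSpace A M lam ≠ ⊥ → lam ∈ J) {μ : WeightHat H}
    (hμ : weightSpace A M μ ≠ ⊥) : ∃ γ, wLE b μ γ ∧ weightSpace A M γ ≠ ⊥ ∧
      ∀ κ, wLE b γ κ → κ ≠ γ → weightSpace A M κ = ⊥ := by
  have hfin : {γ : WeightHat H | wLE b μ γ ∧ weightSpace A M γ ≠ ⊥}.Finite :=
    (hJ μ).subset fun γ hγ => ⟨hMJ γ hγ.2, hγ.1⟩
  obtain ⟨γ, ⟨h1, h2⟩, hmax⟩ := Set.exists_max_image _ (fun γ : WeightHat H => (γ (heightElt b)).re)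
    hfin ⟨μ, wLE_refl b μ, hμ⟩
  refine ⟨γ, h1, h2, fun κ hκ hne => ?_⟩
  by_contra hbot
  have h3 := hmax κ ⟨wLE_trans b h1 hκ, hbot⟩
  obtain ⟨k, hk, hk0⟩ := closure_height b hκ
  rw [LinearMap.sub_apply, sub_eq_iff_eq_add] at hk
  rw [hk, Complex.add_re, Complex.natCast_re] at h3
  have h4 : k = 0 := by
    have : (k : ℝ) ≤ 0 := by linarith
    exact_mod_cast le_antisymm this (Nat.cast_nonneg k)
  exact hne (sub_eq_zero.mp (hk0 h4))

lemma exists_weight_ne_bot (hM : IsWeightModule H A M) [Nontrivial M] :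
    ∃ μ : WeightHat H, weightSpace A M μ ≠ ⊥ := by
  by_contra h
  push Not at h
  have h1 := hM.2
  simp only [h, iSup_bot] at h1
  exact bot_ne_top h1

end Maximal

/-! ### Simplicity and classification by highest weight -/

section Simple

variable {𝔤 : Type u} [LieRing 𝔤] [LieAlgebra ℂ 𝔤] [FiniteDimensional ℂ 𝔤]
  [LieAlgebra.IsKilling ℂ 𝔤] {H : LieSubalgebra ℂ 𝔤} [H.IsCartanSubalgebra]
  {A : Type v} [CommRing A] [Algebra ℂ A] [Algebra (SymmetricAlgebra ℂ H) A]
  {b : (LieAlgebra.IsKilling.rootSystem H).Base} {lam : WeightHat H}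
  {σ : Affine 𝔤 →ₗ[ℂ] Affine 𝔤}

/-- Over a field, the sum of the proper submodules of a Verma module is proper. -/
lemma mk_one_notMem_sSup {K : Type v} [Field K] [Algebra ℂ K] [Algebra (SymmetricAlgebra ℂ H) K]
    [IsScalarTower ℂ (SymmetricAlgebra ℂ H) K] (hσ : IsChevalley H σ) :
    (Submodule.Quotient.mk 1 : Verma K b lam) ∉
      sSup {N : Submodule (UA 𝔤 K) (Verma K b lam) | N ≠ ⊤} := by
  have hw := isHW_mk_one (b := b) (A := K) lam
  have htop := span_mk_one (vermaIdeal K b lam)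
  have hM := hw.isWeightModule hσ htop
  have hV := hw.weightSpace_eq hσ htop
  set v : Verma K b lam := Submodule.Quotient.mk 1 with hv
  -- The largest submodule without a component of weight `lam`. A submodule `N` not inside it
  -- contains a nonzero multiple of `v`, since this weight space is a line, and is therefore
  -- everything.
  let X : Submodule (UA 𝔤 K) (Verma K b lam) :=
    { carrier := {m | ∀ u : UA 𝔤 K, wproj hM lam (u • m) = 0}
      add_mem' := fun {x y} hx hy u => by rw [smul_add, map_add, hx u, hy u, add_zero]
      zero_mem' := fun u => by rw [smul_zero, map_zero]
      smul_mem' := fun u x hx u' => by rw [smul_smul]; exact hx _ }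
  have hle : sSup {N : Submodule (UA 𝔤 K) (Verma K b lam) | N ≠ ⊤} ≤ X := by
    refine sSup_le fun N hN m hm u => ?_
    have h1 : wproj hM lam (u • m) ∈ Submodule.span K {v} := hV ▸ wproj_mem hM lam _
    obtain ⟨c, hc⟩ := Submodule.mem_span_singleton.mp h1
    rw [← hc]
    by_contra hne
    have hc0 : c ≠ 0 := by rintro rfl; exact hne (zero_smul _ _)
    have h2 : c • v ∈ N := hc ▸ wproj_mem_of_mem hM N lam (N.smul_mem u hm)
    have h3 := smulA_mem N c⁻¹ h2
    rw [inv_smul_smul₀ hc0] at h3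
    exact hN (eq_top_iff.mpr (htop ▸ (Submodule.span_singleton_le_iff_mem _ _).mpr h3))
  intro h
  have h1 := hle h 1
  rw [one_smul, wproj_self hM hw.weight, hv, Submodule.Quotient.mk_eq_zero] at h1
  refine vermaIdeal_ne_top (b := b) (A := K) hσ lam (eq_top_iff.mpr fun u _ => ?_)
  have := (vermaIdeal K b lam).smul_mem u h1
  rwa [smul_eq_mul, mul_one] at this

variable [IsLocalRing A]

lemma simpleVec_ne_zero [IsScalarTower ℂ (SymmetricAlgebra ℂ H) A] (hσ : IsChevalley H σ) :
    simpleVec A b lam ≠ 0 := fun h =>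
  mk_one_notMem_sSup (K := IsLocalRing.ResidueField A) (b := b) (lam := lam) hσ
    ((Submodule.Quotient.mk_eq_zero _).mp h)

/-- A vector outside the sum of the proper submodules generates the Verma module. -/
lemma isSimpleModule_simpleMod [IsScalarTower ℂ (SymmetricAlgebra ℂ H) A] (hσ : IsChevalley H σ) :
    IsSimpleModule (UA 𝔤 A) (SimpleMod A b lam) := by
  rw [isSimpleModule_iff_toSpanSingleton_surjective]
  refine ⟨⟨⟨_, _, simpleVec_ne_zero (b := b) (lam := lam) hσ⟩⟩, ?_⟩
  intro x hx
  obtain ⟨x, rfl⟩ := vermaToSimple_surjective x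
  obtain ⟨x, rfl⟩ : ∃ y, toVermaRes y = x := ⟨x, rfl⟩
  have htop : Submodule.span (UA 𝔤 (IsLocalRing.ResidueField A)) {x} = ⊤ := by
    by_contra hne
    apply hx
    exact (Submodule.Quotient.mk_eq_zero _).mpr
      (le_sSup (show _ ∈ {N : Submodule (UA 𝔤 (IsLocalRing.ResidueField A))
        (Verma (IsLocalRing.ResidueField A) b lam) | N ≠ ⊤} from hne)
        (Submodule.mem_span_singleton_self _))
  intro y
  obtain ⟨y, rfl⟩ := vermaToSimple_surjective y
  obtain ⟨y, rfl⟩ : ∃ z, toVermaRes z = y := ⟨y, rfl⟩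
  obtain ⟨u, hu⟩ := Submodule.mem_span_singleton.mp (htop ▸ Submodule.mem_top : y ∈ _)
  obtain ⟨u, rfl⟩ := residueMap_surjective u
  refine ⟨u, ?_⟩
  rw [LinearMap.toSpanSingleton_apply, ← map_smul, smul_toVermaRes, hu]

lemma span_eq_top_of_simple {R S : Type*} [Ring R] [AddCommGroup S] [Module R S]
    [IsSimpleModule R S] {x : S} (hx : x ≠ 0) : Submodule.span R {x} = ⊤ := by
  rcases eq_bot_or_eq_top (Submodule.span R {x}) with h | h
  · exact absurd (Submodule.span_singleton_eq_bot.mp h) hx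
  · exact h

/-- Simple modules are determined by the weight of a highest weight vector. -/
lemma nonempty_equiv_of_isHW (hσ : IsChevalley H σ)
    {S : Type*} [AddCommGroup S] [Module A S] [Module (UA 𝔤 A) S] [IsScalarTower A (UA 𝔤 A) S]
    {T : Type*} [AddCommGroup T] [Module A T] [Module (UA 𝔤 A) T] [IsScalarTower A (UA 𝔤 A) T]
    [IsSimpleModule (UA 𝔤 A) S] [IsSimpleModule (UA 𝔤 A) T] {s : S} {t : T}
    (hs : IsHW b A lam s) (hs0 : s ≠ 0) (ht : IsHW b A lam t) (ht0 : t ≠ 0)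
    (htm : ∀ a ∈ IsLocalRing.maximalIdeal A, a • t = 0) : Nonempty (S ≃ₗ[UA 𝔤 A] T) := by
  -- If the projection from `X` to `S` had a kernel, `X` would contain `(0, t)`, which by weight is
  -- a multiple `a (s, t)`. Then `a s = 0` and `a t = t`, impossible for `a` a unit and for `a` in
  -- the maximal ideal.
  set X := Submodule.span (UA 𝔤 A) {(s, t)} with hX
  have hst : IsHW b A lam (s, t) :=
    ⟨fun h => Prod.ext (hs.weight h) (ht.weight h), fun x hx => Prod.ext (hs.nil x hx) (ht.nil x hx)⟩
  have hw := hst.restrict X (Submodule.mem_span_singleton_self _)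
  have hV := hw.weightSpace_eq hσ (span_mk_eq_top (R := UA 𝔤 A) (s, t))
  let p : X →ₗ[UA 𝔤 A] S := LinearMap.fst _ S T ∘ₗ X.subtype
  let q : X →ₗ[UA 𝔤 A] T := LinearMap.snd _ S T ∘ₗ X.subtype
  let w : X := ⟨(s, t), Submodule.mem_span_singleton_self _⟩
  have hp0 : p ≠ 0 := fun h => hs0 (LinearMap.congr_fun h w)
  have hp : Function.Surjective p := LinearMap.surjective_of_ne_zero hp0
  have hp' : Function.Injective p := by
    rw [injective_iff_map_eq_zero]
    rintro ⟨⟨x, y⟩, hxy⟩ (hx : x = 0)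
    subst hx
    by_contra hne
    have hy : y ≠ 0 := by rintro rfl; exact hne rfl
    obtain ⟨u, hu⟩ := Submodule.mem_span_singleton.mp
      ((span_eq_top_of_simple (R := UA 𝔤 A) hy).symm ▸ Submodule.mem_top : t ∈ _)
    have h1 : ((0 : S), t) ∈ X := by
      have := X.smul_mem u hxy
      rwa [Prod.smul_mk, smul_zero, hu] at this
    have h2 : (⟨(0, t), h1⟩ : X) ∈ weightSpace A X lam :=
      coe_mem_weightSpace.mp fun h => Prod.ext (by simp) (ht.weight h)
    rw [hV] at h2
    obtain ⟨a, ha⟩ := Submodule.mem_span_singleton.mp h2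
    have h3 : a • s = 0 := congrArg (fun z : X => z.1.1) ha
    have h4 : a • t = t := congrArg (fun z : X => z.1.2) ha
    by_cases hu : IsUnit a
    · exact hs0 (hu.smul_eq_zero.mp h3)
    · exact ht0 (h4 ▸ htm a ((IsLocalRing.mem_maximalIdeal a).mpr hu))
  let e := LinearEquiv.ofBijective p ⟨hp', hp⟩
  have hq : q ∘ₗ e.symm.toLinearMap ≠ 0 := by
    intro h
    have h1 := LinearMap.congr_fun h (e w)
    rw [LinearMap.comp_apply, LinearEquiv.coe_coe, LinearEquiv.symm_apply_apply] at h1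
    exact ht0 h1
  exact ⟨LinearEquiv.ofBijective _ (LinearMap.bijective_of_ne_zero hq)⟩

variable {J : Set (WeightHat H)}

lemma inCatO_simpleMod (hσ : IsChevalley H σ) (hJ : IsOpenSet b J) (hJ' : IsLocallyBounded b J)
    (h : lam ∈ J) : InCatO A b J (SimpleMod A b lam) :=
  isHW_simpleVec.inCatO hσ span_simpleVec hJ hJ' h

lemma inCatO_vermaRes (hσ : IsChevalley H σ) (hJ : IsOpenSet b J) (hJ' : IsLocallyBounded b J)
    (h : lam ∈ J) : InCatO A b J (VermaRes A b lam) :=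
  isHW_vermaVec.inCatO hσ span_vermaVec hJ hJ' h

/-- Simple objects have highest weights. -/
lemma exists_isHW_of_simple [IsNoetherianRing A] (hσ : IsChevalley H σ)
    (hJ' : IsLocallyBounded b J)
    {S : Type w} [AddCommGroup S] [Module A S] [Module (UA 𝔤 A) S] [IsScalarTower A (UA 𝔤 A) S]
    [IsSimpleModule (UA 𝔤 A) S] (hS : InCatO A b J S) :
    ∃ γ ∈ J, ∃ s : S, s ≠ 0 ∧ IsHW b A γ s := by
  have : Nontrivial S := IsSimpleModule.nontrivial (UA 𝔤 A) S
  obtain ⟨μ, hμ⟩ := exists_weight_ne_bot hS.isWeight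
  obtain ⟨γ, -, hγ, hmax⟩ := exists_maximal_weight hJ' hS.weights hμ
  obtain ⟨s, hs, hs0⟩ := (Submodule.ne_bot_iff _).mp hγ
  exact ⟨γ, hS.weights γ hγ, s, hs0, isHW_of_maximal hs hmax⟩

/-- Simple objects are the `L_A(γ)`. -/
lemma exists_equiv_simpleMod [IsNoetherianRing A] [IsScalarTower ℂ (SymmetricAlgebra ℂ H) A]
    (hσ : IsChevalley H σ) (hJ' : IsLocallyBounded b J)
    {S : Type w} [AddCommGroup S] [Module A S] [Module (UA 𝔤 A) S] [IsScalarTower A (UA 𝔤 A) S]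
    [IsSimpleModule (UA 𝔤 A) S] (hS : InCatO A b J S) :
    ∃ γ ∈ J, Nonempty (S ≃ₗ[UA 𝔤 A] SimpleMod A b γ) := by
  obtain ⟨γ, hγ, s, hs0, hs⟩ := exists_isHW_of_simple hσ hJ' hS
  have := isSimpleModule_simpleMod (A := A) (b := b) (lam := γ) hσ
  exact ⟨γ, hγ, nonempty_equiv_of_isHW hσ hs hs0 isHW_simpleVec (simpleVec_ne_zero hσ)
    fun a ha => maximalIdeal_smul_simpleMod ha _⟩

end Simple

/-! ## Projective objects -/

section CatO

variable {𝔤 : Type u} [LieRing 𝔤] [LieAlgebra ℂ 𝔤] [FiniteDimensional ℂ 𝔤]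
  [LieAlgebra.IsKilling ℂ 𝔤] {H : LieSubalgebra ℂ 𝔤} [H.IsCartanSubalgebra]
  {A : Type v} [CommRing A] [Algebra ℂ A] [Algebra (SymmetricAlgebra ℂ H) A]
  {b : (LieAlgebra.IsKilling.rootSystem H).Base} {J : Set (WeightHat H)}
  {M : Type w} [AddCommGroup M] [Module A M] [Module (UA 𝔤 A) M] [IsScalarTower A (UA 𝔤 A) M]
  {N : Type*} [AddCommGroup N] [Module A N] [Module (UA 𝔤 A) N] [IsScalarTower A (UA 𝔤 A) N]

lemma InCatO.submodule (hJ : IsLocallyBounded b J) (hM : InCatO A b J M)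
    (X : Submodule (UA 𝔤 A) M) : InCatO A b J X := by
  refine (inCatO_iff hJ).mpr ⟨hM.isWeight.submodule X, fun lam h => hM.weights lam fun h0 => h ?_⟩
  rw [eq_bot_iff]
  intro x hx
  have h1 : (x : M) ∈ weightSpace A M lam := coe_mem_weightSpace.mpr hx
  rw [h0] at h1
  exact (Submodule.mem_bot A).mpr (Subtype.ext h1)

lemma InCatO.of_surjective (hJ : IsLocallyBounded b J) (hM : InCatO A b J M)
    (f : M →ₗ[UA 𝔤 A] N) (hf : Function.Surjective f) : InCatO A b J N := by
  refine (inCatO_iff hJ).mpr ⟨hM.isWeight.of_surjective f hf,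
    fun lam h => hM.weights lam fun h0 => h ?_⟩
  rw [eq_bot_iff]
  intro x hx
  obtain ⟨m, hm, rfl⟩ := exists_weight_lift hM.isWeight f hf hx
  rw [h0] at hm
  rw [(Submodule.mem_bot A).mp hm, map_zero]
  exact zero_mem _

/-- The affine algebra is spanned by positive root vectors, their images under `σ`, and the Cartan
subalgebra of weight zero. -/
lemma mem_of_forall_hasAdWeight {σ : Affine 𝔤 →ₗ[ℂ] Affine 𝔤} (hσ : IsChevalley H σ)
    {S : Submodule ℂ (Affine 𝔤)} (hS : ∀ (β : WeightHat H) (x : Affine 𝔤), HasAdWeight x β → x ∈ S)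
    (b : (LieAlgebra.IsKilling.rootSystem H).Base) (x : Affine 𝔤) : x ∈ S := by
  have h1 : nilHat b ≤ S := nilHat_le_of_posVec fun k z hz => by
    obtain ⟨β, -, -, h⟩ := exists_weight_of_mem_posVec hz
    exact hS β z h
  have h2 : nilHat b ≤ S.comap σ := nilHat_le_of_posVec fun k z hz => by
    obtain ⟨β, -, -, h⟩ := exists_weight_of_mem_posVec hz
    exact hS (-β) _ (hσ.hasAdWeight h)
  obtain ⟨f, ⟨z, hz, rfl⟩, c, hc, rfl⟩ := Submodule.mem_sup.mp (hσ.mem_sup (b := b) x)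
  obtain ⟨h, y, hy, rfl⟩ := mem_borelHat.mp hc
  refine add_mem (h2 hz) (add_mem (hS 0 _ fun h' => ?_) (h1 hy))
  rw [cartan_lie_cartan, LinearMap.zero_apply, zero_smul]

/-- A module generated by weight vectors is a weight module. -/
lemma isWeightModule_of_span {σ : Affine 𝔤 →ₗ[ℂ] Affine 𝔤} (hσ : IsChevalley H σ)
    (b : (LieAlgebra.IsKilling.rootSystem H).Base) {μ : WeightHat H} {v : M}
    (hv : v ∈ weightSpace A M μ) (htop : Submodule.span (UA 𝔤 A) {v} = ⊤) :
    IsWeightModule H A M := by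
  set T := ⨆ lam : WeightHat H, weightSpace A M lam with hT
  have hst : ∀ x : Affine 𝔤, ∀ m ∈ T, inc A x • m ∈ T := by
    refine mem_of_forall_hasAdWeight (S := transporter M T T) hσ (fun β x hx m hm => ?_) b
    have : T ≤ T.comap (act A M (inc A x)) := iSup_le fun lam m hm =>
      Submodule.mem_iSup_of_mem (lam + β) (inc_smul_mem_weightSpace hx hm)
    exact this hm
  rw [isWeightModule_iff, eq_top_iff]
  have h1 : Submodule.span (UA 𝔤 A) {v} ≤ stableSub T hst :=
    (Submodule.span_singleton_le_iff_mem _ _).mpr (Submodule.mem_iSup_of_mem μ hv)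
  rw [htop] at h1
  exact fun m _ => h1 Submodule.mem_top

lemma hom_ext_of_span {R V W : Type*} [Ring R] [AddCommGroup V] [Module R V] [AddCommGroup W]
    [Module R W] {v : V} (htop : Submodule.span R {v} = ⊤) {f g : V →ₗ[R] W} (h : f v = g v) :
    f = g := by
  refine LinearMap.ext_on_range (v := fun _ : Unit => v) ?_ fun _ => h
  rw [Set.range_const, htop]

lemma exists_hom_of_span {R W : Type*} [Ring R] [AddCommGroup W] [Module R W] {I : Submodule R R} {w : W} (h : ∀ z ∈ I, z • w = 0) :
    ∃ f : (R ⧸ I) →ₗ[R] W, f (Submodule.Quotient.mk 1) = w :=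
  ⟨I.liftQ (LinearMap.toSpanSingleton R W w) h,
    (Submodule.liftQ_apply _ _ _).trans (one_smul R w)⟩

/-- The functor of weight vectors is represented by an object of the truncated category. -/
lemma exists_representing {σ : Affine 𝔤 →ₗ[ℂ] Affine 𝔤} (hσ : IsChevalley H σ)
    (hJ : IsLocallyBounded b J) (μ : WeightHat H) :
    ∃ (Q : Type (max u v)) (_ : AddCommGroup Q) (_ : Module A Q) (_ : Module (UA 𝔤 A) Q)
      (_ : IsScalarTower A (UA 𝔤 A) Q) (v : Q), InCatO A b J Q ∧ v ∈ weightSpace A Q μ ∧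
      Submodule.span (UA 𝔤 A) {v} = ⊤ ∧
      ∀ (M : Type (max u v)) [AddCommGroup M] [Module A M] [Module (UA 𝔤 A) M]
        [IsScalarTower A (UA 𝔤 A) M], InCatO A b J M → ∀ m ∈ weightSpace A M μ,
        ∃ f : Q →ₗ[UA 𝔤 A] M, f v = m := by
  -- Induction from the Cartan subalgebra alone, since weight vectors need not be killed by the
  -- positive part.
  let I : Submodule (UA 𝔤 A) (UA 𝔤 A) := Submodule.span (UA 𝔤 A)
    {z | ∃ h : CartanHat H, z = inc A (cartanIncl h) - charVal A μ h • 1}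
  let v₀ : UA 𝔤 A ⧸ I := Submodule.Quotient.mk 1
  have hv₀ : v₀ ∈ weightSpace A (UA 𝔤 A ⧸ I) μ := fun h => by
    rw [← Submodule.Quotient.mk_smul, ← Submodule.Quotient.mk_smul, Submodule.Quotient.eq,
      smul_eq_mul, mul_one]
    exact Submodule.subset_span ⟨h, rfl⟩
  have htop := span_mk_one I
  have hW := isWeightModule_of_span hσ b hv₀ htop
  -- Dividing out all weight spaces outside `J` gives the largest quotient with weights in `J`.
  let X : Submodule (UA 𝔤 A) (UA 𝔤 A ⧸ I) := Submodule.span (UA 𝔤 A)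
    (⋃ κ ∈ Jᶜ, (weightSpace A (UA 𝔤 A ⧸ I) κ : Set (UA 𝔤 A ⧸ I)))
  refine ⟨(UA 𝔤 A ⧸ I) ⧸ X, inferInstance, inferInstance, inferInstance, inferInstance,
    X.mkQ v₀, ?_, map_mem_weightSpace _ hv₀, ?_, ?_⟩
  · refine (inCatO_iff hJ).mpr ⟨hW.of_surjective X.mkQ X.mkQ_surjective, fun κ hκ => ?_⟩
    by_contra hκJ
    refine hκ (eq_bot_iff.mpr fun x hx => ?_)
    obtain ⟨m, hm, rfl⟩ := exists_weight_lift hW X.mkQ X.mkQ_surjective hx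
    refine (Submodule.Quotient.mk_eq_zero X).mpr (Submodule.subset_span ?_)
    exact Set.mem_biUnion (show κ ∈ Jᶜ from hκJ) hm
  · rw [← Set.image_singleton, Submodule.span_image, htop, Submodule.map_top, Submodule.range_mkQ]
  · intro M _ _ _ _ hM m hm
    obtain ⟨f, hf⟩ := exists_hom_of_span (I := I) (w := m) (fun z hz => by
      refine Submodule.span_induction (p := fun z _ => z • m = 0) ?_ (zero_smul _ _) ?_ ?_ hz
      · rintro _ ⟨h, rfl⟩
        rw [sub_smul, smul_assoc, one_smul, hm h, sub_self]
      · intro x y _ _ hx hy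
        rw [add_smul, hx, hy, add_zero]
      · intro a x _ hx
        rw [smul_assoc, hx, smul_zero])
    refine ⟨X.liftQ f (Submodule.span_le.mpr fun x hx => ?_), ?_⟩
    · obtain ⟨κ, hκ, hx⟩ := Set.mem_iUnion₂.mp hx
      have h1 := map_mem_weightSpace f hx
      have h2 : weightSpace A M κ = ⊥ := by
        by_contra h; exact hκ (hM.weights κ h)
      rw [h2] at h1
      exact h1
    · rw [Submodule.mkQ_apply, Submodule.liftQ_apply]
      exact hf

end CatO

/-! ### Existence and uniqueness properties of projective covers -/

section Covers

variable {𝔤 : Type u} [LieRing 𝔤] [LieAlgebra ℂ 𝔤] [FiniteDimensional ℂ 𝔤]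
  [LieAlgebra.IsKilling ℂ 𝔤] {H : LieSubalgebra ℂ 𝔤} [H.IsCartanSubalgebra]
  {A : Type v} [CommRing A] [Algebra ℂ A] [Algebra (SymmetricAlgebra ℂ H) A] [IsLocalRing A]
  {b : (LieAlgebra.IsKilling.rootSystem H).Base} {J : Set (WeightHat H)}
  {σ : Affine 𝔤 →ₗ[ℂ] Affine 𝔤} {μ ν : WeightHat H}
  {P : Type (max u v)} [AddCommGroup P] [Module A P] [Module (UA 𝔤 A) P]
  [IsScalarTower A (UA 𝔤 A) P] {c : P →ₗ[UA 𝔤 A] SimpleMod A b μ}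

/-- A proper submodule of a projective cover is contained in the kernel of the cover. -/
lemma IsProjCover.le_ker [IsScalarTower ℂ (SymmetricAlgebra ℂ H) A] (hσ : IsChevalley H σ)
    (hJ : IsLocallyBounded b J) (hP : IsProjCover A b J μ P c)
    {X : Submodule (UA 𝔤 A) P} (hX : X ≠ ⊤) : X ≤ LinearMap.ker c := by
  have := isSimpleModule_simpleMod (A := A) (b := b) (lam := μ) hσ
  by_contra hne
  have h0 : c ∘ₗ X.subtype ≠ 0 := by
    intro h
    exact hne fun x hx => LinearMap.congr_fun h ⟨x, hx⟩
  have h1 := hP.essential X (hP.mem.submodule hJ X) X.subtype (LinearMap.surjective_of_ne_zero h0)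
  exact hX (eq_top_iff.mpr fun x _ => by obtain ⟨y, rfl⟩ := h1 x; exact y.2)

/-- The only simple quotient of a projective cover. -/
lemma IsProjCover.nonempty_equiv [IsScalarTower ℂ (SymmetricAlgebra ℂ H) A] (hσ : IsChevalley H σ)
    (hJ : IsLocallyBounded b J) (hP : IsProjCover A b J μ P c)
    {S : Type*} [AddCommGroup S] [Module (UA 𝔤 A) S] [IsSimpleModule (UA 𝔤 A) S]
    {f : P →ₗ[UA 𝔤 A] S} (hf : f ≠ 0) : Nonempty (SimpleMod A b μ ≃ₗ[UA 𝔤 A] S) := by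
  have := isSimpleModule_simpleMod (A := A) (b := b) (lam := μ) hσ
  have hle : LinearMap.ker f ≤ LinearMap.ker c :=
    hP.le_ker hσ hJ fun h => hf (LinearMap.ker_eq_top.mp h)
  have hsurj := LinearMap.surjective_of_ne_zero hf
  have hco : IsCoatom (LinearMap.ker f) := isSimpleModule_iff_isCoatom.mp
    (IsSimpleModule.congr (f.quotKerEquivOfSurjective hsurj))
  have hco' : IsCoatom (LinearMap.ker c) := isSimpleModule_iff_isCoatom.mp
    (IsSimpleModule.congr (c.quotKerEquivOfSurjective hP.surjective))
  have heq : LinearMap.ker f = LinearMap.ker c := by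
    rcases hle.eq_or_lt with h | h
    · exact h
    · exact absurd (hco.2 _ h) hco'.1
  exact ⟨(c.quotKerEquivOfSurjective hP.surjective).symm ≪≫ₗ
    (Submodule.quotEquivOfEq _ _ heq.symm) ≪≫ₗ f.quotKerEquivOfSurjective hsurj⟩

lemma wLE_of_simpleMod (hσ : IsChevalley H σ) {x : SimpleMod A b μ} (hx0 : x ≠ 0)
    (hx : x ∈ weightSpace A (SimpleMod A b μ) ν) : wLE b ν μ :=
  isHW_simpleVec.wLE_of_ne_bot hσ span_simpleVec ((Submodule.ne_bot_iff _).mpr ⟨x, hx, hx0⟩)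

/-- Each highest weight occurs in the other module, so it is below the other one. -/
lemma eq_of_equiv_simpleMod [IsScalarTower ℂ (SymmetricAlgebra ℂ H) A] (hσ : IsChevalley H σ)
    (e : SimpleMod A b μ ≃ₗ[UA 𝔤 A] SimpleMod A b ν) : μ = ν := by
  have key : ∀ {μ ν : WeightHat H} (e : SimpleMod A b μ ≃ₗ[UA 𝔤 A] SimpleMod A b ν),
      wLE b μ ν := fun {μ ν} e =>
    wLE_of_simpleMod hσ (x := e (simpleVec A b μ))
      (fun h => simpleVec_ne_zero hσ (e.map_eq_zero_iff.mp h))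
      (map_mem_weightSpace e.toLinearMap isHW_simpleVec.weight)
  exact wLE_antisymm b (key e) (key e.symm)

variable (A b J) in
/-- The simple module `L_A(μ)` has a projective cover. -/
def HasProjCover (μ : WeightHat H) : Prop :=
  ∃ (P : Type (max u v)) (_ : AddCommGroup P) (_ : Module A P) (_ : Module (UA 𝔤 A) P)
    (_ : IsScalarTower A (UA 𝔤 A) P) (c : P →ₗ[UA 𝔤 A] SimpleMod A b μ), IsProjCover A b J μ P c

/-- Idempotent endomorphisms of `Q` that do not change `c`. -/
def IsSplitting {R Q S : Type*} [Ring R] [AddCommGroup Q] [Module R Q] [AddCommGroup S] [Module R S]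
    (c : Q →ₗ[R] S) (e : Module.End R Q) : Prop := e * e = e ∧ c ∘ₗ e = c

lemma IsSplitting.apply_coe {R Q S : Type*} [Ring R] [AddCommGroup Q] [Module R Q] [AddCommGroup S]
    [Module R S] {c : Q →ₗ[R] S} {e : Module.End R Q} (he : IsSplitting c e)
    (x : LinearMap.range e) : e x = x := by
  obtain ⟨_, ⟨y, rfl⟩⟩ := x
  exact LinearMap.congr_fun he.1 y

/-- The subtracted map is the projector onto the copy `s(P)` inside the image of `e`; removing a
summand killed by `c` leaves `c` unchanged. -/
lemma IsSplitting.sub {R Q S : Type*} [Ring R] [AddCommGroup Q] [Module R Q] [AddCommGroup S]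
    [Module R S] {c : Q →ₗ[R] S} {e : Module.End R Q} (he : IsSplitting c e)
    {P : Type*} [AddCommGroup P] [Module R P] (g : LinearMap.range e →ₗ[R] P)
    (s : P →ₗ[R] LinearMap.range e) (hgs : ∀ p, g (s p) = p) (hc : ∀ p, c (s p) = 0) :
    IsSplitting c (e - (LinearMap.range e).subtype ∘ₗ s ∘ₗ g ∘ₗ e.rangeRestrict) := by
  have hr : ∀ x : LinearMap.range e, e.rangeRestrict x = x := fun x =>
    Subtype.ext (he.apply_coe x)
  set E : Module.End R Q := (LinearMap.range e).subtype ∘ₗ s ∘ₗ g ∘ₗ e.rangeRestrict with hE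
  have h1 : E * E = E := LinearMap.ext fun x => by
    simp only [hE, Module.End.mul_apply, LinearMap.comp_apply, Submodule.subtype_apply, hr, hgs]
  have h2 : e * E = E := LinearMap.ext fun x => he.apply_coe _
  have h3 : E * e = E := LinearMap.ext fun x => by
    have : e.rangeRestrict (e x) = e.rangeRestrict x := hr (e.rangeRestrict x)
    simp only [hE, Module.End.mul_apply, LinearMap.comp_apply, this]
  refine ⟨?_, LinearMap.ext fun x => ?_⟩
  · rw [sub_mul, mul_sub, mul_sub, he.1, h1, h2, h3, sub_self, sub_zero]
  · rw [LinearMap.comp_apply, LinearMap.sub_apply, map_sub]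
    have : c (E x) = 0 := hc _
    rw [this, sub_zero]
    exact LinearMap.congr_fun he.2 x

variable [IsNoetherianRing A] [IsScalarTower ℂ (SymmetricAlgebra ℂ H) A]

/-- Start with the object `Q` representing weight vectors of weight `μ`, which is projective because
weight vectors lift. Split off covers of `L_A(γ)` with `γ > μ` until nothing more can be removed
without affecting the map to `L_A(μ)`. The remaining summand is the cover. -/
lemma hasProjCover_of_forall_gt (hσ : IsChevalley H σ) (hJ : IsOpenSet b J)
    (hJ' : IsLocallyBounded b J) (hμ : μ ∈ J)
    (ih : ∀ ν ∈ J, wLE b μ ν → ν ≠ μ → HasProjCover A b J ν) : HasProjCover A b J μ := by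
  obtain ⟨Q, _, _, _, _, v, hQ, hv, htop, hrep⟩ := exists_representing (A := A) (b := b) hσ hJ' μ
  have hL := inCatO_simpleMod (A := A) hσ hJ hJ' hμ
  have hsimple := isSimpleModule_simpleMod (A := A) (b := b) (lam := μ) hσ
  obtain ⟨c, hc⟩ := hrep _ hL (simpleVec A b μ) isHW_simpleVec.weight
  let F : Set (WeightHat H) := {γ ∈ J | wLE b μ γ}
  have hF : F.Finite := hJ' μ
  -- `G` collects the finitely many weights of `J` above `μ` and is Noetherian over `A`; measuring
  -- kernels of idempotents on `G` makes a maximal kernel exist.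
  let G : Submodule A Q := ⨆ γ ∈ hF.toFinset, weightSpace A Q γ
  have hfg : ∀ κ, (weightSpace A Q κ).FG := fun κ => by
    have h1 := weightSpace_span_fg hσ hJ' hQ.isWeight hQ.weights hv κ
    rw [htop] at h1
    have h2 : toA (⊤ : Submodule (UA 𝔤 A) Q) = ⊤ := rfl
    rwa [h2, top_inf_eq] at h1
  have hG : IsNoetherian A G := isNoetherian_of_fg_of_noetherian G
    (Submodule.fg_biSup _ _ fun κ _ => hfg κ)
  obtain ⟨_, ⟨e, he, rfl⟩, hmax⟩ := wellFounded_gt.has_min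
    ((fun e : Module.End (UA 𝔤 A) Q => (toA (LinearMap.ker e)).comap G.subtype) ''
      {e | IsSplitting c e}) ⟨_, 1, ⟨one_mul _, rfl⟩, rfl⟩
  have hC := hQ.submodule hJ' (LinearMap.range e)
  let cC : LinearMap.range e →ₗ[UA 𝔤 A] SimpleMod A b μ := c ∘ₗ (LinearMap.range e).subtype
  let vC : LinearMap.range e := e.rangeRestrict v
  have hvC : vC ∈ weightSpace A (LinearMap.range e) μ := map_mem_weightSpace _ hv
  have htopC : Submodule.span (UA 𝔤 A) {vC} = ⊤ := by
    rw [← Set.image_singleton (f := e.rangeRestrict), Submodule.span_image, htop,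
      Submodule.map_top, LinearMap.range_eq_top]
    exact e.surjective_rangeRestrict
  have hcvC : cC vC = simpleVec A b μ := (LinearMap.congr_fun he.2 v).trans hc
  have hcC : Function.Surjective cC := LinearMap.surjective_of_ne_zero fun h =>
    simpleVec_ne_zero (A := A) (b := b) (lam := μ) hσ (hcvC ▸ LinearMap.congr_fun h vC)
  have hproj : ∀ (M N : Type (max u v)) [AddCommGroup M] [Module A M] [Module (UA 𝔤 A) M]
      [IsScalarTower A (UA 𝔤 A) M] [AddCommGroup N] [Module A N] [Module (UA 𝔤 A) N]
      [IsScalarTower A (UA 𝔤 A) N], InCatO A b J M → InCatO A b J N →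
      ∀ (p : M →ₗ[UA 𝔤 A] N) (f : LinearMap.range e →ₗ[UA 𝔤 A] N), Function.Surjective p →
        ∃ f' : LinearMap.range e →ₗ[UA 𝔤 A] M, p ∘ₗ f' = f := by
    intro M N _ _ _ _ _ _ _ _ hM hN p f hp
    obtain ⟨m, hm, hpm⟩ := exists_weight_lift hM.isWeight p hp (map_mem_weightSpace f hvC)
    obtain ⟨h, hh⟩ := hrep M hM m hm
    have h1 : p ∘ₗ h = f ∘ₗ e.rangeRestrict := hom_ext_of_span htop (by
      rw [LinearMap.comp_apply, hh, hpm]; rfl)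
    refine ⟨h ∘ₗ (LinearMap.range e).subtype, LinearMap.ext fun x => ?_⟩
    have h2 := LinearMap.congr_fun h1 x
    have h3 : e.rangeRestrict x = x := Subtype.ext (he.apply_coe x)
    rw [LinearMap.comp_apply, LinearMap.comp_apply, h3] at h2
    exact h2
  refine ⟨LinearMap.range e, inferInstance, inferInstance, inferInstance, inferInstance, cC,
    hC, hproj, hcC, ?_⟩
  intro M _ _ _ _ hM g hg
  by_contra hns
  have hfin : Module.Finite (UA 𝔤 A) (LinearMap.range e) :=
    ⟨Submodule.fg_def.mpr ⟨{vC}, Set.finite_singleton _, htopC⟩⟩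
  -- If `g` is not onto, its image lies in the kernel of a map `f` onto a simple `L_A(γ)`. The
  -- generator has weight `μ` and survives under `f`, so `γ ≥ μ`.
  obtain ⟨X, hX, hXg⟩ := (eq_top_or_exists_le_coatom (LinearMap.range g)).resolve_left
    fun h => hns (LinearMap.range_eq_top.mp h)
  have hXs : IsSimpleModule (UA 𝔤 A) (LinearMap.range e ⧸ X) := isSimpleModule_iff_isCoatom.mpr hX
  have hXO := hC.of_surjective hJ' X.mkQ X.mkQ_surjective
  obtain ⟨γ, hγ, ⟨ε⟩⟩ := exists_equiv_simpleMod hσ hJ' hXO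
  let f : LinearMap.range e →ₗ[UA 𝔤 A] SimpleMod A b γ := ε.toLinearMap ∘ₗ X.mkQ
  have hf : Function.Surjective f := ε.surjective.comp X.mkQ_surjective
  have hfg0 : ∀ m, f (g m) = 0 := fun m => by
    have : X.mkQ (g m) = 0 := (Submodule.Quotient.mk_eq_zero X).mpr (hXg ⟨m, rfl⟩)
    rw [LinearMap.comp_apply, this, map_zero]
  have hfv : f vC ≠ 0 := fun h => by
    have h0 : f = 0 := hom_ext_of_span htopC h
    obtain ⟨x, hx⟩ := hf (simpleVec A b γ)
    exact simpleVec_ne_zero hσ (by rw [← hx, h0, LinearMap.zero_apply])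
  have hfv' := map_mem_weightSpace f hvC
  have hle : wLE b μ γ := wLE_of_simpleMod hσ hfv hfv'
  by_cases hγμ : γ = μ
  · subst hγμ
    -- For `γ = μ` the weight space is cyclic, so `f` is a multiple of `cC`; as `cC ∘ g` is onto, `f
    -- ∘ g` could not vanish.
    rw [isHW_simpleVec.weightSpace_eq hσ span_simpleVec] at hfv'
    obtain ⟨a, ha⟩ := Submodule.mem_span_singleton.mp hfv'
    have h1 : f = homothety (𝔤 := 𝔤) (SimpleMod A b γ) a ∘ₗ cC := hom_ext_of_span htopC
      (ha.symm.trans (congrArg (a • ·) hcvC.symm))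
    obtain ⟨m, hm⟩ := hg (simpleVec A b γ)
    have h2 := hfg0 m
    have h3 : cC (g m) = simpleVec A b γ := hm
    rw [h1, LinearMap.comp_apply, h3, homothety_apply, ha] at h2
    exact hfv h2
  · obtain ⟨P, _, _, _, _, d, hP⟩ := ih γ hγ hle hγμ
    have hLγ := inCatO_simpleMod (A := A) hσ hJ hJ' hγ
    obtain ⟨g', hg'⟩ := hproj P _ hP.mem hLγ d f hP.surjective
    have hg's : Function.Surjective g' := hP.essential _ hC g' (hg' ▸ hf)
    obtain ⟨s, hs⟩ := hP.projective _ _ hC hP.mem g' LinearMap.id hg's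
    have hgs : ∀ p, g' (s p) = p := LinearMap.congr_fun hs
    -- Otherwise `L_A(μ)` would be a simple quotient of the cover of `L_A(γ)`.
    have hcs : ∀ p, c (s p) = 0 := by
      by_contra hne
      have h0 : cC ∘ₗ s ≠ 0 := fun h => hne (LinearMap.congr_fun h)
      obtain ⟨ε'⟩ := hP.nonempty_equiv hσ hJ' h0
      exact hγμ (eq_of_equiv_simpleMod hσ ε')
    have hsplit := he.sub g' s hgs hcs
    obtain ⟨p, hp, hdp⟩ := exists_weight_lift hP.mem.isWeight d hP.surjective
      (isHW_simpleVec (A := A) (b := b) (lam := γ)).weight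
    have hp0 : p ≠ 0 := by
      rintro rfl
      rw [map_zero] at hdp
      exact simpleVec_ne_zero hσ hdp.symm
    have hw : (s p : Q) ∈ weightSpace A Q γ :=
      map_mem_weightSpace ((LinearMap.range e).subtype ∘ₗ s) hp
    have hwG : (s p : Q) ∈ G := Submodule.mem_iSup_of_mem γ
      (Submodule.mem_iSup_of_mem (hF.mem_toFinset.mpr ⟨hγ, hle⟩) hw)
    -- The new kernel is strictly larger on `G`: it contains the weight vector `s p`, which `e`
    -- fixes.
    refine hmax _ ⟨_, hsplit, rfl⟩ (lt_of_le_of_ne ?_ ?_)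
    · intro x hx
      have hx' : e x = 0 := hx
      have hx'' : e.rangeRestrict (x : Q) = 0 := Subtype.ext hx'
      show e x - (LinearMap.range e).subtype (s (g' (e.rangeRestrict (x : Q)))) = 0
      rw [hx', hx'', map_zero, map_zero, map_zero, sub_zero]
    · intro heq
      have h1 : (⟨_, hwG⟩ : G) ∈ (toA (LinearMap.ker
          (e - (LinearMap.range e).subtype ∘ₗ s ∘ₗ g' ∘ₗ e.rangeRestrict))).comap G.subtype := by
        have h3 : e.rangeRestrict (s p : Q) = s p := Subtype.ext (he.apply_coe (s p))
        show e (s p : Q) - (LinearMap.range e).subtype (s (g' (e.rangeRestrict (s p : Q)))) = 0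
        rw [h3, hgs, he.apply_coe, Submodule.subtype_apply, sub_self]
      have heq' := (SetLike.ext_iff.mp heq _).mpr h1
      have h2 : e (s p : Q) = 0 := heq'
      rw [he.apply_coe] at h2
      have h4 : s p = 0 := Subtype.ext h2
      exact hp0 (by rw [← hgs p, h4, map_zero])

/-- Projective covers exist in the truncated category. -/
lemma hasProjCover (hσ : IsChevalley H σ) (hJ : IsOpenSet b J) (hJ' : IsLocallyBounded b J)
    (hμ : μ ∈ J) : HasProjCover A b J μ := by
  -- Induct on the number of weights of `J` above `μ`, which drops on passing to a larger weight.
  induction h : {γ ∈ J | wLE b μ γ}.ncard using Nat.strong_induction_on generalizing μ with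
  | _ n ih =>
    refine hasProjCover_of_forall_gt hσ hJ hJ' hμ fun ν hν hμν hne => ih _ ?_ hν rfl
    rw [← h]
    refine Set.ncard_lt_ncard ⟨fun γ hγ => ⟨hγ.1, wLE_trans b hμν hγ.2⟩, fun hsub => ?_⟩ (hJ' μ)
    exact hne (wLE_antisymm b (hsub ⟨hμ, wLE_refl b μ⟩).2 hμν)

end Covers

/-! ## Duality -/

section Functionals

variable {A : Type*} [CommRing A] [IsLocalRing A] {V : Type*} [AddCommGroup V] [Module A V]

/-- A nonzero finitely generated module has a maximal submodule, and over a local ring the simple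
quotient is the residue field. -/
lemma exists_functional_ne_zero [Module.Finite A V] [Nontrivial V] :
    ∃ φ : V →ₗ[A] IsLocalRing.ResidueField A, φ ≠ 0 := by
  obtain ⟨X, hX, -⟩ := (eq_top_or_exists_le_coatom (⊥ : Submodule A V)).resolve_left bot_ne_top
  have hs : IsSimpleModule A (V ⧸ X) := isSimpleModule_iff_isCoatom.mpr hX
  obtain ⟨I, hI, ⟨e⟩⟩ := isSimpleModule_iff_quot_maximal.mp hs
  rw [IsLocalRing.eq_maximalIdeal hI] at e
  refine ⟨(e.toLinearMap : (V ⧸ X) →ₗ[A] A ⧸ IsLocalRing.maximalIdeal A) ∘ₗ X.mkQ, fun h => ?_⟩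
  refine hX.1 (eq_top_iff.mpr fun x _ => ?_)
  have h1 : e (X.mkQ x) = 0 := LinearMap.congr_fun h x
  exact (Submodule.Quotient.mk_eq_zero X).mp (e.map_eq_zero_iff.mp h1)

/-- The double annihilator theorem for functionals with values in the residue field. -/
lemma mem_of_forall_functional_eq_zero [Module.Finite A V]
    {E : Submodule A (V →ₗ[A] IsLocalRing.ResidueField A)} {f : V →ₗ[A] IsLocalRing.ResidueField A}
    (h : ∀ x, (∀ g ∈ E, g x = 0) → f x = 0) : f ∈ E := by
  let K := IsLocalRing.ResidueField A
  -- Functionals with values in `K` are those of the finite-dimensional space `K ⊗ V`, all of whose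
  -- elements come from `V`; this reduces the claim to linear algebra over `K`.
  have hone : ∀ z : K ⊗[A] V, ∃ x : V, z = 1 ⊗ₜ x := by
    intro z
    induction z using TensorProduct.induction_on with
    | zero => exact ⟨0, (TensorProduct.tmul_zero _ _).symm⟩
    | add y z hy hz =>
      obtain ⟨y, rfl⟩ := hy
      obtain ⟨z, rfl⟩ := hz
      exact ⟨y + z, (TensorProduct.tmul_add _ _ _).symm⟩
    | tmul c x =>
      obtain ⟨a, rfl⟩ := IsLocalRing.residue_surjective c
      refine ⟨a • x, ?_⟩
      rw [← TensorProduct.smul_tmul, Algebra.smul_def, mul_one]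
      rfl
  have hlift : ∀ (g : V →ₗ[A] K) (x : V), g.liftBaseChange K (1 ⊗ₜ x) = g x := fun g x => by
    rw [LinearMap.liftBaseChange_tmul, one_smul]
  have hmem : f.liftBaseChange K ∈ Submodule.span K
      (Set.range fun g : E => (g : V →ₗ[A] K).liftBaseChange K) := by
    refine FiniteDimensional.mem_span_of_iInf_ker_le_ker fun z hz => ?_
    obtain ⟨x, rfl⟩ := hone z
    rw [LinearMap.mem_ker, hlift]
    refine h x fun g hg => ?_
    have := (Submodule.mem_iInf _).mp hz ⟨g, hg⟩
    rwa [LinearMap.mem_ker, hlift] at this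
  have key : ∀ y ∈ Submodule.span K (Set.range fun g : E => (g : V →ₗ[A] K).liftBaseChange K),
      ∃ g ∈ E, ∀ x : V, y (1 ⊗ₜ x) = g x := by
    intro y hy
    induction hy using Submodule.span_induction with
    | zero => exact ⟨0, zero_mem _, fun x => rfl⟩
    | add y z _ _ hy hz =>
      obtain ⟨g, hg, hg'⟩ := hy
      obtain ⟨k, hk, hk'⟩ := hz
      exact ⟨g + k, add_mem hg hk, fun x => by
        rw [LinearMap.add_apply, hg', hk', LinearMap.add_apply]⟩
    | smul c y _ hy =>
      obtain ⟨g, hg, hg'⟩ := hy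
      obtain ⟨a, rfl⟩ := IsLocalRing.residue_surjective c
      exact ⟨a • g, E.smul_mem a hg, fun x => by
        rw [LinearMap.smul_apply, hg', LinearMap.smul_apply, Algebra.smul_def]; rfl⟩
    | mem y hy =>
      obtain ⟨g, rfl⟩ := hy
      exact ⟨g, g.2, fun x => hlift _ x⟩
  obtain ⟨g, hg, hg'⟩ := key _ hmem
  have : f = g := LinearMap.ext fun x => by rw [← hg', hlift]
  exact this ▸ hg

end Functionals

/-! ### The contragredient dual with values in the residue field -/

section DualModule

variable {𝔤 : Type u} [LieRing 𝔤] [LieAlgebra ℂ 𝔤] [FiniteDimensional ℂ 𝔤]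
  [LieAlgebra.IsKilling ℂ 𝔤] {H : LieSubalgebra ℂ 𝔤} [H.IsCartanSubalgebra]
  {A : Type v} [CommRing A] [Algebra ℂ A] [Algebra (SymmetricAlgebra ℂ H) A] [IsLocalRing A]
  {b : (LieAlgebra.IsKilling.rootSystem H).Base}
  {σ : Affine 𝔤 →ₗ[ℂ] Affine 𝔤}
  (M : Type w) [AddCommGroup M] [Module A M] [Module (UA 𝔤 A) M] [IsScalarTower A (UA 𝔤 A) M]

variable (A σ) in
/-- The contragredient action on functionals. -/
def dualRep : Affine 𝔤 →ₗ[ℂ] Module.End A (M →ₗ[A] IsLocalRing.ResidueField A) where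
  toFun x := (act A M (inc A (σ x))).lcomp A (IsLocalRing.ResidueField A)
  map_add' x y := by
    refine LinearMap.ext fun f => LinearMap.ext fun m => ?_
    show f (inc A (σ (x + y)) • m) = f (inc A (σ x) • m) + f (inc A (σ y) • m)
    rw [map_add, inc_add, add_smul, map_add]
  map_smul' c x := by
    refine LinearMap.ext fun f => LinearMap.ext fun m => ?_
    show f (inc A (σ (c • x)) • m) = c • f (inc A (σ x) • m)
    rw [map_smul σ, inc_smul_smul, map_smul, algebraMap_smul]

lemma dualRep_apply (x : Affine 𝔤) (f : M →ₗ[A] IsLocalRing.ResidueField A) (m : M) :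
    dualRep A σ M x f m = f (inc A (σ x) • m) := rfl

lemma dualRep_lie (hσ : IsChevalley H σ) (x y : Affine 𝔤) : dualRep A σ M ⁅x, y⁆ =
    dualRep A σ M x * dualRep A σ M y - dualRep A σ M y * dualRep A σ M x := by
  refine LinearMap.ext fun f => LinearMap.ext fun m => ?_
  show f (inc A (σ ⁅x, y⁆) • m) =
    f (inc A (σ y) • inc A (σ x) • m) - f (inc A (σ x) • inc A (σ y) • m)
  rw [hσ.lie, inc_lie_smul, map_sub]

variable (hσ : IsChevalley H σ)

/-- The contragredient dual of a module over `A ⊗ U`. -/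
def DualMod (_ : IsChevalley H σ) (A : Type v) [CommRing A] [IsLocalRing A] (M : Type w)
    [AddCommGroup M] [Module A M] : Type (max v w) := M →ₗ[A] IsLocalRing.ResidueField A

instance : AddCommGroup (DualMod hσ A M) :=
  inferInstanceAs (AddCommGroup (M →ₗ[A] IsLocalRing.ResidueField A))

instance : Module A (DualMod hσ A M) :=
  inferInstanceAs (Module A (M →ₗ[A] IsLocalRing.ResidueField A))

instance : Module (UA 𝔤 A) (DualMod hσ A M) :=
  Module.compHom (M →ₗ[A] IsLocalRing.ResidueField A)
    (envLift (dualRep A σ M) (dualRep_lie M hσ)).toRingHom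

variable {M}

/-- A functional as an element of the dual module. -/
def toDual (f : M →ₗ[A] IsLocalRing.ResidueField A) : DualMod hσ A M := f

variable {hσ}

/-- An element of the dual module as a functional. -/
def ofDual : DualMod hσ A M →ₗ[A] M →ₗ[A] IsLocalRing.ResidueField A := LinearMap.id

lemma dual_ext {f g : DualMod hσ A M} (h : ∀ m, ofDual f m = ofDual g m) : f = g :=
  LinearMap.ext h

instance : IsScalarTower A (UA 𝔤 A) (DualMod hσ A M) :=
  ⟨fun a u f => by
    show envLift (dualRep A σ M) (dualRep_lie M hσ) (a • u) (ofDual f) =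
      a • envLift (dualRep A σ M) (dualRep_lie M hσ) u (ofDual f)
    rw [map_smul, LinearMap.smul_apply]⟩

lemma ofDual_inc_smul (x : Affine 𝔤) (f : DualMod hσ A M) (m : M) :
    ofDual (inc A x • f) m = ofDual f (inc A (σ x) • m) := by
  show envLift (dualRep A σ M) (dualRep_lie M hσ) (inc A x) (ofDual f) m = _
  have h : envLift (dualRep A σ M) (dualRep_lie M hσ) (inc A x) = dualRep A σ M x :=
    envLift_ι _ _ x
  rw [h, dualRep_apply]

lemma maximalIdeal_smul_residueField {a : A} (ha : a ∈ IsLocalRing.maximalIdeal A)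
    (c : IsLocalRing.ResidueField A) : a • c = 0 := by
  have h : algebraMap A (IsLocalRing.ResidueField A) a = 0 :=
    (IsLocalRing.residue_eq_zero_iff a).mpr ha
  rw [Algebra.smul_def, h, zero_mul]

lemma maximalIdeal_smul_dual {a : A} (ha : a ∈ IsLocalRing.maximalIdeal A)
    (f : DualMod hσ A M) : a • f = 0 := dual_ext fun m => by
  rw [map_smul, LinearMap.smul_apply, maximalIdeal_smul_residueField ha, map_zero,
    LinearMap.zero_apply]

lemma isHW_dual {γ : WeightHat H} {f : DualMod hσ A M}
    (h1 : ∀ x ∈ nilHat b, ∀ m, ofDual f (inc A (σ x) • m) = 0)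
    (h2 : ∀ h m, ofDual f (inc A (cartanIncl h) • m) = charVal A γ h • ofDual f m) :
    IsHW b A γ f := by
  refine ⟨fun h => dual_ext fun m => ?_, fun x hx => dual_ext fun m => ?_⟩
  · rw [ofDual_inc_smul, hσ.cartan, h2, map_smul, LinearMap.smul_apply]
  · rw [ofDual_inc_smul, h1 x hx, map_zero, LinearMap.zero_apply]

/-- Weight vectors of the dual vanish on the weight spaces of other weights. -/
lemma ofDual_eq_zero_of_ne {κ ν : WeightHat H} (hne : κ ≠ ν) {f : DualMod hσ A M}
    (hf : f ∈ weightSpace A (DualMod hσ A M) κ) {m : M} (hm : m ∈ weightSpace A M ν) :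
    ofDual f m = 0 := by
  obtain ⟨h, hh⟩ : ∃ h, κ h ≠ ν h := by
    by_contra hcon
    push Not at hcon
    exact hne (LinearMap.ext hcon)
  have h1 := ofDual_inc_smul (cartanIncl h) f m
  rw [hf h, hσ.cartan, hm h, map_smul, map_smul, LinearMap.smul_apply, ← sub_eq_zero, ← sub_smul,
    charVal_sub] at h1
  have hu : IsUnit (algebraMap ℂ A (κ h - ν h)) :=
    (isUnit_iff_ne_zero.mpr (sub_ne_zero.mpr hh)).map _
  exact hu.smul_eq_zero.mp h1

end DualModule

/-! ### Functionals supported on one weight space -/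

section HighestFunctional

variable {𝔤 : Type u} [LieRing 𝔤] [LieAlgebra ℂ 𝔤] [FiniteDimensional ℂ 𝔤]
  [LieAlgebra.IsKilling ℂ 𝔤] {H : LieSubalgebra ℂ 𝔤} [H.IsCartanSubalgebra]
  {A : Type v} [CommRing A] [Algebra ℂ A] [Algebra (SymmetricAlgebra ℂ H) A]
  {b : (LieAlgebra.IsKilling.rootSystem H).Base}
  {σ : Affine 𝔤 →ₗ[ℂ] Affine 𝔤}
  {M : Type w} [AddCommGroup M] [Module A M] [Module (UA 𝔤 A) M] [IsScalarTower A (UA 𝔤 A) M]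
  {V : Type*} [AddCommGroup V] [Module A V] {γ : WeightHat H}

/-- A map that is supported in a maximal weight vanishes on the image of the negative part. -/
lemma apply_negative_smul_eq_zero (hσ : IsChevalley H σ) (hM : IsWeightModule H A M)
    (hmax : ∀ κ, wLE b γ κ → κ ≠ γ → weightSpace A M κ = ⊥) {f : M →ₗ[A] V}
    (hf : ∀ κ ≠ γ, ∀ m ∈ weightSpace A M κ, f m = 0) {x : Affine 𝔤} (hx : x ∈ nilHat b) (m : M) :
    f (inc A (σ x) • m) = 0 := by
  have h : nilHat b ≤ (transporter M ⊤ (LinearMap.ker f)).comap σ := by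
    refine nilHat_le_of_posVec fun k z hz m _ => ?_
    obtain ⟨β, hβ, -, hzβ⟩ := exists_weight_of_mem_posVec hz
    refine hM.induction (p := fun m => f (inc A (σ z) • m) = 0) ?_ ?_ ?_ m
    · intro κ m hm
      have h1 := inc_smul_mem_weightSpace (hσ.hasAdWeight hzβ) hm
      by_cases hκ : κ + -β = γ
      · have h2 : weightSpace A M κ = ⊥ := by
          refine hmax κ ?_ ?_
          · rw [wLE, ← hκ, ← sub_eq_add_neg, sub_sub_cancel]
            exact AddSubmonoid.subset_closure hβ
          · intro h
            obtain ⟨k, -, hk, hk', -⟩ := posRoots_height b hβ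
            have h3 : β = 0 := by
              rw [h, add_eq_left, neg_eq_zero] at hκ
              exact hκ
            rw [h3, LinearMap.zero_apply] at hk'
            exact hk.ne (by exact_mod_cast hk')
        rw [h2, Submodule.mem_bot] at hm
        rw [hm, smul_zero, map_zero]
      · exact hf _ hκ _ h1
    · rw [smul_zero, map_zero]
    · intro m n hm hn
      rw [smul_add, map_add, hm, hn, add_zero]
  exact h hx m trivial

lemma apply_cartan_smul (hM : IsWeightModule H A M) {f : M →ₗ[A] V}
    (hf : ∀ κ ≠ γ, ∀ m ∈ weightSpace A M κ, f m = 0) (h : CartanHat H) (m : M) :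
    f (inc A (cartanIncl h) • m) = charVal A γ h • f m := by
  refine hM.induction (p := fun m => f (inc A (cartanIncl h) • m) = charVal A γ h • f m) ?_ ?_ ?_ m
  · intro κ m hm
    rw [hm h, map_smul]
    by_cases hκ : κ = γ
    · rw [hκ]
    · rw [hf κ hκ m hm, smul_zero, smul_zero]
  · rw [smul_zero, map_zero, smul_zero]
  · intro m n hm hn
    rw [smul_add, map_add, hm, hn, map_add, smul_add]

/-- A functional on a weight space, extended by zero. -/
def extendWeight (hM : IsWeightModule H A M) (φ : weightSpace A M γ →ₗ[A] V) : M →ₗ[A] V :=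
  φ ∘ₗ (wproj hM γ).codRestrict _ (wproj_mem hM γ)

lemma extendWeight_apply (hM : IsWeightModule H A M) (φ : weightSpace A M γ →ₗ[A] V)
    (m : weightSpace A M γ) : extendWeight hM φ m = φ m :=
  congrArg φ (Subtype.ext (wproj_self hM m.2))

lemma extendWeight_of_ne (hM : IsWeightModule H A M) (φ : weightSpace A M γ →ₗ[A] V)
    {κ : WeightHat H} (hκ : κ ≠ γ) {m : M} (hm : m ∈ weightSpace A M κ) :
    extendWeight hM φ m = 0 := by
  have : (wproj hM γ).codRestrict _ (wproj_mem hM γ) m = 0 := Subtype.ext (wproj_of_ne hM hκ hm)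
  rw [extendWeight, LinearMap.comp_apply, this, map_zero]

end HighestFunctional

/-! ### Verma subquotients from maximal weights -/

section Duality

variable {R : Type*} [Ring R] {V P M L : Type*} [AddCommGroup V] [Module R V] [AddCommGroup P]
  [Module R P] [AddCommGroup M] [Module R M] [AddCommGroup L] [Module R L]

/-- The preimage of the range of `φ` under `h` maps onto that range, which is `P ⧸ ker φ` and so
maps onto `L`. -/
lemma isSubquotient_of_range_le {h : V →ₗ[R] M} {φ : P →ₗ[R] M} {c : P →ₗ[R] L}
    (hc : Function.Surjective c) (hker : LinearMap.ker φ ≤ LinearMap.ker c)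
    (hle : LinearMap.range φ ≤ LinearMap.range h) : IsSubquotient R L V := by
  rw [isSubquotient_iff]
  let X := (LinearMap.range φ).comap h
  let k : X →ₗ[R] LinearMap.range φ := (h ∘ₗ X.subtype).codRestrict _ fun x => x.2
  have hk : Function.Surjective k := by
    rintro ⟨y, hy⟩
    obtain ⟨x, rfl⟩ := hle hy
    exact ⟨⟨x, hy⟩, rfl⟩
  have hl : Function.Surjective ((LinearMap.ker φ).liftQ c hker) := fun y => by
    obtain ⟨x, rfl⟩ := hc y
    exact ⟨Submodule.Quotient.mk x, rfl⟩
  exact ⟨X, (LinearMap.ker φ).liftQ c hker ∘ₗ φ.quotKerEquivRange.symm.toLinearMap ∘ₗ k,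
    hl.comp (φ.quotKerEquivRange.symm.surjective.comp hk)⟩

variable {𝔤 : Type u} [LieRing 𝔤] [LieAlgebra ℂ 𝔤] [FiniteDimensional ℂ 𝔤]
  [LieAlgebra.IsKilling ℂ 𝔤] {H : LieSubalgebra ℂ 𝔤} [H.IsCartanSubalgebra]
  {A : Type v} [CommRing A] [Algebra ℂ A] [Algebra (SymmetricAlgebra ℂ H) A] [IsLocalRing A]
  {b : (LieAlgebra.IsKilling.rootSystem H).Base}
  {σ : Affine 𝔤 →ₗ[ℂ] Affine 𝔤}
  {M : Type w} [AddCommGroup M] [Module A M] [Module (UA 𝔤 A) M] [IsScalarTower A (UA 𝔤 A) M]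
  {γ μ : WeightHat H}

lemma le_ker_vermaToSimple {X : Submodule (UA 𝔤 A) (VermaRes A b μ)} (hX : X ≠ ⊤) :
    X ≤ LinearMap.ker (vermaToSimple A b μ) := by
  let X' : Submodule (UA 𝔤 (IsLocalRing.ResidueField A)) (Verma (IsLocalRing.ResidueField A) b μ) :=
    { carrier := {x | toVermaRes x ∈ X}
      add_mem' := X.add_mem
      zero_mem' := X.zero_mem
      smul_mem' := fun u x hx => by
        obtain ⟨u, rfl⟩ := residueMap_surjective u
        exact X.smul_mem u hx }
  have hX' : X' ≠ ⊤ := fun h => hX (eq_top_iff.mpr fun x _ => by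
    obtain ⟨x, rfl⟩ : ∃ y, toVermaRes y = x := ⟨x, rfl⟩
    have : x ∈ X' := h ▸ Submodule.mem_top
    exact this)
  intro x hx
  exact (Submodule.Quotient.mk_eq_zero _).mpr
    (le_sSup (show X' ∈ {N : Submodule (UA 𝔤 (IsLocalRing.ResidueField A))
      (Verma (IsLocalRing.ResidueField A) b μ) | N ≠ ⊤} from hX') hx)

/-- In the dual, a functional that factors through the simple quotient lies in the submodule
generated by any nonzero functional that is a highest weight vector. -/
lemma mem_span_dual [IsNoetherianRing A] (hσ : IsChevalley H σ) (hM : IsWeightModule H A M)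
    (hfg : (weightSpace A M μ).FG) {φ : DualMod hσ A M} (hφ : IsHW b A γ φ) (hφ0 : φ ≠ 0)
    {f : DualMod hσ A M} (hfμ : ∀ κ ≠ μ, ∀ m ∈ weightSpace A M κ, ofDual f m = 0)
    (hf : ∀ X : Submodule (UA 𝔤 A) M, X ≠ ⊤ → ∀ m ∈ X, ofDual f m = 0) :
    f ∈ Submodule.span (UA 𝔤 A) {φ} := by
  have hfin : Module.Finite A (weightSpace A M μ) := Module.Finite.iff_fg.mpr hfg
  set W := Submodule.span (UA 𝔤 A) {φ} with hW
  let r : DualMod hσ A M →ₗ[A] weightSpace A M μ →ₗ[A] IsLocalRing.ResidueField A :=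
    (weightSpace A M μ).subtype.lcomp A (IsLocalRing.ResidueField A) ∘ₗ ofDual
  have hr : r f ∈ (toA W).map r := by
    refine mem_of_forall_functional_eq_zero fun m hm => ?_
    -- The annihilator of `W` in `M`. It is stable because `σ` is onto and proper because `φ ≠ 0`,
    -- so `f` vanishes on it. Double annihilation on the weight space of `μ` then finds `g ∈ W`
    -- agreeing with `f` there.
    let S : Submodule A M :=
      { carrier := {m | ∀ g ∈ W, ofDual g m = 0}
        add_mem' := fun hx hy g hg => by rw [map_add, hx g hg, hy g hg, add_zero]
        zero_mem' := fun g _ => map_zero _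
        smul_mem' := fun a x hx g hg => by rw [map_smul, hx g hg, smul_zero] }
    have hS : ∀ x : Affine 𝔤, ∀ m ∈ S, inc A x • m ∈ S := by
      intro x m hm g hg
      obtain ⟨y, rfl⟩ := hσ.surjective x
      rw [← ofDual_inc_smul]
      exact hm _ (W.smul_mem _ hg)
    refine hf (stableSub S hS) (fun htop => hφ0 (dual_ext fun x => ?_)) m fun g hg =>
      hm (r g) ⟨g, hg, rfl⟩
    have hx : x ∈ stableSub S hS := htop ▸ Submodule.mem_top
    rw [map_zero, LinearMap.zero_apply]
    exact hx φ (Submodule.mem_span_singleton_self φ)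
  obtain ⟨g, hg, hgf⟩ := hr
  -- The full dual need not be a weight module, but `W` is one, being generated by a highest weight
  -- vector. So the component of `g` of weight `μ` lies in `W`, and it equals `f`.
  have hWw : IsWeightModule H A W :=
    (hφ.restrict W (Submodule.mem_span_singleton_self φ)).isWeightModule hσ (span_mk_eq_top φ)
  have hproj : ∀ w : W, ∀ m ∈ weightSpace A M μ,
      ofDual (wproj hWw μ w : DualMod hσ A M) m = ofDual (w : DualMod hσ A M) m := by
    intro w
    refine hWw.induction (p := fun w => ∀ m ∈ weightSpace A M μ,
      ofDual (wproj hWw μ w : DualMod hσ A M) m = ofDual (w : DualMod hσ A M) m) ?_ ?_ ?_ w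
    · intro ν w hw m hm
      by_cases hν : ν = μ
      · subst hν
        rw [wproj_self hWw hw]
      · rw [wproj_of_ne hWw hν hw, ofDual_eq_zero_of_ne hν (coe_mem_weightSpace.mpr hw) hm,
          ZeroMemClass.coe_zero, map_zero, LinearMap.zero_apply]
    · intro m _
      rw [map_zero]
    · intro w w' hw hw' m hm
      rw [map_add, Submodule.coe_add, map_add, LinearMap.add_apply, hw m hm, hw' m hm,
        Submodule.coe_add, map_add, LinearMap.add_apply]
  have hfg' : f = (wproj hWw μ ⟨g, hg⟩ : W) := dual_ext fun m => by
    refine hM.induction (p := fun m => ofDual f m =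
      ofDual ((wproj hWw μ ⟨g, hg⟩ : W) : DualMod hσ A M) m) ?_ ?_ ?_ m
    · intro κ m hm
      by_cases hκ : κ = μ
      · subst hκ
        rw [hproj _ m hm]
        exact (LinearMap.congr_fun hgf ⟨m, hm⟩).symm
      · rw [hfμ κ hκ m hm, ofDual_eq_zero_of_ne (Ne.symm hκ)
          (coe_mem_weightSpace.mpr (wproj_mem hWw μ _)) hm]
    · rw [map_zero, map_zero]
    · intro m n hm hn
      rw [map_add, map_add, hm, hn]
  rw [hfg']
  exact Submodule.coe_mem _

/-- If `M` has the unique simple quotient `L_A(μ)`, and `γ` is a maximal weight of `M`, then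
`L_A(μ)` occurs in the Verma module of highest weight `γ`. -/
lemma vermaLinked_of_maximal [IsNoetherianRing A] [IsScalarTower ℂ (SymmetricAlgebra ℂ H) A]
    (hσ : IsChevalley H σ) (hM : IsWeightModule H A M)
    (hfg : ∀ κ : WeightHat H, (weightSpace A M κ).FG)
    {d : M →ₗ[UA 𝔤 A] SimpleMod A b μ} (hd : Function.Surjective d)
    (hker : ∀ X : Submodule (UA 𝔤 A) M, X ≠ ⊤ → X ≤ LinearMap.ker d)
    (hγ : weightSpace A M γ ≠ ⊥) (hmax : ∀ κ, wLE b γ κ → κ ≠ γ → weightSpace A M κ = ⊥) :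
    VermaLinked A b γ μ := by
  have hnt : Nontrivial (weightSpace A M γ) := (Submodule.nontrivial_iff_ne_bot).mpr hγ
  have hfin : Module.Finite A (weightSpace A M γ) := Module.Finite.iff_fg.mpr (hfg γ)
  obtain ⟨φ, hφ⟩ := exists_functional_ne_zero (A := A) (V := weightSpace A M γ)
  have hφW : IsHW b A γ (toDual hσ (extendWeight hM φ)) := isHW_dual
    (fun x hx m => apply_negative_smul_eq_zero hσ hM hmax
      (fun κ hκ m hm => extendWeight_of_ne hM φ hκ hm) hx m)
    (fun h m => apply_cartan_smul hM (fun κ hκ m hm => extendWeight_of_ne hM φ hκ hm) h m)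
  have hφ0 : toDual hσ (extendWeight hM φ) ≠ 0 := fun h => hφ (LinearMap.ext fun m => by
    rw [← extendWeight_apply hM φ]
    exact LinearMap.congr_fun h (m : M))
  have hL : IsWeightModule H A (SimpleMod A b μ) :=
    isHW_simpleVec.isWeightModule hσ span_simpleVec
  have hLμ := isHW_simpleVec.weightSpace_eq (A := A) (b := b) (lam := μ) hσ span_simpleVec
  have hntL : Nontrivial (weightSpace A (SimpleMod A b μ) μ) :=
    (Submodule.nontrivial_iff_ne_bot).mpr ((Submodule.ne_bot_iff _).mpr
      ⟨_, isHW_simpleVec.weight, simpleVec_ne_zero hσ⟩)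
  have hfinL : Module.Finite A (weightSpace A (SimpleMod A b μ) μ) :=
    Module.Finite.iff_fg.mpr (hLμ ▸ Submodule.fg_span_singleton _)
  -- The pullback of `ℓ` along `d` is a highest weight vector of weight `μ` in the dual and vanishes
  -- on all proper submodules of `M`.
  obtain ⟨ℓ, hℓ⟩ := exists_functional_ne_zero (A := A) (V := weightSpace A (SimpleMod A b μ) μ)
  have hmaxL : ∀ κ, wLE b μ κ → κ ≠ μ → weightSpace A (SimpleMod A b μ) κ = ⊥ := fun κ h hne => by
    by_contra h'
    exact hne (wLE_antisymm b (isHW_simpleVec.wLE_of_ne_bot hσ span_simpleVec h') h)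
  let f : DualMod hσ A M := toDual hσ (extendWeight hL ℓ ∘ₗ mapA d)
  have hfW : IsHW b A μ f := isHW_dual
    (fun x hx m => by
      show extendWeight hL ℓ (d (inc A (σ x) • m)) = 0
      rw [map_smul]
      exact apply_negative_smul_eq_zero hσ hL hmaxL
        (fun κ hκ m hm => extendWeight_of_ne hL ℓ hκ hm) hx (d m))
    (fun h m => by
      show extendWeight hL ℓ (d (inc A (cartanIncl h) • m)) = _ • extendWeight hL ℓ (d m)
      rw [map_smul]
      exact apply_cartan_smul hL (fun κ hκ m hm => extendWeight_of_ne hL ℓ hκ hm) h (d m))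
  have hf0 : f ≠ 0 := fun h => hℓ (LinearMap.ext fun x => by
    obtain ⟨m, hm⟩ := hd x
    rw [← extendWeight_apply hL ℓ, ← hm]
    exact LinearMap.congr_fun h m)
  have hmem := mem_span_dual hσ hM (hfg μ) hφW hφ0 (f := f)
    (fun κ hκ m hm => extendWeight_of_ne hL ℓ hκ (map_mem_weightSpace d hm))
    (fun X hX m hm => by
      have : d m = 0 := hker X hX hm
      show extendWeight hL ℓ (d m) = 0
      rw [this, map_zero])
  obtain ⟨h, hh⟩ := exists_hom_vermaRes hφW fun a ha => maximalIdeal_smul_dual ha _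
  obtain ⟨k, hk⟩ := exists_hom_vermaRes hfW fun a ha => maximalIdeal_smul_dual ha _
  have hrange : ∀ {ν : WeightHat H} (h : VermaRes A b ν →ₗ[UA 𝔤 A] DualMod hσ A M),
      LinearMap.range h = Submodule.span (UA 𝔤 A) {h (vermaVec A b ν)} := fun h => by
    rw [← Set.image_singleton, Submodule.span_image, span_vermaVec, Submodule.map_top]
  rw [vermaLinked_iff]
  -- The Verma module of `γ` maps onto the submodule generated by the first functional, which
  -- contains the nonzero image of the Verma module of `μ`.
  refine isSubquotient_of_range_le (h := h) (φ := k) vermaToSimple_surjective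
    (le_ker_vermaToSimple fun htop => hf0 ?_) ?_
  · rw [← hk, LinearMap.ker_eq_top.mp htop, LinearMap.zero_apply]
  · rw [hrange k, hrange h, hk, hh, Submodule.span_singleton_le_iff_mem]
    exact hmem

end Duality

/-! ## Comparison of the two relations -/

section Linkage

variable {𝔤 : Type u} [LieRing 𝔤] [LieAlgebra ℂ 𝔤] [FiniteDimensional ℂ 𝔤]
  [LieAlgebra.IsKilling ℂ 𝔤] {H : LieSubalgebra ℂ 𝔤} [H.IsCartanSubalgebra]
  {A : Type v} [CommRing A] [Algebra ℂ A] [Algebra (SymmetricAlgebra ℂ H) A] [IsLocalRing A]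
  [IsScalarTower ℂ (SymmetricAlgebra ℂ H) A] [IsNoetherianRing A]
  {b : (LieAlgebra.IsKilling.rootSystem H).Base} {J : Set (WeightHat H)}
  {σ : Affine 𝔤 →ₗ[ℂ] Affine 𝔤} {lam μ γ : WeightHat H}

/-- A lift of the projection to the simple quotient along a Verma module is surjective. -/
lemma surjective_of_vermaToSimple_comp (hσ : IsChevalley H σ) {P : Type w} [AddCommGroup P]
    [Module A P] [Module (UA 𝔤 A) P] [IsScalarTower A (UA 𝔤 A) P]
    {h : P →ₗ[UA 𝔤 A] VermaRes A b lam}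
    (hs : Function.Surjective (vermaToSimple A b lam ∘ₗ h)) : Function.Surjective h := by
  by_contra hne
  have hle := le_ker_vermaToSimple (X := LinearMap.range h)
    fun htop => hne (LinearMap.range_eq_top.mp htop)
  obtain ⟨x, hx⟩ := hs (simpleVec A b lam)
  have h0 : vermaToSimple A b lam (h x) = 0 := hle ⟨x, rfl⟩
  exact simpleVec_ne_zero hσ (hx.symm.trans h0)

/-- A subquotient of a Verma module gives a homomorphism between projective covers. -/
lemma projLinked_of_vermaLinked (hσ : IsChevalley H σ) (h : VermaLinked A b lam μ) :
    ProjLinked A b μ lam := by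
  have hsimple := isSimpleModule_simpleMod (A := A) (b := b) (lam := μ) hσ
  obtain ⟨X, f, hf⟩ := isSubquotient_iff.mp (vermaLinked_iff.mp h)
  have hJ := isOpenSet_Iic b lam
  have hJ' := isLocallyBounded_Iic b lam
  have hlam : lam ∈ {μ | wLE b μ lam} := wLE_refl b lam
  have hV := inCatO_vermaRes (A := A) hσ hJ hJ' hlam
  have hX := hV.submodule hJ' X
  have hμ : μ ∈ {μ | wLE b μ lam} := by
    obtain ⟨x, hx, hfx⟩ := exists_weight_lift hX.isWeight f hf
      (isHW_simpleVec (A := A) (b := b) (lam := μ)).weight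
    refine hX.weights μ ((Submodule.ne_bot_iff _).mpr ⟨x, hx, ?_⟩)
    rintro rfl
    rw [map_zero] at hfx
    exact simpleVec_ne_zero hσ hfx.symm
  obtain ⟨P, _, _, _, _, c, hP⟩ := hasProjCover (A := A) hσ hJ hJ' hμ
  obtain ⟨Q, _, _, _, _, d, hQ⟩ := hasProjCover (A := A) hσ hJ hJ' hlam
  obtain ⟨p, hp⟩ := hQ.projective _ _ hV (inCatO_simpleMod hσ hJ hJ' hlam) (vermaToSimple A b lam) d
    vermaToSimple_surjective
  have hps := surjective_of_vermaToSimple_comp hσ (h := p) (hp ▸ hQ.surjective)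
  obtain ⟨k, hk⟩ := hP.projective _ _ hX (inCatO_simpleMod hσ hJ hJ' hμ) f c hf
  -- The lift `F` is nonzero because `f ∘ k` is the cover of `L_A(μ)`.
  obtain ⟨F, hF⟩ := hP.projective _ _ hQ.mem hV p (X.subtype ∘ₗ k) hps
  refine ⟨_, hJ, hJ', hμ, hlam, P, _, _, _, _, c, Q, _, _, _, _, d, hP, hQ, F, ?_⟩
  rintro rfl
  obtain ⟨x, hx⟩ := hP.surjective (simpleVec A b μ)
  have h1 : (k x : VermaRes A b lam) = 0 := by
    have := LinearMap.congr_fun hF x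
    rw [LinearMap.comp_apply, LinearMap.zero_apply, map_zero] at this
    exact this.symm
  have h2 : k x = 0 := Subtype.ext h1
  have h3 : f (k x) = c x := LinearMap.congr_fun hk x
  rw [h2, map_zero, hx] at h3
  exact simpleVec_ne_zero hσ h3.symm

/-- A submodule that is maximal among those not containing a given nonzero element. -/
lemma exists_maximal_notMem {R M : Type*} [Ring R] [AddCommGroup M] [Module R M] {x : M}
    (hx : x ≠ 0) : ∃ Z : Submodule R M, x ∉ Z ∧ ∀ Y, Z < Y → x ∈ Y := by
  obtain ⟨Z, -, hZ⟩ := zorn_le_nonempty₀ {Z : Submodule R M | x ∉ Z} (fun c hc hchain y hy => by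
    refine ⟨sSup c, fun hxc => ?_, fun z hz => le_sSup hz⟩
    obtain ⟨z, hz, hxz⟩ := (Submodule.mem_sSup_of_directed ⟨y, hy⟩ hchain.directedOn).mp hxc
    exact hc hz hxz) ⊥ (fun h => hx ((Submodule.mem_bot R).mp h))
  refine ⟨Z, hZ.prop, fun Y hY => ?_⟩
  by_contra h
  exact hY.not_ge (hZ.le_of_ge h hY.le)

/-- If every nonzero submodule of `M` contains a nonzero weight vector `x`, and the weight space of
`x` is finitely generated, then `M` is killed by a power of the maximal ideal. -/
lemma exists_pow_smul_eq_bot {M : Type w} [AddCommGroup M] [Module A M] [Module (UA 𝔤 A) M]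
    [IsScalarTower A (UA 𝔤 A) M] (hM : IsWeightModule H A M) {x : M}
    (hx : x ∈ weightSpace A M lam) (hx0 : x ≠ 0)
    (hsoc : ∀ Y : Submodule (UA 𝔤 A) M, Y ≠ ⊥ → x ∈ Y) (hfg : (weightSpace A M lam).FG) :
    ∃ n : ℕ, (IsLocalRing.maximalIdeal A ^ n • ⊤ : Submodule A M) = ⊥ := by
  by_contra hne
  push Not at hne
  have hfin : Module.Finite A (weightSpace A M lam) := Module.Finite.iff_fg.mpr hfg
  have hst : ∀ (n : ℕ) (z : Affine 𝔤),
      ∀ m ∈ (IsLocalRing.maximalIdeal A ^ n • ⊤ : Submodule A M),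
        inc A z • m ∈ (IsLocalRing.maximalIdeal A ^ n • ⊤ : Submodule A M) := by
    intro n z m hm
    have h1 : act A M (inc A z) m ∈
        (IsLocalRing.maximalIdeal A ^ n • ⊤ : Submodule A M).map (act A M (inc A z)) := ⟨m, hm, rfl⟩
    rw [Submodule.map_smul''] at h1
    exact Submodule.smul_mono le_rfl le_top h1
  -- A nonzero `𝔪ⁿM` is a submodule for `A ⊗ U`, so it contains `x`; the weight projection puts `x`
  -- into `𝔪ⁿ` times its weight space. Krull's intersection theorem there gives `x = 0`.
  have hxn : ∀ n : ℕ, (⟨x, hx⟩ : weightSpace A M lam) ∈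
      (IsLocalRing.maximalIdeal A ^ n • ⊤ : Submodule A (weightSpace A M lam)) := by
    intro n
    have h1 : x ∈ (IsLocalRing.maximalIdeal A ^ n • ⊤ : Submodule A M) :=
      hsoc (stableSub _ (hst n)) fun h => hne n (by
        rw [eq_bot_iff]
        intro m hm
        have : m ∈ stableSub _ (hst n) := hm
        rw [h] at this
        exact this)
    have h2 : wproj hM lam x ∈
        (IsLocalRing.maximalIdeal A ^ n • ⊤ : Submodule A M).map (wproj hM lam) := ⟨x, h1, rfl⟩
    rw [wproj_self hM hx, Submodule.map_smul''] at h2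
    have h3 : (⊤ : Submodule A M).map (wproj hM lam) ≤
        (⊤ : Submodule A (weightSpace A M lam)).map (weightSpace A M lam).subtype := by
      rintro _ ⟨m, -, rfl⟩
      exact ⟨⟨_, wproj_mem hM lam m⟩, trivial, rfl⟩
    have h4 := Submodule.smul_mono (le_refl (IsLocalRing.maximalIdeal A ^ n)) h3 h2
    rw [← Submodule.map_smul''] at h4
    obtain ⟨y, hy, hyx⟩ := h4
    rwa [show y = ⟨x, hx⟩ from Subtype.ext hyx] at hy
  have hbot := (IsLocalRing.maximalIdeal A).iInf_pow_smul_eq_bot_of_isLocalRing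
    (M := weightSpace A M lam) (IsLocalRing.maximalIdeal.isMaximal A).ne_top
  have hmem : (⟨x, hx⟩ : weightSpace A M lam) ∈
      (⨅ n : ℕ, IsLocalRing.maximalIdeal A ^ n • ⊤ : Submodule A (weightSpace A M lam)) :=
    (Submodule.mem_iInf _).mpr hxn
  rw [hbot, Submodule.mem_bot] at hmem
  exact hx0 (congrArg Subtype.val hmem)

/-- In a module killed by a power of the maximal ideal, every nonzero vector has a nonzero multiple
that is killed by the maximal ideal. -/
lemma exists_smul_ne_zero {R M : Type*} [CommRing R] [IsLocalRing R] [AddCommGroup M] [Module R M]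
    {n : ℕ} {y : M} (hy : y ≠ 0)
    (hn : (IsLocalRing.maximalIdeal R ^ n • ⊤ : Submodule R M) = ⊥) :
    ∃ a : R, a • y ≠ 0 ∧ ∀ c ∈ IsLocalRing.maximalIdeal R, c • a • y = 0 := by
  classical
  have hex : ∃ n : ℕ, ∀ a ∈ IsLocalRing.maximalIdeal R ^ n, a • y = 0 := ⟨n, fun a ha => by
    have : a • y ∈ (IsLocalRing.maximalIdeal R ^ n • ⊤ : Submodule R M) :=
      Submodule.smul_mem_smul ha trivial
    rwa [hn, Submodule.mem_bot] at this⟩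
  have hspec := Nat.find_spec hex
  have hpos : Nat.find hex ≠ 0 := fun h => by
    rw [h, pow_zero] at hspec
    exact hy (by simpa using hspec 1 (by simp))
  -- With `k + 1` the least exponent such that `𝔪^(k+1) y = 0`, some `a ∈ 𝔪^k` has `a y ≠ 0`, and
  -- then `𝔪 a y = 0`.
  obtain ⟨k, hk⟩ := Nat.exists_eq_succ_of_ne_zero hpos
  have hmin := Nat.find_min hex (m := k) (by omega)
  push Not at hmin
  obtain ⟨a, ha, hay⟩ := hmin
  refine ⟨a, hay, fun c hc => ?_⟩
  rw [smul_smul]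
  apply hspec
  rw [hk, pow_succ']
  exact Ideal.mul_mem_mul hc ha

/-- A projective cover is generated by a weight vector. -/
lemma IsProjCover.exists_generator (hσ : IsChevalley H σ) (hJ : IsLocallyBounded b J)
    {P : Type (max u v)} [AddCommGroup P] [Module A P] [Module (UA 𝔤 A) P]
    [IsScalarTower A (UA 𝔤 A) P] {c : P →ₗ[UA 𝔤 A] SimpleMod A b lam}
    (hP : IsProjCover A b J lam P c) : ∃ x ∈ weightSpace A P lam, c x = simpleVec A b lam ∧
      Submodule.span (UA 𝔤 A) {x} = ⊤ := by
  obtain ⟨x, hx, hcx⟩ := exists_weight_lift hP.mem.isWeight c hP.surjective isHW_simpleVec.weight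
  refine ⟨x, hx, hcx, ?_⟩
  by_contra hne
  have h0 : c x = 0 := hP.le_ker hσ hJ hne (Submodule.mem_span_singleton_self x)
  exact simpleVec_ne_zero hσ (hcx.symm.trans h0)

/-- A homomorphism between projective covers gives a Verma module that contains both simple
modules. -/
lemma exists_vermaLinked_of_projLinked (hσ : IsChevalley H σ) (h : ProjLinked A b lam μ) :
    ∃ γ, VermaLinked A b γ lam ∧ VermaLinked A b γ μ := by
  obtain ⟨J, hJ, hJ', hlam, hμ, P, _, _, _, _, c, Q, _, _, _, _, d, hP, hQ, f, hf⟩ := h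
  obtain ⟨p, hp, hcp, hptop⟩ := hP.exists_generator hσ hJ'
  obtain ⟨q, hq, hdq, hqtop⟩ := hQ.exists_generator hσ hJ'
  have hfp : f p ≠ 0 := fun h => hf (hom_ext_of_span hptop (h.trans (LinearMap.zero_apply p).symm))
  -- Modulo `Z` the image of `f p` lies in every nonzero submodule, while the unique simple quotient
  -- `L_A(μ)` is kept.
  obtain ⟨Z, hxZ, hZ⟩ := exists_maximal_notMem (R := UA 𝔤 A) hfp
  have hZtop : Z ≠ ⊤ := fun h => hxZ (h ▸ Submodule.mem_top)
  have hM := hQ.mem.of_surjective hJ' Z.mkQ Z.mkQ_surjective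
  let dM : (Q ⧸ Z) →ₗ[UA 𝔤 A] SimpleMod A b μ := Z.liftQ d (hQ.le_ker hσ hJ' hZtop)
  have hdM : Function.Surjective dM := fun y => by
    obtain ⟨x, rfl⟩ := hQ.surjective y
    exact ⟨Z.mkQ x, rfl⟩
  have hker : ∀ X : Submodule (UA 𝔤 A) (Q ⧸ Z), X ≠ ⊤ → X ≤ LinearMap.ker dM := by
    intro X hX x hx
    obtain ⟨x, rfl⟩ := Z.mkQ_surjective x
    refine hQ.le_ker hσ hJ' (X := X.comap Z.mkQ) (fun h => hX (eq_top_iff.mpr fun y _ => ?_)) hx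
    obtain ⟨y, rfl⟩ := Z.mkQ_surjective y
    have : y ∈ X.comap Z.mkQ := h ▸ Submodule.mem_top
    exact this
  have hqM := map_mem_weightSpace Z.mkQ hq
  have hqMtop : Submodule.span (UA 𝔤 A) {Z.mkQ q} = ⊤ := by
    rw [← Set.image_singleton, Submodule.span_image, hqtop, Submodule.map_top, Submodule.range_mkQ]
  have hfg : ∀ κ : WeightHat H, (weightSpace A (Q ⧸ Z) κ).FG := fun κ => by
    have h1 := weightSpace_span_fg hσ hJ' hM.isWeight hM.weights hqM κ
    rw [hqMtop] at h1
    have h2 : toA (⊤ : Submodule (UA 𝔤 A) (Q ⧸ Z)) = ⊤ := rfl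
    rwa [h2, top_inf_eq] at h1
  let φ : P →ₗ[UA 𝔤 A] Q ⧸ Z := Z.mkQ ∘ₗ f
  have hx0 : φ p ≠ 0 := fun h => hxZ ((Submodule.Quotient.mk_eq_zero Z).mp h)
  have hx : φ p ∈ weightSpace A (Q ⧸ Z) lam := map_mem_weightSpace φ hp
  have hsoc : ∀ Y : Submodule (UA 𝔤 A) (Q ⧸ Z), Y ≠ ⊥ → φ p ∈ Y := by
    intro Y hY
    refine hZ (Y.comap Z.mkQ) (lt_of_le_of_ne ?_ fun h => hY ?_)
    · intro z hz
      rw [Submodule.mem_comap, Submodule.mkQ_apply, (Submodule.Quotient.mk_eq_zero Z).mpr hz]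
      exact zero_mem Y
    · rw [eq_bot_iff]
      intro y hy
      obtain ⟨y, rfl⟩ := Z.mkQ_surjective y
      have h1 : y ∈ Y.comap Z.mkQ := hy
      rw [← h] at h1
      exact (Submodule.Quotient.mk_eq_zero Z).mpr h1
  have hμbot : weightSpace A (Q ⧸ Z) lam ≠ ⊥ := (Submodule.ne_bot_iff _).mpr ⟨_, hx, hx0⟩
  obtain ⟨γ, -, hγ, hmax⟩ := exists_maximal_weight hJ' hM.weights hμbot
  refine ⟨γ, ?_, vermaLinked_of_maximal hσ hM.isWeight hfg hdM hker hγ hmax⟩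
  obtain ⟨y, hy, hy0⟩ := (Submodule.ne_bot_iff _).mp hγ
  obtain ⟨n, hn⟩ := exists_pow_smul_eq_bot hM.isWeight hx hx0 hsoc (hfg lam)
  -- The universal property of the Verma module over the residue field requires a highest weight
  -- vector killed by the maximal ideal; `a y` is one.
  obtain ⟨a, hay, ha⟩ := exists_smul_ne_zero hy0 hn
  obtain ⟨h, hh⟩ := exists_hom_vermaRes ((isHW_of_maximal hy hmax).smul a) ha
  rw [vermaLinked_iff]
  refine isSubquotient_of_range_le (h := h) (φ := φ) hP.surjective
    (hP.le_ker hσ hJ' fun htop => hx0 ?_) ?_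
  · rw [LinearMap.ker_eq_top.mp htop, LinearMap.zero_apply]
  · rw [← Submodule.map_top φ, ← hptop, ← Submodule.span_image, Set.image_singleton,
      Submodule.span_singleton_le_iff_mem]
    exact hsoc _ fun h0 => hay (by
      have h1 : h (vermaVec A b γ) ∈ LinearMap.range h := ⟨_, rfl⟩
      rw [h0, Submodule.mem_bot, hh] at h1
      exact h1)

variable (A b) in
lemma vermaRel_eq_blockRel (hσ : IsChevalley H σ) : vermaRel A b = blockRel A b := by
  refine le_antisymm (fun x y h => ?_) (fun x y h => ?_)
  · refine Relation.EqvGen.rec (motive := fun x y _ => Relation.EqvGen (ProjLinked A b) x y) ?_ ?_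
      ?_ ?_ h
    · exact fun x y hxy => .symm _ _ (.rel _ _ (projLinked_of_vermaLinked hσ hxy))
    · exact fun x => .refl x
    · exact fun x y _ h => .symm _ _ h
    · exact fun x y z _ _ h h' => .trans _ _ _ h h'
  · refine Relation.EqvGen.rec (motive := fun x y _ => Relation.EqvGen (VermaLinked A b) x y) ?_ ?_
      ?_ ?_ h
    · intro x y hxy
      obtain ⟨γ, h1, h2⟩ := exists_vermaLinked_of_projLinked hσ hxy
      -- The two weights are joined through the common Verma module of highest weight `γ`.
      exact .trans _ _ _ (.symm _ _ (.rel _ _ h1)) (.rel _ _ h2)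
    · exact fun x => .refl x
    · exact fun x y _ h => .symm _ _ h
    · exact fun x y z _ _ h h' => .trans _ _ _ h h'

end Linkage

end AffineKM

end

theorem mainTheorem6 {𝔤 : Type u} [LieRing 𝔤] [LieAlgebra ℂ 𝔤] [FiniteDimensional ℂ 𝔤]
    [LieAlgebra.IsSimple ℂ 𝔤] (H : LieSubalgebra ℂ 𝔤) [H.IsCartanSubalgebra]
    (b : (LieAlgebra.IsKilling.rootSystem H).Base)
    (A : Type v) [CommRing A] [Algebra ℂ A] [Algebra (SymmetricAlgebra ℂ H) A]
    [IsScalarTower ℂ (SymmetricAlgebra ℂ H) A] [IsNoetherianRing A] [IsLocalRing A] :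
    AffineKM.vermaRel A b = AffineKM.blockRel A b := by
  obtain ⟨σ, hσ⟩ := AffineKM.exists_isChevalley b
  exact AffineKM.vermaRel_eq_blockRel A b hσ
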